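/- Let $\Omega\subset\mathbb{R}^2$ be open, connected and bounded with $C^\infty$ boundary, and let $\Omega_K\subsetneq\Omega$ be relatively closed in $\Omega$, of positive Lebesgue measure, with $C^\infty$ boundary, such that $\partial\Omega\cap\partial\Omega_K=\emptyset$ (a set has $C^\infty$ boundary if near each boundary point it lies exactly on one side of a smooth curve). Put $U=\Omega\setminus\Omega_K$. Let $f$ be $C^\infty$ on $\Omega$ up to the boundary, and let $c$ map $\Omega$ to $[0,1]$ with $c=1$ on $\Omega_K$ and $c<1$ almost everywhere in $U$. Assume that $c$ has a weak gradient in $L^1_{\mathrm{loc}}(U)$ and that, for some constant $\kappa>0$, $|\partial_x c|\le\kappa\sqrt{c(1-c)}$ and $|\partial_y c|\le\kappa\sqrt{c(1-c)}$ almost everywhere in $U$. A function $u$ on $U$ has trace $a$ at $x\in\partial U$ if the mean value of $|u-a|$ over $B(x,r)\cap U$ tends to $0$ as $r\to0$; boundary integrals are taken with respect to arc length $ds$. Let $V$ be the space of all $\varphi\in L^2(U)$ that have a weak gradient $\nabla\varphi\in L^1_{\mathrm{loc}}(U)$ with $\int_U(1-c)|\nabla\varphi|^2\,dx<\infty$ and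 that have trace $0$ at almost every point of $\partial\Omega_K$, with the norm $$\|\varphi\|_V=\Big(\int_U(1-c)|\nabla\varphi|^2+\varphi^2\,dx\Big)^{1/2}.$$ Let $g$ be a function on $U$ (for instance $g=(1-c)\Delta f$), let $h=-\partial_n f$ on $\partial\Omega$, where $n$ is the outer unit normal of $\Omega$, and $$F(\varphi)=\int_{U}g\,\varphi\,dx+\int_{\partial\Omega\setminus\partial\Omega_K}h\,\varphi\,ds ,\qquad \varphi\in V .$$ Suppose that $g$, $\Delta f$ and $\nabla f/\sqrt{1-c}$ belong to $L^2(U)$. Then $F$ is well defined on $V$: for every $\varphi\in V$ the function $g\varphi$ is integrable over $U$, $\varphi$ has a trace at almost every point of $\partial\Omega\setminus\partial\Omega_K$ at which $h\ne0$, and $h\varphi$ (understood as $0$ where $h=0$) is integrable over $\partial\Omega\setminus\partial\Omega_K$. Moreover $F$ is a bounded linear functional on $V$, and $$\|F\|_{V^*}\le\|g\|_{L^2(U)}+\|\Delta f\|_{L^2(U)}+\Big\|\frac{\nabla f}{\sqrt{1-c}}\Big\|_{L^2(U)} .$$ -/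

import Mathlib

open MeasureTheory Set Filter Topology
open scoped ContDiff RealInnerProductSpace

noncomputable section

/-- The Euclidean plane. -/
abbrev Plane : Type := EuclideanSpace ℝ (Fin 2)

/-- `ρ` is a smooth local defining function of `S` at `x`: the differential of `ρ` does not vanish
at `x` and, near `x`, the set `S` lies exactly on the side `ρ < 0` of the curve `ρ = 0`
(which may or may not belong to `S`). -/
structure IsDefiningAt (S : Set Plane) (x : Plane) (ρ : Plane → ℝ) : Prop where
  smooth : ContDiff ℝ ∞ ρ
  gradient_ne_zero : gradient ρ x ≠ 0
  interior_iff : ∀ᶠ y in 𝓝 x, y ∈ interior S ↔ ρ y < 0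
  closure_iff : ∀ᶠ y in 𝓝 x, y ∈ closure S ↔ ρ y ≤ 0

/-- `S` has a boundary of class `C^∞`. -/
def HasSmoothBoundary (S : Set Plane) : Prop :=
  ∀ x ∈ frontier S, ∃ ρ : Plane → ℝ, IsDefiningAt S x ρ

/-- `ν` is the outer unit normal of `S` at the boundary point `x`. -/
def IsOuterNormalAt (S : Set Plane) (x ν : Plane) : Prop :=
  ∃ ρ : Plane → ℝ, IsDefiningAt S x ρ ∧ ν = (‖gradient ρ x‖)⁻¹ • gradient ρ x

open Classical in
/-- The outer unit normal field of `S` (zero where `S` has none). -/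
def outerNormal (S : Set Plane) (x : Plane) : Plane :=
  if h : ∃ ν, IsOuterNormalAt S x ν then h.choose else 0

/-- The derivative of `f` in the direction of the outer unit normal of `S`, at points of the
boundary of `S`, for `f` differentiable up to the boundary. -/
def normalDerivative (S : Set Plane) (f : Plane → ℝ) (x : Plane) : ℝ :=
  fderivWithin ℝ f (closure S) x (outerNormal S x)

/-- `G` is the weak gradient of `u` on the open set `U`. -/
structure HasWeakGradientOn (U : Set Plane) (u : Plane → ℝ) (G : Plane → Plane) : Prop where
  locallyIntegrable : LocallyIntegrableOn u U volume
  locallyIntegrable_grad : LocallyIntegrableOn G U volume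
  integral_eq : ∀ ψ : Plane → ℝ, ContDiff ℝ ∞ ψ → HasCompactSupport ψ → tsupport ψ ⊆ U →
    ∀ v : Plane, ∫ x in U, u x * fderiv ℝ ψ x v = -∫ x in U, ⟪G x, v⟫ * ψ x

/-- The function `u` on `U` has the boundary value (trace) `a` at `x`: the mean of `|u - a|` over
`U ∩ B(x, r)` tends to `0` as `r → 0`. -/
def HasTraceAt (U : Set Plane) (u : Plane → ℝ) (x : Plane) (a : ℝ) : Prop :=
  Tendsto (fun r : ℝ => ⨍ y in Metric.ball x r ∩ U, |u y - a|) (𝓝[>] 0) (𝓝 0)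

open Classical in
/-- The trace of `u` at `x` (zero where there is none). -/
def boundaryTrace (U : Set Plane) (u : Plane → ℝ) (x : Plane) : ℝ :=
  if h : ∃ a, HasTraceAt U u x a then h.choose else 0

/-- Pairs `(u, G)` with `u ∈ L²(U)` and `G ∈ L²(U; 1 - c)`, with the Hilbert norm
`(∫_U u² + (1 - c) |G|²)^(1/2)`. -/
abbrev WeightedPair (U : Set Plane) (c : Plane → ℝ) : Type :=
  WithLp 2 (Lp ℝ 2 (volume.restrict U) ×
    Lp Plane 2 ((volume.restrict U).withDensity fun x => ENNReal.ofReal (1 - c x)))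

theorem integrableOn_mul_test {U : Set Plane} {u ψ : Plane → ℝ}
    (hu : LocallyIntegrableOn u U volume) (hc : Continuous ψ) {K : Set Plane} (hK : IsCompact K)
    (hKU : K ⊆ U) (h0 : ∀ x, x ∉ K → ψ x = 0) :
    IntegrableOn (fun x => u x * ψ x) U volume := by
  have h1 : IntegrableOn (fun x => u x * ψ x) K volume :=
    (hu.integrableOn_compact_subset hKU hK).mul_continuousOn hc.continuousOn hK
  have h2 : IntegrableOn (fun x => u x * ψ x) univ volume :=
    h1.of_forall_sdiff_eq_zero MeasurableSet.univ (fun x hx => by simp [h0 x hx.2])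
  exact h2.mono_set (subset_univ _)

theorem integrableOn_mul_fderiv {U : Set Plane} {u ψ : Plane → ℝ}
    (hu : LocallyIntegrableOn u U volume) (hs : ContDiff ℝ ∞ ψ) (hc : HasCompactSupport ψ)
    (hU : tsupport ψ ⊆ U) (v : Plane) :
    IntegrableOn (fun x => u x * fderiv ℝ ψ x v) U volume := by
  refine integrableOn_mul_test hu ?_ hc hU ?_
  · exact (hs.continuous_fderiv (by simp)).clm_apply continuous_const
  · intro x hx
    have : fderiv ℝ ψ x = 0 := by
      by_contra h
      exact hx (support_fderiv_subset ℝ h)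
    simp [this]

theorem integrableOn_inner_mul {U : Set Plane} {G : Plane → Plane} {ψ : Plane → ℝ}
    (hG : LocallyIntegrableOn G U volume) (hs : ContDiff ℝ ∞ ψ) (hc : HasCompactSupport ψ)
    (hU : tsupport ψ ⊆ U) (v : Plane) :
    IntegrableOn (fun x => ⟪G x, v⟫ * ψ x) U volume := by
  refine integrableOn_mul_test ?_ hs.continuous hc hU (fun x hx => image_eq_zero_of_notMem_tsupport hx)
  intro x hx
  obtain ⟨s, hs, hi⟩ := hG x hx
  exact ⟨s, hs, hi.inner_const v⟩

theorem HasWeakGradientOn.add {U : Set Plane} {u₁ u₂ : Plane → ℝ} {G₁ G₂ : Plane → Plane}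
    (h₁ : HasWeakGradientOn U u₁ G₁) (h₂ : HasWeakGradientOn U u₂ G₂) :
    HasWeakGradientOn U (u₁ + u₂) (G₁ + G₂) where
  locallyIntegrable := h₁.1.add h₂.1
  locallyIntegrable_grad := h₁.2.add h₂.2
  integral_eq ψ hs hc hU v := by
    simp only [Pi.add_apply, add_mul, inner_add_left]
    rw [integral_add (integrableOn_mul_fderiv h₁.1 hs hc hU v)
        (integrableOn_mul_fderiv h₂.1 hs hc hU v),
      integral_add (integrableOn_inner_mul h₁.2 hs hc hU v)
        (integrableOn_inner_mul h₂.2 hs hc hU v),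
      h₁.3 ψ hs hc hU v, h₂.3 ψ hs hc hU v]
    ring

theorem HasWeakGradientOn.smul {U : Set Plane} {u : Plane → ℝ} {G : Plane → Plane}
    (h : HasWeakGradientOn U u G) (t : ℝ) : HasWeakGradientOn U (t • u) (t • G) where
  locallyIntegrable := h.1.smul t
  locallyIntegrable_grad := h.2.smul t
  integral_eq ψ hs hc hU v := by
    simp only [Pi.smul_apply, smul_eq_mul, real_inner_smul_left, mul_assoc]
    rw [integral_const_mul, integral_const_mul, h.3 ψ hs hc hU v]
    ring

theorem HasWeakGradientOn.zero (U : Set Plane) : HasWeakGradientOn U 0 0 where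
  locallyIntegrable := locallyIntegrableOn_zero
  locallyIntegrable_grad := locallyIntegrableOn_zero
  integral_eq := by simp

theorem HasWeakGradientOn.congr {U : Set Plane} {u u' : Plane → ℝ} {G : Plane → Plane}
    (h : HasWeakGradientOn U u G) (hu : u =ᵐ[volume.restrict U] u')
    (hl : LocallyIntegrableOn u' U volume) : HasWeakGradientOn U u' G where
  locallyIntegrable := hl
  locallyIntegrable_grad := h.2
  integral_eq ψ hs hc hU v := by
    rw [← h.3 ψ hs hc hU v]
    refine integral_congr_ae ?_
    filter_upwards [hu] with x hx
    rw [hx]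

theorem locallyIntegrableOn_Lp {U : Set Plane} (u : Lp ℝ 2 (volume.restrict U)) :
    LocallyIntegrableOn u U volume := by
  intro x _
  refine ⟨Metric.ball x 1 ∩ U, inter_mem (mem_nhdsWithin_of_mem_nhds
    (Metric.ball_mem_nhds x one_pos)) self_mem_nhdsWithin, ?_⟩
  rw [IntegrableOn, ← Measure.restrict_restrict measurableSet_ball]
  have : IsFiniteMeasure ((volume.restrict U).restrict (Metric.ball x 1)) := by
    refine ⟨?_⟩
    rw [Measure.restrict_apply_univ]
    exact (Measure.restrict_apply_le _ _).trans_lt measure_ball_lt_top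
  exact ((Lp.memLp u).restrict _).integrable (by norm_num)

theorem integrableOn_ball_Lp {U : Set Plane} (u : Lp ℝ 2 (volume.restrict U)) (x : Plane) (r : ℝ) :
    IntegrableOn u (Metric.ball x r ∩ U) volume := by
  rw [IntegrableOn, ← Measure.restrict_restrict measurableSet_ball]
  have : IsFiniteMeasure ((volume.restrict U).restrict (Metric.ball x r)) := by
    refine ⟨?_⟩
    rw [Measure.restrict_apply_univ]
    exact (Measure.restrict_apply_le _ _).trans_lt measure_ball_lt_top
  exact ((Lp.memLp u).restrict _).integrable (by norm_num)

theorem HasTraceAt.congr {U : Set Plane} {u u' : Plane → ℝ} {x : Plane} {a : ℝ}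
    (h : HasTraceAt U u x a) (hu : u =ᵐ[volume.restrict U] u') : HasTraceAt U u' x a := by
  refine Tendsto.congr (fun r => ?_) h
  refine average_congr ?_
  have := ae_restrict_of_ae (s := Metric.ball x r) hu
  rw [Measure.restrict_restrict measurableSet_ball] at this
  filter_upwards [this] with y hy
  rw [hy]

theorem HasTraceAt.zero (U : Set Plane) (x : Plane) : HasTraceAt U 0 x 0 := by
  simp [HasTraceAt]

theorem HasTraceAt.add {U : Set Plane} {u v : Lp ℝ 2 (volume.restrict U)} {x : Plane} {a b : ℝ}
    (hu : HasTraceAt U u x a) (hv : HasTraceAt U v x b) :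
    HasTraceAt U (u + v : Lp ℝ 2 (volume.restrict U)) x (a + b) := by
  refine HasTraceAt.congr ?_ (Lp.coeFn_add u v).symm
  have hlim := Tendsto.add hu hv
  rw [add_zero] at hlim
  refine squeeze_zero (fun r => ?_) (fun r => ?_) hlim
  · rw [setAverage_eq]
    exact smul_nonneg (by positivity) (integral_nonneg fun _ => abs_nonneg _)
  · have fin : volume (Metric.ball x r ∩ U) ≠ ⊤ :=
      ((measure_mono inter_subset_left).trans_lt measure_ball_lt_top).ne
    have i1 : IntegrableOn (fun y => |u y - a|) (Metric.ball x r ∩ U) volume :=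
      ((integrableOn_ball_Lp u x r).sub (integrableOn_const fin)).abs
    have i2 : IntegrableOn (fun y => |v y - b|) (Metric.ball x r ∩ U) volume :=
      ((integrableOn_ball_Lp v x r).sub (integrableOn_const fin)).abs
    have i3 : IntegrableOn (fun y => |(u + v : Plane → ℝ) y - (a + b)|)
        (Metric.ball x r ∩ U) volume :=
      (((integrableOn_ball_Lp u x r).add (integrableOn_ball_Lp v x r)).sub
        (integrableOn_const fin)).abs
    simp only [setAverage_eq]
    rw [← smul_add, ← integral_add i1 i2]
    refine smul_le_smul_of_nonneg_left (integral_mono i3 (i1.add i2) fun y => ?_) (by positivity)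
    simp only [Pi.add_apply]
    calc |u y + v y - (a + b)| = |(u y - a) + (v y - b)| := by ring_nf
      _ ≤ _ := abs_add_le _ _

theorem HasTraceAt.smul {U : Set Plane} {u : Plane → ℝ} {x : Plane} {a : ℝ}
    (hu : HasTraceAt U u x a) (t : ℝ) : HasTraceAt U (t • u) x (t * a) := by
  have hlim := Tendsto.const_mul |t| hu
  rw [mul_zero] at hlim
  refine Tendsto.congr (fun r => ?_) hlim
  simp only [setAverage_eq, smul_eq_mul, Pi.smul_apply, ← mul_sub, abs_mul, integral_const_mul]
  ring

/-- The space `V` of all `u` in the weighted Sobolev space `W^{1,2}(U; 1, 1 - c, 1 - c)` that vanish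
on `Γ ⊆ ∂U`. An element is the pair of `u` and of its weak gradient, which `u` determines; so the
norm of `V` is `(∫_U (1 - c) |∇u|² + u²)^(1/2)`. -/
def weightedSobolevZero (U Γ : Set Plane) (c : Plane → ℝ) : Submodule ℝ (WeightedPair U c) where
  carrier := {p | (∃ G : Plane → Plane, HasWeakGradientOn U p.fst G ∧
      p.snd =ᵐ[(volume.restrict U).withDensity fun x => ENNReal.ofReal (1 - c x)] G) ∧
    ∀ᵐ x ∂(Measure.hausdorffMeasure 1 : Measure Plane).restrict Γ, HasTraceAt U p.fst x 0}
  zero_mem' := by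
    have h0 : ((0 : Lp ℝ 2 (volume.restrict U)) : Plane → ℝ) =ᵐ[volume.restrict U] 0 :=
      Lp.coeFn_zero _ _ _
    refine ⟨⟨0, (HasWeakGradientOn.zero U).congr h0.symm (locallyIntegrableOn_Lp _), ?_⟩, ?_⟩
    · exact Lp.coeFn_zero _ _ _
    · exact Eventually.of_forall fun x => (HasTraceAt.zero U x).congr h0.symm
  add_mem' := by
    rintro p q ⟨⟨G, hG, hpG⟩, hp⟩ ⟨⟨H, hH, hqH⟩, hq⟩
    refine ⟨⟨G + H, (hG.add hH).congr (Lp.coeFn_add p.fst q.fst).symm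
      (locallyIntegrableOn_Lp _), ?_⟩, ?_⟩
    · exact (Lp.coeFn_add p.snd q.snd).trans (hpG.add hqH)
    · filter_upwards [hp, hq] with x h1 h2
      simpa using h1.add h2
  smul_mem' := by
    rintro t p ⟨⟨G, hG, hpG⟩, hp⟩
    refine ⟨⟨t • G, (hG.smul t).congr (Lp.coeFn_smul t p.fst).symm
      (locallyIntegrableOn_Lp _), ?_⟩, ?_⟩
    · exact (Lp.coeFn_smul t p.snd).trans (hpG.const_smul t)
    · filter_upwards [hp] with x h1
      simpa using (h1.smul t).congr (Lp.coeFn_smul t p.fst).symm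

/-- The function on `U` underlying an element of `V`. -/
def sobolevFun {U Γ : Set Plane} {c : Plane → ℝ} (φ : weightedSobolevZero U Γ c) :
    Plane → ℝ :=
  (φ : WeightedPair U c).fst

/-- The length measure of the Neumann part `∂Ω ∖ ∂Ω_K` of the boundary. -/
def neumannMeasure (Ω ΩK : Set Plane) : Measure Plane :=
  (Measure.hausdorffMeasure 1 : Measure Plane).restrict (frontier Ω \ frontier ΩK)

/-- The right-hand side `F(φ) = ∫_{Ω∖Ω_K} g φ dx + ∫_{∂Ω∖∂Ω_K} h φ ds`, with `h = -∂ₙ f`. -/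
def rhsFunctional (Ω ΩK : Set Plane) (c f g : Plane → ℝ)
    (φ : weightedSobolevZero (Ω \ ΩK) (frontier ΩK) c) : ℝ :=
  (∫ x in Ω \ ΩK, g x * (sobolevFun φ) x) +
    ∫ x, -normalDerivative Ω f x * boundaryTrace (Ω \ ΩK) (sobolevFun φ) x ∂neumannMeasure Ω ΩK

end

/-! ### Traces of integrable functions -/

/-! Put U = Ω ∖ Ω_K. An element φ of V need not have an integrable gradient, because the weight 1 -
c may degenerate, so φ itself need not have a trace. The products φ ∂ᵢf do: their weak gradient is
∂ᵢf ∇φ + φ ∇∂ᵢf, where |∇f||∇φ| = (|∇f|/√(1-c)) · (√(1-c)|∇φ|) is a product of two L² functions and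
the second derivatives of f are bounded. So φ ∂ᵢf is in W^{1,1}(U), and the divergence theorem
`HasWeakGradientOn.green` gives it an integrable trace. Summing over i, and using that φ vanishes on
∂Ω_K, yields ∫ hφ ds = -∫_U (∇f·∇φ + φ Δf), which is `green_formula`. The bound then follows from
Cauchy-Schwarz, with the gradient term paired in the weighted space.

The trace of φ is recovered pointwise in `boundaryTrace_mul`. Where some ∂ᵢf(x) ≠ 0, one divides by
it. Where ∂ᵢf(x) = 0, the factor ∂ᵢf is O(|y - x|), and in the plane this forces trace zero on the
product with any L² function (`hasTraceAt_zero_of_memLp_two`). Hence φ has a trace at almost every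
point where ∂ₙf ≠ 0, and the traces of the products are ∂ᵢf times `boundaryTrace` everywhere
relevant.

The divergence theorem for W^{1,1} is local. Near a boundary point U is the region above a C¹ graph
in an inward direction b. Testing the weak gradient against primitives along b shows that uχ is a.e.
the integral of its b-derivative along lines (`HasWeakGradientOn.mul_ae_eq`). Integrating over whole
lines gives the boundary function, Lebesgue differentiation (`ae_tendsto_box`) makes it a trace, and
Fubini gives the formula in direction b (`IsGraphRegion.hasGreenOn`). Every direction is a
difference of two inward ones, and a partition of unity globalizes. Hausdorff measure on the graph
is computed from its speed (`HasSpeed.hausdorffMeasure_restrict_range`). -/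

theorem volume_ball_inter_ne_top (U : Set Plane) (x : Plane) (r : ℝ) :
    volume (Metric.ball x r ∩ U) ≠ ⊤ :=
  ((measure_mono inter_subset_left).trans_lt measure_ball_lt_top).ne

theorem setAverage_abs_nonneg (S : Set Plane) (u : Plane → ℝ) : 0 ≤ ⨍ y in S, |u y| := by
  rw [setAverage_eq]
  exact smul_nonneg (by positivity) (integral_nonneg fun _ => abs_nonneg _)

theorem HasTraceAt.of_le {U : Set Plane} {u : Plane → ℝ} {x : Plane} {a : ℝ} {b : ℝ → ℝ}
    (hb : Tendsto b (𝓝[>] 0) (𝓝 0))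
    (h : ∀ᶠ r in 𝓝[>] (0 : ℝ), ⨍ y in Metric.ball x r ∩ U, |u y - a| ≤ b r) :
    HasTraceAt U u x a :=
  squeeze_zero' (Eventually.of_forall fun _ => setAverage_abs_nonneg _ _) h hb

theorem eventually_ball_of_nhdsWithin {U : Set Plane} {x : Plane} {p : Plane → Prop}
    (h : ∀ᶠ y in 𝓝[U] x, p y) : ∀ᶠ r in 𝓝[>] (0 : ℝ), ∀ y ∈ Metric.ball x r ∩ U, p y := by
  obtain ⟨δ, hδ, hp⟩ := Metric.mem_nhdsWithin_iff.1 h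
  filter_upwards [Ioo_mem_nhdsGT hδ] with r hr y hy
  exact hp ⟨Metric.ball_subset_ball hr.2.le hy.1, hy.2⟩

theorem HasTraceAt.congr_of_eventuallyEq {U : Set Plane} (hU : MeasurableSet U) {u u' : Plane → ℝ}
    {x : Plane} {a : ℝ} (h : HasTraceAt U u x a) (hu : ∀ᶠ y in 𝓝[U] x, u y = u' y) :
    HasTraceAt U u' x a := by
  refine Tendsto.congr' ?_ h
  filter_upwards [eventually_ball_of_nhdsWithin hu] with r hr
  rw [setAverage_eq, setAverage_eq]
  congr 1
  refine setIntegral_congr_fun (measurableSet_ball.inter hU) fun y hy => ?_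
  rw [hr y hy]

theorem HasTraceAt.of_eventually_zero {U : Set Plane} (hU : MeasurableSet U) {u : Plane → ℝ}
    {x : Plane} (hu : ∀ᶠ y in 𝓝[U] x, u y = 0) : HasTraceAt U u x 0 :=
  (HasTraceAt.zero U x).congr_of_eventuallyEq hU (hu.mono fun _ h => by simp [h])

theorem integrableOn_abs_sub {U : Set Plane} {u : Plane → ℝ} (hu : IntegrableOn u U) (x : Plane)
    (r a : ℝ) : IntegrableOn (fun y => |u y - a|) (Metric.ball x r ∩ U) :=
  ((hu.mono_set inter_subset_right).sub (integrableOn_const (volume_ball_inter_ne_top U x r))).abs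

theorem HasTraceAt.add_of_integrableOn {U : Set Plane} {u v : Plane → ℝ} (hu : IntegrableOn u U)
    (hv : IntegrableOn v U) {x : Plane} {a b : ℝ} (h : HasTraceAt U u x a)
    (h' : HasTraceAt U v x b) : HasTraceAt U (fun y => u y + v y) x (a + b) := by
  have hlim := Tendsto.add h h'
  rw [add_zero] at hlim
  refine HasTraceAt.of_le hlim (Eventually.of_forall fun r => ?_)
  simp only [setAverage_eq]
  rw [← smul_add, ← integral_add (integrableOn_abs_sub hu x r a) (integrableOn_abs_sub hv x r b)]
  refine smul_le_smul_of_nonneg_left (integral_mono_of_nonneg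
    (Eventually.of_forall fun _ => abs_nonneg _)
    ((integrableOn_abs_sub hu x r a).add (integrableOn_abs_sub hv x r b))
    (Eventually.of_forall fun y => ?_)) (by positivity)
  calc |u y + v y - (a + b)| = |(u y - a) + (v y - b)| := by ring_nf
    _ ≤ _ := abs_add_le _ _

theorem HasTraceAt.sum {ι : Type*} {U : Set Plane} (s : Finset ι) {u : ι → Plane → ℝ}
    (hu : ∀ i ∈ s, IntegrableOn (u i) U) {x : Plane} {a : ι → ℝ}
    (h : ∀ i ∈ s, HasTraceAt U (u i) x (a i)) :
    HasTraceAt U (fun y => ∑ i ∈ s, u i y) x (∑ i ∈ s, a i) := by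
  classical
  induction s using Finset.induction_on with
  | empty =>
    have h0 : HasTraceAt U (fun _ => (0 : ℝ)) x 0 := HasTraceAt.zero U x
    simpa using h0
  | insert i s hi ih =>
    simp only [Finset.sum_insert hi]
    refine HasTraceAt.add_of_integrableOn (hu i (by simp)) ?_ (h i (by simp))
      (ih (fun j hj => hu j (by simp [hj])) fun j hj => h j (by simp [hj]))
    exact integrable_finsetSum _ fun j hj => hu j (by simp [hj])

theorem volume_ball_inter_ne_zero {U : Set Plane} (hU : IsOpen U) {x : Plane} (hx : x ∈ closure U)
    {r : ℝ} (hr : 0 < r) : volume (Metric.ball x r ∩ U) ≠ 0 :=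
  ((Metric.isOpen_ball.inter hU).measure_pos volume
    (mem_closure_iff.1 hx _ Metric.isOpen_ball (Metric.mem_ball_self hr))).ne'

/-- Average |b - a| ≤ |u - a| + |u - b| over B(x, r) ∩ U, which has positive measure. This makes the
choice inside `boundaryTrace` harmless. -/
theorem HasTraceAt.unique {U : Set Plane} (hU : IsOpen U) {x : Plane} (hx : x ∈ closure U)
    {u : Plane → ℝ} (hu : IntegrableOn u U) {a b : ℝ}
    (h : HasTraceAt U u x a) (h' : HasTraceAt U u x b) : a = b := by
  have hlim := Tendsto.add h h'
  rw [add_zero] at hlim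
  have : |b - a| ≤ 0 := by
    refine ge_of_tendsto hlim ?_
    filter_upwards [self_mem_nhdsWithin] with r (hr : 0 < r)
    rw [← setAverage_const (volume_ball_inter_ne_zero hU hx hr) (volume_ball_inter_ne_top U x r)
      |b - a|]
    simp only [setAverage_eq]
    rw [← smul_add, ← integral_add (integrableOn_abs_sub hu x r a) (integrableOn_abs_sub hu x r b)]
    refine smul_le_smul_of_nonneg_left (integral_mono_of_nonneg
      (Eventually.of_forall fun _ => abs_nonneg _)
      ((integrableOn_abs_sub hu x r a).add (integrableOn_abs_sub hu x r b))
      (Eventually.of_forall fun y => ?_)) (by positivity)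
    calc |b - a| = |(u y - a) - (u y - b)| := by ring_nf
      _ ≤ _ := abs_sub _ _
  linarith [abs_nonpos_iff.1 this]

theorem HasTraceAt.boundaryTrace_eq {U : Set Plane} (hU : IsOpen U) {x : Plane}
    (hx : x ∈ closure U) {u : Plane → ℝ} (hu : IntegrableOn u U) {a : ℝ}
    (h : HasTraceAt U u x a) : boundaryTrace U u x = a := by
  have h' : ∃ a, HasTraceAt U u x a := ⟨a, h⟩
  rw [boundaryTrace, dif_pos h']
  exact h'.choose_spec.unique hU hx hu h

/-- Split uψ - ab = ψ(u - a) + a(ψ - b): near x the factor ψ is bounded in the first term, and the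
second is uniformly small. -/
theorem HasTraceAt.mul_continuousWithinAt {U : Set Plane} (hU : IsOpen U) {x : Plane}
    {u ψ : Plane → ℝ} (hu : IntegrableOn u U) {a b : ℝ} (h : HasTraceAt U u x a)
    (hψ : Tendsto ψ (𝓝[U] x) (𝓝 b)) : HasTraceAt U (fun y => u y * ψ y) x (a * b) := by
  rw [HasTraceAt, Metric.tendsto_nhds]
  intro ε hε
  have h1 : Tendsto (fun η : ℝ => |a| * η) (𝓝[>] 0) (𝓝 0) := by
    have : Tendsto (fun η : ℝ => |a| * η) (𝓝 0) (𝓝 (|a| * 0)) := by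
      exact (continuous_const.mul continuous_id).tendsto 0
    rw [mul_zero] at this
    exact this.mono_left nhdsWithin_le_nhds
  obtain ⟨η, hη1, hη⟩ := ((h1.eventually (gt_mem_nhds (half_pos hε))).and
    self_mem_nhdsWithin).exists
  have hη : 0 < η := hη
  have h2 : Tendsto (fun r : ℝ => (|b| + η) * ⨍ y in Metric.ball x r ∩ U, |u y - a|)
      (𝓝[>] 0) (𝓝 0) := by
    simpa using Tendsto.const_mul (|b| + η) h
  have h3 : ∀ᶠ y in 𝓝[U] x, |ψ y - b| < η := by
    have := Metric.tendsto_nhds.1 hψ η hη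
    simpa [Real.dist_eq] using this
  filter_upwards [eventually_ball_of_nhdsWithin h3, h2.eventually (gt_mem_nhds (half_pos hε)),
    self_mem_nhdsWithin] with r hr1 hr2 (hr : 0 < r)
  rw [Real.dist_eq, sub_zero, abs_of_nonneg (setAverage_abs_nonneg _ _)]
  have hi := integrableOn_abs_sub hu x r a
  have hc : IntegrableOn (fun _ : Plane => |a| * η) (Metric.ball x r ∩ U) :=
    integrableOn_const (volume_ball_inter_ne_top U x r)
  have h4 : ⨍ y in Metric.ball x r ∩ U, |u y * ψ y - a * b| ≤
      (|b| + η) * (⨍ y in Metric.ball x r ∩ U, |u y - a|) +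
        ⨍ y in Metric.ball x r ∩ U, |a| * η := by
    simp only [setAverage_eq, smul_eq_mul]
    rw [mul_left_comm, ← mul_add, ← integral_const_mul (|b| + η),
      ← integral_add (hi.const_mul _) hc]
    refine mul_le_mul_of_nonneg_left (integral_mono_of_nonneg
      (Eventually.of_forall fun _ => abs_nonneg _) ((hi.const_mul _).add hc) ?_) (by positivity)
    refine ae_restrict_of_forall_mem (measurableSet_ball.inter hU.measurableSet) fun y hy => ?_
    have h5 := hr1 y hy
    have h6 : |ψ y| ≤ |b| + η := by
      calc |ψ y| = |b + (ψ y - b)| := by ring_nf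
        _ ≤ |b| + |ψ y - b| := abs_add_le _ _
        _ ≤ _ := by linarith
    calc |u y * ψ y - a * b| = |ψ y * (u y - a) + a * (ψ y - b)| := by ring_nf
      _ ≤ |ψ y| * |u y - a| + |a| * |ψ y - b| := by
        rw [← abs_mul, ← abs_mul]; exact abs_add_le _ _
      _ ≤ _ := add_le_add (mul_le_mul_of_nonneg_right h6 (abs_nonneg _))
        (mul_le_mul_of_nonneg_left h5.le (abs_nonneg _))
  -- Only an inequality, since x is not assumed to lie in the closure of U: on a null set the
  -- average is 0.
  have h7 : ⨍ y in Metric.ball x r ∩ U, |a| * η ≤ |a| * η := by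
    by_cases h0 : volume (Metric.ball x r ∩ U) = 0
    · rw [setAverage_eq, Measure.restrict_eq_zero.2 h0]
      simp only [integral_zero_measure, smul_zero]
      positivity
    · rw [setAverage_const h0 (volume_ball_inter_ne_top U x r)]
  linarith

/-! ### Smooth sides -/

/-- Near `x`, the set `U` is the side `ρ < 0` of the curve `ρ = 0`, which is regular at `x`. -/
structure IsSideAt (U : Set Plane) (x : Plane) (ρ : Plane → ℝ) : Prop where
  smooth : ContDiff ℝ ∞ ρ
  gradient_ne_zero : gradient ρ x ≠ 0
  mem_iff : ∀ᶠ y in 𝓝 x, y ∈ U ↔ ρ y < 0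

theorem continuous_gradient {ρ : Plane → ℝ} (h : ContDiff ℝ ∞ ρ) : Continuous (gradient ρ) :=
  (InnerProductSpace.toDual ℝ Plane).symm.continuous.comp (h.continuous_fderiv (by simp))

theorem IsSideAt.eventually {U : Set Plane} {x : Plane} {ρ : Plane → ℝ} (h : IsSideAt U x ρ) :
    ∀ᶠ y in 𝓝 x, IsSideAt U y ρ := by
  filter_upwards [h.mem_iff.eventually_nhds,
    (continuous_gradient h.smooth).continuousAt.eventually_ne h.gradient_ne_zero] with y h1 h2
  exact ⟨h.smooth, h2, h1⟩

theorem IsSideAt.apply_eq_zero {U : Set Plane} (hU : IsOpen U) {x : Plane} {ρ : Plane → ℝ}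
    (h : IsSideAt U x ρ) (hx : x ∈ frontier U) : ρ x = 0 := by
  rw [hU.frontier_eq] at hx
  refine le_antisymm ?_ (not_lt.1 fun h0 => hx.2 (h.mem_iff.self_of_nhds.2 h0))
  by_contra! h0
  have h1 := h.smooth.continuous.continuousAt.eventually (lt_mem_nhds h0)
  obtain ⟨y, hy, h2, h3⟩ := ((mem_closure_iff_frequently.1 hx.1).and_eventually
    (h1.and h.mem_iff)).exists
  exact absurd (h3.1 hy) (not_lt.2 h2.le)

/-- The derivative of ρ at x along v is negative and ρ vanishes at x, so ρ is negative just after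
leaving x. -/
theorem IsSideAt.eventually_smul_mem {U : Set Plane} {x v : Plane} {ρ : Plane → ℝ}
    (h : IsSideAt U x ρ) (h0 : ρ x = 0) (hv : ⟪gradient ρ x, v⟫ < 0) :
    ∀ᶠ t in 𝓝[>] (0 : ℝ), x + t • v ∈ U := by
  have hd : HasDerivAt (fun t : ℝ => ρ (x + t • v)) (⟪gradient ρ x, v⟫) 0 := by
    rw [inner_gradient_left]
    have h1 : HasDerivAt (fun t : ℝ => x + t • v) v 0 := by
      simpa using ((hasDerivAt_id (0 : ℝ)).smul_const v).const_add x
    have h2 : HasFDerivAt ρ (fderiv ℝ ρ x) (x + (0 : ℝ) • v) := by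
      simpa using (h.smooth.differentiable (by simp) x).hasFDerivAt
    exact h2.comp_hasDerivAt 0 h1
  have h3 : Tendsto (fun t : ℝ => x + t • v) (𝓝[>] 0) (𝓝 x) := by
    have : Continuous fun t : ℝ => x + t • v := by fun_prop
    simpa using (this.tendsto 0).mono_left nhdsWithin_le_nhds
  have h4 := (hasDerivAt_iff_tendsto_slope.1 hd).mono_left
    (nhdsWithin_mono (0 : ℝ) (fun t (ht : 0 < t) => ht.ne' : Ioi (0 : ℝ) ⊆ {0}ᶜ))
  filter_upwards [h3.eventually h.mem_iff, h4.eventually (gt_mem_nhds hv), self_mem_nhdsWithin]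
    with t h5 h6 (ht : 0 < t)
  refine h5.2 ?_
  simp only [slope, sub_zero, zero_smul, add_zero, h0, vsub_eq_sub, smul_eq_mul] at h6
  by_contra! h7
  exact absurd h6 (not_lt.2 (mul_nonneg (inv_nonneg.2 ht.le) h7))

/-- The unit normal given by a local description of a set does not depend on the description. -/
theorem IsSideAt.normal_unique {U : Set Plane} (hU : IsOpen U) {x : Plane} (hx : x ∈ frontier U)
    {ρ ρ' : Plane → ℝ} (h : IsSideAt U x ρ) (h' : IsSideAt U x ρ') :
    (‖gradient ρ x‖)⁻¹ • gradient ρ x = (‖gradient ρ' x‖)⁻¹ • gradient ρ' x := by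
  set p := gradient ρ x with hp
  set q := gradient ρ' x with hq
  have hp0 : p ≠ 0 := h.gradient_ne_zero
  have hq0 : q ≠ 0 := h'.gradient_ne_zero
  -- A direction that enters U strictly according to ρ cannot leave it strictly according to ρ'.
  have key : ∀ v, ⟪p, v⟫ < 0 → ⟪q, v⟫ ≤ 0 := by
    intro v hv
    by_contra! hq1
    have h1 := h.eventually_smul_mem (h.apply_eq_zero hU hx) hv
    have h0' := h'.apply_eq_zero hU hx
    have hs : ∀ᶠ y in 𝓝 x, y ∈ {y | 0 < ρ' y} ↔ -ρ' y < 0 := by simp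
    have hneg : gradient (fun y => -ρ' y) x = -q := by
      simp [gradient, hq]
    have h2 : IsSideAt {y | 0 < ρ' y} x (fun y => -ρ' y) :=
      ⟨h'.smooth.neg, by simpa [hneg] using hq0, hs⟩
    have h3 := h2.eventually_smul_mem (v := v) (by simp [h0']) (by simp [hneg, hq1])
    have h4 : Tendsto (fun t : ℝ => x + t • v) (𝓝[>] 0) (𝓝 x) := by
      have : Continuous fun t : ℝ => x + t • v := by fun_prop
      simpa using (this.tendsto 0).mono_left nhdsWithin_le_nhds
    obtain ⟨t, ht1, ht2, ht3⟩ := (h1.and (h3.and (h4.eventually h'.mem_iff))).exists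
    exact lt_asymm (ht3.1 ht1) ht2
  have hpp : 0 < ⟪p, p⟫ := real_inner_self_pos.2 hp0
  have key' : ∀ v, ⟪p, v⟫ ≤ 0 → ⟪q, v⟫ ≤ 0 := by
    intro v hv
    have hlim : Tendsto (fun t : ℝ => ⟪q, v - t • p⟫) (𝓝[>] 0) (𝓝 (⟪q, v - (0 : ℝ) • p⟫)) := by
      have : Continuous fun t : ℝ => ⟪q, v - t • p⟫ := by fun_prop
      exact (this.tendsto 0).mono_left nhdsWithin_le_nhds
    rw [zero_smul, sub_zero] at hlim
    refine le_of_tendsto hlim ?_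
    filter_upwards [self_mem_nhdsWithin] with t (ht : 0 < t)
    refine key _ ?_
    rw [inner_sub_right, real_inner_smul_right]
    nlinarith [mul_pos ht hpp]
  -- The component of q orthogonal to p: both w and -w satisfy the hypothesis of `key'`, so ⟪q, w⟫ =
  -- 0 and w vanishes.
  set w := q - (⟪p, q⟫ / ⟪p, p⟫) • p with hw
  have hpw : ⟪p, w⟫ = 0 := by
    rw [hw, inner_sub_right, real_inner_smul_right]
    field_simp
    ring
  have hqw : ⟪q, w⟫ = 0 :=
    le_antisymm (key' w hpw.le) (by simpa using key' (-w) (by simp [hpw]))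
  have hww : w = 0 := by
    rw [← inner_self_eq_zero (𝕜 := ℝ)]
    nth_rewrite 1 [hw]
    rw [inner_sub_left, real_inner_smul_left, hpw, hqw]
    simp
  obtain ⟨t, ht⟩ : ∃ t : ℝ, q = t • p := ⟨_, sub_eq_zero.1 hww⟩
  have htpos : 0 < t := by
    have h1 := key (-p) (by rw [inner_neg_right]; exact neg_lt_zero.2 hpp)
    rw [ht, inner_neg_right, real_inner_smul_left] at h1
    have h2 : t ≠ 0 := by
      rintro rfl
      exact hq0 (by simp [ht])
    exact lt_of_le_of_ne (by nlinarith) h2.symm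
  rw [ht, norm_smul, Real.norm_of_nonneg htpos.le, smul_smul]
  congr 1
  field_simp

/-- A set with a smooth side at a boundary point `x` fills a fixed part of the small balls
around `x`. -/
theorem IsSideAt.volume_ball_inter_ge {U : Set Plane} {x : Plane} {ρ : Plane → ℝ}
    (h : IsSideAt U x ρ) (h0 : ρ x = 0) :
    ∃ k > 0, ∀ᶠ r in 𝓝[>] (0 : ℝ), k * r ^ 2 ≤ volume.real (Metric.ball x r ∩ U) := by
  set p := gradient ρ x with hp
  have hp0 : 0 < ‖p‖ := norm_pos_iff.2 h.gradient_ne_zero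
  refine ⟨volume.real (Metric.ball (0 : Plane) 1) / 16, div_pos (ENNReal.toReal_pos
    (Metric.measure_ball_pos volume 0 one_pos).ne' measure_ball_lt_top.ne) (by norm_num), ?_⟩
  have hd := hasGradientAt_iff_isLittleO.1
    (h.smooth.differentiable (by simp) x).hasGradientAt
  have hd' := hd.def (c := ‖p‖ / 4) (by positivity)
  have hev : ∀ᶠ y in 𝓝[univ] x, (y ∈ U ↔ ρ y < 0) ∧
      ‖ρ y - ρ x - ⟪p, y - x⟫‖ ≤ ‖p‖ / 4 * ‖y - x‖ := by
    rw [nhdsWithin_univ]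
    exact h.mem_iff.and hd'
  filter_upwards [eventually_ball_of_nhdsWithin hev, self_mem_nhdsWithin] with r hr (hr0 : 0 < r)
  -- The ball of radius r/4 whose centre lies at distance r/2 from x against the gradient; the 1/16
  -- in the constant is (1/4)². On it the linear part of ρ is below -‖p‖r/4, while the remainder is
  -- at most 3‖p‖r/16.
  have hsub : Metric.ball (x - (r / 2 / ‖p‖) • p) (r / 4) ⊆ Metric.ball x r ∩ U := by
    intro y hy
    rw [mem_ball_iff_norm] at hy
    set z := y - (x - (r / 2 / ‖p‖) • p) with hz
    have hyx : y - x = z - (r / 2 / ‖p‖) • p := by rw [hz]; abel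
    have hn : ‖(r / 2 / ‖p‖) • p‖ = r / 2 := by
      rw [norm_smul, Real.norm_of_nonneg (by positivity)]
      field_simp
    have hyn : ‖y - x‖ < 3 / 4 * r := by
      rw [hyx]
      have := norm_sub_le z ((r / 2 / ‖p‖) • p)
      linarith
    have hyb : y ∈ Metric.ball x r := by
      rw [mem_ball_iff_norm]
      linarith
    obtain ⟨h1, h2⟩ := hr y ⟨hyb, mem_univ _⟩
    refine ⟨hyb, h1.2 ?_⟩
    have h3 : ⟪p, y - x⟫ < - (‖p‖ * r / 4) := by
      rw [hyx, inner_sub_right, real_inner_smul_right, real_inner_self_eq_norm_sq]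
      have h4 : ⟪p, z⟫ ≤ ‖p‖ * ‖z‖ := real_inner_le_norm p z
      have h5 : ‖p‖ * ‖z‖ < ‖p‖ * (r / 4) := mul_lt_mul_of_pos_left hy hp0
      have h6 : r / 2 / ‖p‖ * ‖p‖ ^ 2 = ‖p‖ * r / 2 := by field_simp
      linarith
    rw [h0, Real.norm_eq_abs] at h2
    have h7 := (abs_le.1 h2).2
    have h8 : ‖p‖ / 4 * ‖y - x‖ ≤ ‖p‖ / 4 * (3 / 4 * r) :=
      mul_le_mul_of_nonneg_left hyn.le (by positivity)
    nlinarith [mul_pos hp0 hr0]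
  have h9 := measureReal_mono hsub (volume_ball_inter_ne_top U x r)
  refine le_trans (le_of_eq ?_) h9
  rw [measureReal_def, measureReal_def, Measure.addHaar_ball volume (x - (r / 2 / ‖p‖) • p) (by positivity),
    finrank_euclideanSpace_fin, ENNReal.toReal_mul, ENNReal.toReal_ofReal (by positivity)]
  ring

/-! ### The length measure of a curve -/

/-- `σ` is an injective curve whose chords between two parameters have a length given by the value
of the positive speed `w` in between. -/
structure HasSpeed (σ : ℝ → Plane) (w : ℝ → ℝ) : Prop where
  continuous : Continuous w
  pos : ∀ s, 0 < w s
  dist_eq : ∀ s t, s < t → ∃ c ∈ Ioo s t, dist (σ s) (σ t) = w c * (t - s)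

namespace HasSpeed

variable {σ : ℝ → Plane} {w : ℝ → ℝ}

theorem dist_le (h : HasSpeed σ w) {p q hi : ℝ} (hhi : ∀ c ∈ Icc p q, w c ≤ hi) {s t : ℝ}
    (hs : s ∈ Icc p q) (ht : t ∈ Icc p q) : dist (σ s) (σ t) ≤ hi * dist s t := by
  wlog hst : s < t generalizing s t
  · rcases eq_or_lt_of_le (not_lt.1 hst) with rfl | hts
    · simp
    · rw [dist_comm, dist_comm s]
      exact this ht hs hts
  obtain ⟨c, hc, he⟩ := h.dist_eq s t hst
  rw [he, dist_comm s, Real.dist_eq, abs_of_pos (sub_pos.2 hst)]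
  exact mul_le_mul_of_nonneg_right (hhi c ⟨hs.1.trans hc.1.le, hc.2.le.trans ht.2⟩)
    (sub_pos.2 hst).le

theorem le_dist (h : HasSpeed σ w) {p q lo : ℝ} (hlo : ∀ c ∈ Icc p q, lo ≤ w c) {s t : ℝ}
    (hs : s ∈ Icc p q) (ht : t ∈ Icc p q) : lo * dist s t ≤ dist (σ s) (σ t) := by
  wlog hst : s < t generalizing s t
  · rcases eq_or_lt_of_le (not_lt.1 hst) with rfl | hts
    · simp
    · rw [dist_comm, dist_comm (σ s)]
      exact this ht hs hts
  obtain ⟨c, hc, he⟩ := h.dist_eq s t hst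
  rw [he, dist_comm s, Real.dist_eq, abs_of_pos (sub_pos.2 hst)]
  exact mul_le_mul_of_nonneg_right (hlo c ⟨hs.1.trans hc.1.le, hc.2.le.trans ht.2⟩)
    (sub_pos.2 hst).le

theorem injective (h : HasSpeed σ w) : Function.Injective σ := by
  intro s t hst
  by_contra hne
  wlog hlt : s < t generalizing s t
  · exact this hst.symm (Ne.symm hne) (lt_of_le_of_ne (not_lt.1 hlt) (Ne.symm hne))
  obtain ⟨c, -, he⟩ := h.dist_eq s t hlt
  rw [hst, dist_self] at he
  exact (mul_pos (h.pos c) (sub_pos.2 hlt)).ne he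

theorem continuous_curve (h : HasSpeed σ w) : Continuous σ := by
  rw [continuous_iff_continuousAt]
  intro s
  obtain ⟨hi, hhi⟩ := (isCompact_Icc (a := s - 1) (b := s + 1)).bddAbove_image
    h.continuous.continuousOn
  have hs : Icc (s - 1) (s + 1) ∈ 𝓝 s := Icc_mem_nhds (by linarith) (by linarith)
  have : ContinuousOn σ (Icc (s - 1) (s + 1)) := by
    refine (LipschitzOnWith.of_dist_le_mul (K := Real.toNNReal hi) fun x hx y hy => ?_).continuousOn
    refine (h.dist_le (fun c hc => hhi (mem_image_of_mem w hc)) hx hy).trans ?_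
    exact mul_le_mul_of_nonneg_right (Real.le_coe_toNNReal hi) dist_nonneg
  exact this.continuousAt hs

theorem measurableEmbedding (h : HasSpeed σ w) : MeasurableEmbedding σ :=
  h.continuous_curve.measurableEmbedding h.injective

theorem hausdorffMeasure_image_le (h : HasSpeed σ w) {p q hi : ℝ} (hhi : ∀ c ∈ Icc p q, w c ≤ hi)
    (hpq : p ≤ q) : (Measure.hausdorffMeasure 1 : Measure Plane) (σ '' Ioc p q) ≤
      ENNReal.ofReal (hi * (q - p)) := by
  have hi0 : 0 ≤ hi := (h.pos p).le.trans (hhi p (left_mem_Icc.2 hpq))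
  have hL : LipschitzOnWith (Real.toNNReal hi) σ (Ioc p q) :=
    LipschitzOnWith.of_dist_le_mul fun x hx y hy => by
      rw [Real.coe_toNNReal _ hi0]
      exact h.dist_le hhi (Ioc_subset_Icc_self hx) (Ioc_subset_Icc_self hy)
  refine (hL.hausdorffMeasure_image_le zero_le_one).trans ?_
  rw [hausdorffMeasure_real, Real.volume_Ioc, ENNReal.rpow_one, ENNReal.ofReal_mul hi0]
  rfl

/-- On the arc the inverse of σ is Lipschitz with constant 1/lo, so it cannot expand length by more
than that factor. -/
theorem le_hausdorffMeasure_image (h : HasSpeed σ w) {p q lo : ℝ} (hlo : ∀ c ∈ Icc p q, lo ≤ w c)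
    (hlo0 : 0 < lo) : ENNReal.ofReal (lo * (q - p)) ≤
      (Measure.hausdorffMeasure 1 : Measure Plane) (σ '' Ioc p q) := by
  have hL : LipschitzOnWith (Real.toNNReal lo⁻¹) (Function.invFun σ) (σ '' Ioc p q) := by
    refine LipschitzOnWith.of_dist_le_mul ?_
    rintro _ ⟨x, hx, rfl⟩ _ ⟨y, hy, rfl⟩
    rw [Function.leftInverse_invFun h.injective, Function.leftInverse_invFun h.injective,
      Real.coe_toNNReal _ (inv_pos.2 hlo0).le, inv_mul_eq_div, le_div_iff₀ hlo0, mul_comm]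
    exact h.le_dist hlo (Ioc_subset_Icc_self hx) (Ioc_subset_Icc_self hy)
  have h1 := hL.hausdorffMeasure_image_le (zero_le_one : (0 : ℝ) ≤ 1)
  rw [← image_comp, Function.invFun_comp h.injective, image_id, hausdorffMeasure_real,
    Real.volume_Ioc, ENNReal.rpow_one] at h1
  rw [ENNReal.ofReal_mul hlo0.le]
  calc ENNReal.ofReal lo * ENNReal.ofReal (q - p)
      ≤ ENNReal.ofReal lo * (ENNReal.ofReal lo⁻¹ *
        (Measure.hausdorffMeasure 1 : Measure Plane) (σ '' Ioc p q)) := by gcongr; exact h1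
    _ = _ := by
      rw [← mul_assoc, ← ENNReal.ofReal_mul hlo0.le, mul_inv_cancel₀ hlo0.ne', ENNReal.ofReal_one,
        one_mul]

/-- Arc length is additive over adjacent intervals and lies between the extreme speeds times the
parameter length. By continuity of w its right derivative is w, as for the integral of w, and both
start at 0. -/
theorem hausdorffMeasure_image_Ioc (h : HasSpeed σ w) {p q : ℝ} (hpq : p ≤ q) :
    (Measure.hausdorffMeasure 1 : Measure Plane) (σ '' Ioc p q) =
      ENNReal.ofReal (∫ s in p..q, w s) := by
  set ν : ℝ → ℝ → ENNReal := fun a b =>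
    (Measure.hausdorffMeasure 1 : Measure Plane) (σ '' Ioc a b) with hν
  have hadd : ∀ a b c, a ≤ b → b ≤ c → ν a c = ν a b + ν b c := by
    intro a b c hab hbc
    simp only [hν]
    rw [← Ioc_union_Ioc_eq_Ioc hab hbc, image_union, measure_union]
    · exact (disjoint_image_iff h.injective).2 (Ioc_disjoint_Ioc_of_le le_rfl)
    · exact h.measurableEmbedding.measurableSet_image' measurableSet_Ioc
  have hbd : ∀ a b, ∃ hi, ∀ c ∈ Icc a b, w c ≤ hi := fun a b => by
    obtain ⟨hi, hhi⟩ := (isCompact_Icc (a := a) (b := b)).bddAbove_image h.continuous.continuousOn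
    exact ⟨hi, fun c hc => hhi (mem_image_of_mem w hc)⟩
  have hfin : ∀ a b, ν a b ≠ ⊤ := by
    intro a b
    rcases le_total a b with hab | hab
    · obtain ⟨hi, hhi⟩ := hbd a b
      exact ((h.hausdorffMeasure_image_le hhi hab).trans_lt ENNReal.ofReal_lt_top).ne
    · simp [hν, Ioc_eq_empty (not_lt.2 hab)]
  have hreal : ∀ a b c, a ≤ b → b ≤ c → (ν a c).toReal = (ν a b).toReal + (ν b c).toReal := by
    intro a b c hab hbc
    rw [hadd a b c hab hbc, ENNReal.toReal_add (hfin _ _) (hfin _ _)]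
  have hup : ∀ a b hi, a ≤ b → (∀ c ∈ Icc a b, w c ≤ hi) → (ν a b).toReal ≤ hi * (b - a) := by
    intro a b hi hab hhi
    refine ENNReal.toReal_le_of_le_ofReal (mul_nonneg ?_ (sub_nonneg.2 hab))
      (h.hausdorffMeasure_image_le hhi hab)
    exact (h.pos a).le.trans (hhi a (left_mem_Icc.2 hab))
  have hdown : ∀ a b lo, a ≤ b → (∀ c ∈ Icc a b, lo ≤ w c) → lo * (b - a) ≤ (ν a b).toReal := by
    intro a b lo hab hlo
    rcases le_or_gt lo 0 with h0 | h0
    · exact (mul_nonpos_of_nonpos_of_nonneg h0 (sub_nonneg.2 hab)).trans ENNReal.toReal_nonneg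
    · exact (ENNReal.ofReal_le_iff_le_toReal (hfin a b)).1 (h.le_hausdorffMeasure_image hlo h0)
  have hΘ : ∀ x ∈ Icc p q, (ν p x).toReal - ∫ s in p..x, w s = (ν p p).toReal - ∫ s in p..p, w s := by
    have hder : ∀ x ∈ Ico p q, HasDerivWithinAt (fun x => (ν p x).toReal) (w x) (Ici x) x := by
      intro x hx
      rw [hasDerivWithinAt_iff_isLittleO, Asymptotics.isLittleO_iff]
      intro ε hε
      obtain ⟨δ, hδ, hw⟩ := Metric.continuousAt_iff.1 h.continuous.continuousAt ε hε
      have hmem : Ico x (x + δ) ∈ 𝓝[Ici x] x := Ico_mem_nhdsGE (by linarith)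
      filter_upwards [hmem] with y hy
      have hc : ∀ c ∈ Icc x y, w x - ε ≤ w c ∧ w c ≤ w x + ε := by
        intro c hc
        have hd : dist c x < δ := by
          rw [Real.dist_eq, abs_of_nonneg (sub_nonneg.2 hc.1)]
          linarith [hc.2, hy.2]
        have := abs_lt.1 (hw hd)
        constructor <;> linarith [this.1, this.2]
      rw [hreal p x y hx.1 hy.1, Real.norm_eq_abs, Real.norm_of_nonneg (sub_nonneg.2 hy.1),
        smul_eq_mul, abs_le]
      have h1 := hup x y _ hy.1 fun c hc' => (hc c hc').2
      have h2 := hdown x y _ hy.1 fun c hc' => (hc c hc').1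
      constructor <;> nlinarith
    refine constant_of_has_deriv_right_zero ?_ ?_
    · refine ContinuousOn.sub ?_ ?_
      · obtain ⟨hi, hhi⟩ := hbd p q
        have hmono : ∀ x ∈ Icc p q, ∀ y ∈ Icc p q, x ≤ y →
            dist (ν p x).toReal (ν p y).toReal ≤ Real.toNNReal hi * dist x y := by
          intro x hx y hy hxy
          rw [hreal p x y hx.1 hxy, dist_comm, dist_comm x, Real.dist_eq, Real.dist_eq,
            add_sub_cancel_left, abs_of_nonneg ENNReal.toReal_nonneg,
            abs_of_nonneg (sub_nonneg.2 hxy)]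
          refine (hup x y hi hxy fun c hc => hhi c ⟨hx.1.trans hc.1, hc.2.trans hy.2⟩).trans ?_
          exact mul_le_mul_of_nonneg_right (Real.le_coe_toNNReal hi) (sub_nonneg.2 hxy)
        refine (LipschitzOnWith.of_dist_le_mul (K := Real.toNNReal hi)
          fun x hx y hy => ?_).continuousOn
        rcases le_total x y with hxy | hxy
        · exact hmono x hx y hy hxy
        · rw [dist_comm, dist_comm x]
          exact hmono y hy x hx hxy
      · exact (intervalIntegral.continuous_primitive
          (fun a b => h.continuous.intervalIntegrable a b) p).continuousOn
    · intro x hx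
      have := (hder x hx).sub (intervalIntegral.integral_hasDerivAt_right
        (h.continuous.intervalIntegrable p x)
        h.continuous.stronglyMeasurable.stronglyMeasurableAtFilter
        h.continuous.continuousAt).hasDerivWithinAt
      rwa [sub_self] at this
  have h1 := hΘ q (right_mem_Icc.2 hpq)
  have h2 : ν p p = 0 := by simp [hν]
  rw [h2, intervalIntegral.integral_same, ENNReal.toReal_zero, sub_zero, sub_eq_zero] at h1
  rw [← h1, ENNReal.ofReal_toReal (hfin p q)]

/-- The length measure of a curve in terms of its speed. -/
theorem hausdorffMeasure_restrict_range (h : HasSpeed σ w) :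
    (Measure.hausdorffMeasure 1 : Measure Plane).restrict (range σ) =
      (volume.withDensity fun s => ENNReal.ofReal (w s)).map σ := by
  rw [← h.measurableEmbedding.map_comap]
  congr 1
  symm
  have hI : ∀ a b, a < b → volume.withDensity (fun s => ENNReal.ofReal (w s)) (Ioc a b) =
      ENNReal.ofReal (∫ s in a..b, w s) := by
    intro a b hab
    rw [withDensity_apply _ measurableSet_Ioc, intervalIntegral.integral_of_le hab.le,
      ofReal_integral_eq_lintegral_ofReal
        (h.continuous.integrableOn_Ioc) (Eventually.of_forall fun s => (h.pos s).le)]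
  refine Measure.ext_of_Ioc' _ _ (fun a b hab => ?_) fun a b hab => ?_
  · rw [hI a b hab]
    exact ENNReal.ofReal_ne_top
  · rw [hI a b hab, h.measurableEmbedding.comap_apply, h.hausdorffMeasure_image_Ioc hab.le]

end HasSpeed

/-! ### Graph charts -/

/-- The rotation of `b` by a right angle. -/
def quarterTurn (b : Plane) : Plane := !₂[-b 1, b 0]

theorem inner_quarterTurn_self (b : Plane) : ⟪quarterTurn b, b⟫ = 0 := by
  simp [quarterTurn, PiLp.inner_apply, Fin.sum_univ_two]
  ring

theorem inner_self_quarterTurn (b : Plane) : ⟪b, quarterTurn b⟫ = 0 := by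
  rw [real_inner_comm, inner_quarterTurn_self]

theorem norm_quarterTurn (b : Plane) : ‖quarterTurn b‖ = ‖b‖ := by
  simp [quarterTurn, EuclideanSpace.norm_eq, Fin.sum_univ_two, add_comm]

theorem norm_sq_frame {b : Plane} (hb : ‖b‖ = 1) (s t : ℝ) :
    ‖s • quarterTurn b + t • b‖ ^ 2 = s ^ 2 + t ^ 2 := by
  rw [norm_add_sq_real, norm_smul, norm_smul, norm_quarterTurn, hb, real_inner_smul_left,
    real_inner_smul_right, inner_quarterTurn_self]
  simp

theorem frame_expansion {b : Plane} (hb : ‖b‖ = 1) (y : Plane) :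
    ⟪quarterTurn b, y⟫ • quarterTurn b + ⟪b, y⟫ • b = y := by
  have h : b 0 ^ 2 + b 1 ^ 2 = 1 := by
    have := EuclideanSpace.real_norm_sq_eq b
    rw [hb, Fin.sum_univ_two] at this
    linarith
  ext i
  fin_cases i
  · simp [quarterTurn, PiLp.inner_apply, Fin.sum_univ_two]
    linear_combination y 0 * h
  · simp [quarterTurn, PiLp.inner_apply, Fin.sum_univ_two]
    linear_combination y 1 * h

/-- The isometry given by the frame `(quarterTurn b, b)`. -/
noncomputable def frameIsometry {b : Plane} (hb : ‖b‖ = 1) : Plane →ₗᵢ[ℝ] Plane where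
  toFun y := y 0 • quarterTurn b + y 1 • b
  map_add' y z := by simp only [PiLp.add_apply, add_smul]; abel
  map_smul' t y := by simp [mul_smul]
  norm_map' y := by
    have h1 : ‖y 0 • quarterTurn b + y 1 • b‖ ^ 2 = ‖y‖ ^ 2 := by
      rw [norm_sq_frame hb, EuclideanSpace.real_norm_sq_eq, Fin.sum_univ_two]
    exact (sq_eq_sq₀ (norm_nonneg _) (norm_nonneg _)).1 h1

theorem measurePreserving_frame {b : Plane} (hb : ‖b‖ = 1) :
    MeasurePreserving (fun p : ℝ × ℝ => p.1 • quarterTurn b + p.2 • b) := by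
  have h1 := ((frameIsometry hb).toLinearIsometryEquiv rfl).measurePreserving
  have h2 := (PiLp.volume_preserving_toLp (Fin 2)).comp (volume_preserving_finTwoArrow ℝ).symm
  have h3 := h1.comp h2
  exact h3

/-- The chart `(s, τ) ↦ s b' + (γ s + τ) b`, with `b'` the rotation of `b` by a right angle,
which maps the line `τ = 0` to a graph over the line orthogonal to `b`. -/
noncomputable def graphChart {b : Plane} (hb : ‖b‖ = 1) {γ : ℝ → ℝ} (hγ : Continuous γ) : ℝ × ℝ ≃ₜ Plane where
  toFun p := p.1 • quarterTurn b + (γ p.1 + p.2) • b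
  invFun y := (⟪quarterTurn b, y⟫, ⟪b, y⟫ - γ ⟪quarterTurn b, y⟫)
  left_inv p := by
    simp [inner_add_right, real_inner_smul_right, inner_quarterTurn_self, inner_self_quarterTurn,
      norm_quarterTurn, hb]
  right_inv y := by
    simp only [add_sub_cancel]
    exact frame_expansion hb y
  continuous_toFun := by fun_prop
  continuous_invFun := by fun_prop

section graphChart

variable {b : Plane} (hb : ‖b‖ = 1) {γ : ℝ → ℝ} (hγ : Continuous γ)

theorem graphChart_apply (s τ : ℝ) :
    graphChart hb hγ (s, τ) = s • quarterTurn b + (γ s + τ) • b := rfl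

theorem graphChart_add_smul (s τ r : ℝ) :
    graphChart hb hγ (s, τ) + r • b = graphChart hb hγ (s, τ + r) := by
  simp only [graphChart_apply, add_assoc, ← add_smul]

/-- The chart is a shear followed by a rotation, so no Jacobian appears anywhere in the area
integrals. -/
theorem measurePreserving_graphChart : MeasurePreserving (graphChart hb hγ) := by
  have h1 : MeasurePreserving (fun p : ℝ × ℝ => (p.1, γ p.1 + p.2)) :=
    (MeasurePreserving.id volume).skew_product (g := fun s τ => γ s + τ)
      (by unfold Function.uncurry; fun_prop)
      (Eventually.of_forall fun s => map_add_left_eq_self volume (γ s))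
  exact (measurePreserving_frame hb).comp h1

theorem measurableEmbedding_graphChart : MeasurableEmbedding (graphChart hb hγ) :=
  (graphChart hb hγ).measurableEmbedding

/-- By the mean value theorem the slope of each chord of the graph is a value of γ' in between, so
the speed is √(1 + γ'²). -/
theorem hasSpeed_graphChart (hγ1 : ContDiff ℝ 1 γ) :
    HasSpeed (fun s => graphChart hb hγ (s, 0)) (fun s => √(1 + deriv γ s ^ 2)) where
  continuous := by
    have := hγ1.continuous_deriv le_rfl
    fun_prop
  pos s := Real.sqrt_pos.2 (by positivity)
  dist_eq s t hst := by
    obtain ⟨c, hc, he⟩ := exists_deriv_eq_slope γ hst hγ1.continuous.continuousOn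
      (hγ1.differentiable (by simp)).differentiableOn
    refine ⟨c, hc, ?_⟩
    have hts : 0 < t - s := sub_pos.2 hst
    rw [dist_comm, dist_eq_norm, he]
    have h1 : graphChart hb hγ (t, 0) - graphChart hb hγ (s, 0) =
        (t - s) • quarterTurn b + (γ t - γ s) • b := by
      simp only [graphChart_apply, add_zero, sub_smul]
      abel
    rw [h1, ← Real.sqrt_sq (norm_nonneg _), norm_sq_frame hb, ← Real.sqrt_sq hts.le,
      ← Real.sqrt_mul (by positivity), Real.sqrt_sq hts.le]
    congr 1
    field_simp

end graphChart

/-- Near a boundary point, a set with a smooth side is the region above a graph. -/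
theorem IsSideAt.exists_graphChart {U : Set Plane} (hU : IsOpen U) {x : Plane} {ρ : Plane → ℝ}
    (h : IsSideAt U x ρ) (hx : x ∈ frontier U) {b : Plane} (hb : ‖b‖ = 1)
    (hneg : ⟪gradient ρ x, b⟫ < 0) :
    ∃ γ : ℝ → ℝ, ∃ hγ : ContDiff ℝ 1 γ, ∃ s₀ : ℝ, ∃ δ > 0,
      graphChart hb hγ.continuous (s₀, 0) = x ∧ ∀ s τ, |s - s₀| < δ → |τ| < δ →
        (graphChart hb hγ.continuous (s, τ) ∈ U ↔ 0 < τ) ∧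
        IsSideAt U (graphChart hb hγ.continuous (s, τ)) ρ ∧
        ⟪gradient ρ (graphChart hb hγ.continuous (s, τ)), b⟫ < 0 ∧
        ⟪gradient ρ (graphChart hb hγ.continuous (s, 0)), quarterTurn b + deriv γ s • b⟫ = 0 := by
  set f : ℝ × ℝ → ℝ := fun p => ρ (p.1 • quarterTurn b + p.2 • b) with hf
  set u : ℝ × ℝ := (⟪quarterTurn b, x⟫, ⟪b, x⟫) with hu
  have hux : u.1 • quarterTurn b + u.2 • b = x := frame_expansion hb x
  have hρd : ∀ y, HasFDerivAt ρ (fderiv ℝ ρ y) y := fun y =>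
    (h.smooth.differentiable (by simp) y).hasFDerivAt
  have hfu : f u = 0 := by
    simp only [hf]
    rw [hux]
    exact h.apply_eq_zero hU hx
  have hfs : ContDiff ℝ ∞ f := h.smooth.comp (by fun_prop)
  have cdf : ContDiffAt ℝ 1 f u := (hfs.of_le (by simp)).contDiffAt
  have hinr : ∀ t : ℝ, (fderiv ℝ f u ∘L .inr ℝ ℝ ℝ) t = t * ⟪gradient ρ x, b⟫ := by
    intro t
    have h1 : HasFDerivAt (fun p : ℝ × ℝ => p.1 • quarterTurn b + p.2 • b)
        ((ContinuousLinearMap.fst ℝ ℝ ℝ).smulRight (quarterTurn b) +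
          (ContinuousLinearMap.snd ℝ ℝ ℝ).smulRight b) u :=
      ((ContinuousLinearMap.fst ℝ ℝ ℝ).hasFDerivAt.smul_const _).add
        ((ContinuousLinearMap.snd ℝ ℝ ℝ).hasFDerivAt.smul_const _)
    have h2 : HasFDerivAt ρ (fderiv ℝ ρ x) (u.1 • quarterTurn b + u.2 • b) := by
      rw [hux]
      exact hρd x
    have h3 : HasFDerivAt f _ u := h2.comp u h1
    rw [h3.fderiv, inner_gradient_left]
    simp
  -- The derivative of ρ along b is nonzero at x, so the implicit function theorem solves ρ = 0 for
  -- the b-coordinate.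
  have hinv : (fderiv ℝ f u ∘L .inr ℝ ℝ ℝ).IsInvertible := by
    refine ContinuousLinearMap.IsInvertible.of_inverse
      (g := (⟪gradient ρ x, b⟫)⁻¹ • ContinuousLinearMap.id ℝ ℝ) ?_ ?_
    · ext
      rw [ContinuousLinearMap.comp_apply, hinr]
      simp only [_root_.smul_apply, ContinuousLinearMap.id_apply, smul_eq_mul]
      field_simp
      exact div_self hneg.ne
    · ext
      rw [ContinuousLinearMap.comp_apply, hinr]
      simp only [_root_.smul_apply, ContinuousLinearMap.id_apply, smul_eq_mul]
      field_simp
      exact div_self hneg.ne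
  set γ₀ := cdf.implicitFunction one_ne_zero hinv with hγ₀
  have hγ₀u : γ₀ u.1 = u.2 := cdf.implicitFunction_apply_self one_ne_zero hinv
  have hγ₀f : ∀ᶠ s in 𝓝 u.1, f (s, γ₀ s) = 0 := by
    have := cdf.eventually_apply_implicitFunction one_ne_zero hinv
    rwa [hfu] at this
  have hγ₀c : ∀ᶠ s in 𝓝 u.1, ContDiffAt ℝ 1 γ₀ s :=
    (cdf.contDiffAt_implicitFunction one_ne_zero hinv).eventually (by simp)
  obtain ⟨R, hR, hball⟩ := Metric.eventually_nhds_iff.1 hγ₀c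
  -- The implicit function is C¹ only near the base point; multiplying by a bump equal to 1 there
  -- gives a globally C¹ γ, as the chart requires.
  let β : ContDiffBump u.1 := ⟨R / 3, R / 2, by positivity, by linarith⟩
  set γ : ℝ → ℝ := fun s => β s * γ₀ s with hγdef
  have hγ : ContDiff ℝ 1 γ := by
    rw [contDiff_iff_contDiffAt]
    intro s
    by_cases hs : dist s u.1 < R
    · exact β.contDiffAt.mul (hball hs)
    · have h1 : ∀ᶠ s' in 𝓝 s, R / 2 < dist s' u.1 :=
        (continuous_id.dist continuous_const).continuousAt.eventually
          (lt_mem_nhds (show R / 2 < dist (id s) u.1 by simp only [id]; linarith))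
      refine (contDiffAt_const (c := (0 : ℝ))).congr_of_eventuallyEq ?_
      filter_upwards [h1] with s' hs'
      simp only [hγdef]
      rw [β.zero_of_le_dist hs'.le, zero_mul]
  have hγγ₀ : γ =ᶠ[𝓝 u.1] γ₀ := by
    filter_upwards [β.eventuallyEq_one] with s hs
    simp only [hγdef]
    rw [hs, Pi.one_apply, one_mul]
  have hγf : ∀ᶠ s in 𝓝 u.1, f (s, γ s) = 0 := by
    filter_upwards [hγγ₀, hγ₀f] with s h1 h2
    rwa [h1]
  have hΦ : ∀ s, graphChart hb hγ.continuous (s, 0) = s • quarterTurn b + γ s • b := by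
    intro s
    rw [graphChart_apply, add_zero]
  have hΦx : graphChart hb hγ.continuous (u.1, 0) = x := by
    rw [hΦ, hγγ₀.self_of_nhds, hγ₀u, hux]
  have hev : ∀ᶠ p in 𝓝 ((u.1, 0) : ℝ × ℝ), IsSideAt U (graphChart hb hγ.continuous p) ρ ∧
      ⟪gradient ρ (graphChart hb hγ.continuous p), b⟫ < 0 := by
    have h1 : Tendsto (graphChart hb hγ.continuous) (𝓝 (u.1, 0)) (𝓝 x) := by
      have := (graphChart hb hγ.continuous).continuous.tendsto (u.1, 0)
      rwa [hΦx] at this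
    have h2 : ∀ᶠ y in 𝓝 x, ⟪gradient ρ y, b⟫ < 0 :=
      ((continuous_gradient h.smooth).inner continuous_const).continuousAt.eventually
        (gt_mem_nhds hneg)
    exact h1.eventually (h.eventually.and h2)
  obtain ⟨δ₁, hδ₁, hbox⟩ := Metric.eventually_nhds_iff.1 hev
  obtain ⟨δ₂, hδ₂, hz⟩ := Metric.eventually_nhds_iff.1 hγf
  have hδ : 0 < min δ₁ δ₂ := lt_min hδ₁ hδ₂
  have hmem : ∀ s τ, |s - u.1| < min δ₁ δ₂ → |τ| < min δ₁ δ₂ →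
      IsSideAt U (graphChart hb hγ.continuous (s, τ)) ρ ∧
      ⟪gradient ρ (graphChart hb hγ.continuous (s, τ)), b⟫ < 0 := by
    intro s τ hs hτ
    refine hbox ?_
    rw [Prod.dist_eq, max_lt_iff]
    simp only [Real.dist_eq, sub_zero]
    exact ⟨hs.trans_le (min_le_left _ _), hτ.trans_le (min_le_left _ _)⟩
  have hρ0 : ∀ s, |s - u.1| < min δ₁ δ₂ → ρ (graphChart hb hγ.continuous (s, 0)) = 0 := by
    intro s hs
    rw [hΦ]
    exact hz (by rw [Real.dist_eq]; exact hs.trans_le (min_le_right _ _))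
  refine ⟨γ, hγ, u.1, min δ₁ δ₂, hδ, hΦx, fun s τ hs hτ => ⟨?_, (hmem s τ hs hτ).1,
    (hmem s τ hs hτ).2, ?_⟩⟩
  · rw [(hmem s τ hs hτ).1.mem_iff.self_of_nhds]
    have hder : ∀ τ, HasDerivAt (fun τ => ρ (graphChart hb hγ.continuous (s, τ)))
        (⟪gradient ρ (graphChart hb hγ.continuous (s, τ)), b⟫) τ := by
      intro τ
      rw [inner_gradient_left]
      refine (hρd _).comp_hasDerivAt τ ?_
      have : HasDerivAt (fun τ : ℝ => s • quarterTurn b + (γ s + τ) • b) ((1 : ℝ) • b) τ :=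
        (((hasDerivAt_id τ).const_add (γ s)).smul_const b).const_add _
      rwa [one_smul] at this
    -- Along b the function ρ strictly decreases and it vanishes on the graph, so ρ < 0 exactly
    -- above the graph.
    have hanti : StrictAntiOn (fun τ => ρ (graphChart hb hγ.continuous (s, τ)))
        (Ioo (-min δ₁ δ₂) (min δ₁ δ₂)) := by
      refine strictAntiOn_of_deriv_neg (convex_Ioo _ _)
        (fun τ _ => (hder τ).continuousAt.continuousWithinAt) fun τ hτ' => ?_
      rw [interior_Ioo] at hτ'
      rw [(hder τ).deriv]
      exact (hmem s τ hs (abs_lt.2 hτ')).2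
    have := hanti.lt_iff_gt (a := τ) (b := 0) (abs_lt.1 hτ) ⟨by linarith, hδ⟩
    simp only [hρ0 s hs] at this
    exact this
  -- Differentiating ρ = 0 along the graph shows that the gradient is orthogonal to the tangent.
  · have h1 : (fun s' => ρ (graphChart hb hγ.continuous (s', 0))) =ᶠ[𝓝 s] fun _ => 0 := by
      have : ∀ᶠ s' in 𝓝 s, |s' - u.1| < min δ₁ δ₂ :=
        (continuous_abs.comp (continuous_id.sub continuous_const)).continuousAt.eventually
          (gt_mem_nhds hs)
      filter_upwards [this] with s' hs'
      exact hρ0 s' hs'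
    have h2 : HasDerivAt (fun s' => graphChart hb hγ.continuous (s', 0))
        (quarterTurn b + deriv γ s • b) s := by
      have h3 : HasDerivAt (fun s' : ℝ => s' • quarterTurn b + γ s' • b)
          ((1 : ℝ) • quarterTurn b + deriv γ s • b) s :=
        ((hasDerivAt_id s).smul_const _).add
          (((hγ.differentiable (by simp)) s).hasDerivAt.smul_const b)
      rw [one_smul] at h3
      exact h3.congr_of_eventuallyEq (Eventually.of_forall fun s' => hΦ s')
    have h4 := (hρd (graphChart hb hγ.continuous (s, 0))).comp_hasDerivAt s h2
    rw [inner_gradient_left]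
    exact h4.unique ((hasDerivAt_const s (0 : ℝ)).congr_of_eventuallyEq h1)

/-! ### Weakly differentiable functions along lines -/

/-- The integral of `ψ` along the segment of direction `b` and length `L` that ends at `y`. -/
noncomputable def segmentIntegral (ψ : Plane → ℝ) (b : Plane) (L : ℝ) (y : Plane) : ℝ :=
  ∫ r in Ioc 0 L, ψ (y - r • b)

/-- This is the convolution of ψ with a finite measure, the image of length under r ↦ r b, so it is
as smooth as ψ. -/
theorem contDiff_segmentIntegral {ψ : Plane → ℝ} (hψ : ContDiff ℝ ∞ ψ) (hc : HasCompactSupport ψ)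
    (b : Plane) (L : ℝ) : ContDiff ℝ ∞ (segmentIntegral ψ b L) := by
  let μ : Measure Plane := (volume.restrict (Ioc 0 L)).map fun r : ℝ => r • b
  have hm : Measurable fun r : ℝ => r • b := by fun_prop
  have hfin : IsFiniteMeasure (volume.restrict (Ioc (0 : ℝ) L)) := by
    refine ⟨?_⟩
    rw [Measure.restrict_apply_univ]
    exact measure_Ioc_lt_top
  have hμ : IsFiniteMeasure μ := Measure.isFiniteMeasure_map _ _
  have h1 := hc.contDiff_convolution_right (n := ⊤) (μ := μ) (f := fun _ => (1 : ℝ))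
    (ContinuousLinearMap.mul ℝ ℝ) (locallyIntegrable_const _) hψ
  convert h1 using 1
  ext y
  rw [segmentIntegral, convolution, integral_map hm.aemeasurable]
  · simp
  · exact (continuous_const.clm_apply
      (hψ.continuous.comp (continuous_const.sub continuous_id))).aestronglyMeasurable

/-- Moving the endpoint along b by t slides the window of integration to (t - L, t]; the fundamental
theorem of calculus gives the difference of the end values. -/
theorem fderiv_segmentIntegral {ψ : Plane → ℝ} (hψ : ContDiff ℝ ∞ ψ) (hc : HasCompactSupport ψ)
    (b : Plane) {L : ℝ} (hL : 0 ≤ L) (y : Plane) :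
    fderiv ℝ (segmentIntegral ψ b L) y b = ψ y - ψ (y - L • b) := by
  have hd : DifferentiableAt ℝ (segmentIntegral ψ b L) y :=
    (contDiff_segmentIntegral hψ hc b L).differentiable (by simp) y
  have h1 : HasDerivAt (fun t : ℝ => segmentIntegral ψ b L (y + t • b))
      (fderiv ℝ (segmentIntegral ψ b L) y b) 0 := by
    have h2 : HasDerivAt (fun t : ℝ => y + t • b) b 0 := by
      simpa using ((hasDerivAt_id (0 : ℝ)).smul_const b).const_add y
    have h3 : HasFDerivAt (segmentIntegral ψ b L) (fderiv ℝ (segmentIntegral ψ b L) y)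
      (y + (0 : ℝ) • b) := by simpa using hd.hasFDerivAt
    exact h3.comp_hasDerivAt 0 h2
  have hg : Continuous fun t : ℝ => ψ (y + t • b) := hψ.continuous.comp (by fun_prop)
  have h4 : (fun t : ℝ => segmentIntegral ψ b L (y + t • b)) =
      fun t => (∫ r in (0 : ℝ)..t, ψ (y + r • b)) - ∫ r in (0 : ℝ)..(t - L), ψ (y + r • b) := by
    ext t
    rw [intervalIntegral.integral_interval_sub_left (hg.intervalIntegrable _ _)
      (hg.intervalIntegrable _ _), segmentIntegral, ← intervalIntegral.integral_of_le hL]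
    have h5 := intervalIntegral.integral_comp_sub_left (a := 0) (b := L)
      (fun r => ψ (y + r • b)) t
    rw [sub_zero] at h5
    rw [← h5]
    refine intervalIntegral.integral_congr fun r _ => ?_
    simp only [sub_smul, add_sub_assoc]
  have hp : ∀ t, HasDerivAt (fun t : ℝ => ∫ r in (0 : ℝ)..t, ψ (y + r • b)) (ψ (y + t • b)) t :=
    fun t => intervalIntegral.integral_hasDerivAt_right (hg.intervalIntegrable _ _)
      hg.stronglyMeasurable.stronglyMeasurableAtFilter hg.continuousAt
  have h6 := (hp 0).sub ((hp (0 - L)).comp_sub_const 0 L)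
  rw [h4] at h1
  have h7 := h1.unique h6
  rw [h7]
  simp [sub_eq_add_neg]

/-- The derivative in the direction `b` of the product of a function with weak gradient `G` on `U`
and a smooth function `χ`, extended by zero. -/
noncomputable def productDeriv (U : Set Plane) (u : Plane → ℝ) (G : Plane → Plane) (χ : Plane → ℝ)
    (b : Plane) : Plane → ℝ :=
  U.indicator fun y => ⟪G y, b⟫ * χ y + u y * fderiv ℝ χ y b

theorem integrableOn_mul_of_hasCompactSupport {U : Set Plane} {u χ : Plane → ℝ}
    (hu : IntegrableOn u U) (hχ : Continuous χ) (hc : HasCompactSupport χ) :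
    IntegrableOn (fun y => u y * χ y) U := by
  obtain ⟨C, hC⟩ := hc.exists_bound_of_continuous hχ
  exact hu.mul_bdd (c := C) hχ.aestronglyMeasurable (Eventually.of_forall hC)

theorem continuous_fderiv_apply {χ : Plane → ℝ} (hχ : ContDiff ℝ ∞ χ) (b : Plane) :
    Continuous fun y => fderiv ℝ χ y b :=
  (hχ.continuous_fderiv (by simp)).clm_apply continuous_const

theorem hasCompactSupport_fderiv_apply {χ : Plane → ℝ} (hc : HasCompactSupport χ) (b : Plane) :
    HasCompactSupport fun y => fderiv ℝ χ y b :=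
  (hc.fderiv (𝕜 := ℝ)).comp_left (g := fun T : Plane →L[ℝ] ℝ => T b) (by simp)

theorem integrableOn_productDeriv {U : Set Plane} {u : Plane → ℝ} {G : Plane → Plane}
    (hu : IntegrableOn u U) (hG : IntegrableOn G U) {χ : Plane → ℝ} (hχ : ContDiff ℝ ∞ χ)
    (hc : HasCompactSupport χ) (b : Plane) :
    IntegrableOn (fun y => ⟪G y, b⟫ * χ y + u y * fderiv ℝ χ y b) U :=
  (integrableOn_mul_of_hasCompactSupport (hG.inner_const b) hχ.continuous hc).add
    (integrableOn_mul_of_hasCompactSupport hu (continuous_fderiv_apply hχ b)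
      (hasCompactSupport_fderiv_apply hc b))

theorem integrable_productDeriv {U : Set Plane} (hU : IsOpen U) {u : Plane → ℝ} {G : Plane → Plane}
    (hu : IntegrableOn u U) (hG : IntegrableOn G U) {χ : Plane → ℝ} (hχ : ContDiff ℝ ∞ χ)
    (hc : HasCompactSupport χ) (b : Plane) : Integrable (productDeriv U u G χ b) :=
  (integrable_indicator_iff hU.measurableSet).2 (integrableOn_productDeriv hu hG hχ hc b)

/-- This shear turns integrability of H into joint integrability of H(y + r b), as needed for
Fubini. -/
theorem measurePreserving_add_smul (b : Plane) (L : ℝ) :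
    MeasurePreserving (fun p : ℝ × Plane => (p.1, p.2 + p.1 • b))
      ((volume.restrict (Ioc 0 L)).prod volume) ((volume.restrict (Ioc 0 L)).prod volume) :=
  (MeasurePreserving.id _).skew_product (g := fun r y => y + r • b)
    (by unfold Function.uncurry; fun_prop)
    (Eventually.of_forall fun r => map_add_right_eq_self volume (r • b))

theorem integrable_comp_add_smul {H : Plane → ℝ} (hH : Integrable H) (b : Plane) (L : ℝ) :
    Integrable (fun p : ℝ × Plane => H (p.2 + p.1 • b))
      ((volume.restrict (Ioc 0 L)).prod volume) := by
  have hfin : IsFiniteMeasure (volume.restrict (Ioc (0 : ℝ) L)) := by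
    refine ⟨?_⟩
    rw [Measure.restrict_apply_univ]
    exact measure_Ioc_lt_top
  have h1 : Integrable (fun p : ℝ × Plane => H p.2) ((volume.restrict (Ioc 0 L)).prod volume) :=
    hH.comp_snd _
  exact (measurePreserving_add_smul b L).integrable_comp_of_integrable h1

/-- `∫ H Ψ = ∫ ψ P` for `Ψ` the integral of `ψ` over the segments that end at a point and `P` the
integral of `H` over the segments that start there. -/
theorem integral_mul_segmentIntegral {H ψ : Plane → ℝ} (hH : Integrable H) (hψ : Continuous ψ)
    (hc : HasCompactSupport ψ) (b : Plane) (L : ℝ) :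
    ∫ y, H y * segmentIntegral ψ b L y = ∫ y, ψ y * ∫ r in Ioc 0 L, H (y + r • b) := by
  obtain ⟨C, hC⟩ := hc.exists_bound_of_continuous hψ
  have hfin : IsFiniteMeasure (volume.restrict (Ioc (0 : ℝ) L)) := by
    refine ⟨?_⟩
    rw [Measure.restrict_apply_univ]
    exact measure_Ioc_lt_top
  have h1 : Integrable (fun p : ℝ × Plane => H p.2 * ψ (p.2 - p.1 • b))
      ((volume.restrict (Ioc 0 L)).prod volume) := by
    have h0 : Integrable (fun p : ℝ × Plane => H p.2) ((volume.restrict (Ioc 0 L)).prod volume) :=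
      hH.comp_snd _
    exact h0.mul_bdd (c := C) (hψ.comp (by fun_prop)).aestronglyMeasurable
      (Eventually.of_forall fun p => hC _)
  have h2 : Integrable (fun p : ℝ × Plane => ψ p.2 * H (p.2 + p.1 • b))
      ((volume.restrict (Ioc 0 L)).prod volume) :=
    (integrable_comp_add_smul hH b L).bdd_mul (c := C)
      (hψ.comp continuous_snd).aestronglyMeasurable (Eventually.of_forall fun p => hC _)
  calc ∫ y, H y * segmentIntegral ψ b L y
      = ∫ y, ∫ r in Ioc 0 L, H y * ψ (y - r • b) := by
        simp only [segmentIntegral, integral_const_mul]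
    _ = ∫ r in Ioc 0 L, ∫ y, H y * ψ (y - r • b) := (integral_integral_swap h1).symm
    _ = ∫ r in Ioc 0 L, ∫ y, ψ y * H (y + r • b) := by
        refine integral_congr_ae (Eventually.of_forall fun r => ?_)
        simp only
        rw [← integral_add_right_eq_self _ (r • b)]
        simp only [add_sub_cancel_right, mul_comm]
    _ = ∫ y, ∫ r in Ioc 0 L, ψ y * H (y + r • b) := integral_integral_swap h2
    _ = _ := by simp only [integral_const_mul]

/-- On an open set `W ⊆ U` from which the direction `b` leads into `U` as long as it stays in the
support of `χ`, the product of `χ` and a weakly differentiable function is almost everywhere the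
integral of its derivative along the lines in the direction `b`. -/
theorem HasWeakGradientOn.mul_ae_eq {U W : Set Plane} (hU : IsOpen U) (hW : IsOpen W) (hWU : W ⊆ U)
    {u : Plane → ℝ} {G : Plane → Plane} (h : HasWeakGradientOn U u G) (hu : IntegrableOn u U)
    (hG : IntegrableOn G U) {χ : Plane → ℝ} (hχ : ContDiff ℝ ∞ χ) (hc : HasCompactSupport χ)
    {b : Plane} {L : ℝ} (hL : 0 ≤ L)
    (hup : ∀ y ∈ W, ∀ r : ℝ, 0 ≤ r → y + r • b ∈ tsupport χ → y + r • b ∈ U)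
    (hout : ∀ y ∈ W, y + L • b ∉ tsupport χ) :
    ∀ᵐ y, y ∈ W → u y * χ y = -∫ r in Ioc 0 L, productDeriv U u G χ b (y + r • b) := by
  set H := productDeriv U u G χ b with hH
  have hHi : Integrable H := integrable_productDeriv hU hu hG hχ hc b
  have hPi : Integrable fun y => ∫ r in Ioc 0 L, H (y + r • b) :=
    (integrable_comp_add_smul hHi b L).integral_prod_right
  have hui : IntegrableOn (fun y => u y * χ y) U :=
    integrableOn_mul_of_hasCompactSupport hu hχ.continuous hc
  have hloc : LocallyIntegrableOn (fun y => u y * χ y + ∫ r in Ioc 0 L, H (y + r • b)) W :=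
    ((hui.mono_set hWU).add hPi.integrableOn).locallyIntegrableOn
  -- By the fundamental lemma of the calculus of variations it suffices to test against ψ supported
  -- in W.
  have key := hW.ae_eq_zero_of_integral_contDiff_smul_eq_zero hloc ?_
  · filter_upwards [key] with y hy hyW
    linarith [hy hyW]
  intro ψ hψ hψc hψW
  -- The weak gradient is tested against χΨ: since the b-derivative of Ψ is ψ minus a translate,
  -- this isolates ∫ uχψ.
  set Ψ := segmentIntegral ψ b L with hΨ
  have hΨs : ContDiff ℝ ∞ Ψ := contDiff_segmentIntegral hψ hψc b L
  have hsupp : tsupport Ψ ⊆ (fun p : ℝ × Plane => p.2 + p.1 • b) '' (Icc 0 L ×ˢ tsupport ψ) := by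
    refine closure_minimal ?_ ?_
    · intro y hy
      by_contra hn
      refine hy ?_
      rw [hΨ, segmentIntegral]
      refine setIntegral_eq_zero_of_forall_eq_zero fun r hr => ?_
      refine image_eq_zero_of_notMem_tsupport fun hy' => hn ?_
      exact ⟨(r, y - r • b), ⟨Ioc_subset_Icc_self hr, hy'⟩, by simp⟩
    · exact ((isCompact_Icc.prod hψc).image (by fun_prop)).isClosed
  -- The support of Ψ consists of forward translates of that of ψ, and `hup` keeps these in U as
  -- long as they meet the support of χ.
  have hprod : tsupport (fun y => χ y * Ψ y) ⊆ U := by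
    intro y hy
    have h1 : y ∈ tsupport χ := tsupport_mul_subset_left hy
    obtain ⟨⟨r, z⟩, ⟨hr, hz⟩, rfl⟩ := hsupp (tsupport_mul_subset_right hy)
    exact hup z (hψW hz) r hr.1 h1
  have hweak := h.integral_eq _ (hχ.mul hΨs) (hc.mul_right (f' := Ψ)) hprod b
  have hder : ∀ y, fderiv ℝ (fun y => χ y * Ψ y) y b =
      χ y * ψ y + fderiv ℝ χ y b * Ψ y := by
    intro y
    rw [fderiv_fun_mul (hχ.differentiable (by simp) y) (hΨs.differentiable (by simp) y)]
    simp only [_root_.add_apply, _root_.smul_apply, smul_eq_mul]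
    rw [hΨ, fderiv_segmentIntegral hψ hψc b hL]
    -- By `hout` the translate of ψ by L b has left the support of χ.
    have h0 : χ y * ψ (y - L • b) = 0 := by
      by_cases hy : y - L • b ∈ tsupport ψ
      · have h1 := hout _ (hψW hy)
        rw [sub_add_cancel] at h1
        rw [image_eq_zero_of_notMem_tsupport h1, zero_mul]
      · rw [image_eq_zero_of_notMem_tsupport hy, mul_zero]
    rw [mul_sub, h0, sub_zero]
    ring
  simp only [hder] at hweak
  obtain ⟨C, hC⟩ := hψc.exists_bound_of_continuous hψ.continuous
  have hΨb : ∀ y, ‖Ψ y‖ ≤ C * (volume.real (Ioc 0 L)) := fun y =>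
    norm_setIntegral_le_of_norm_le_const measure_Ioc_lt_top fun r _ => hC _
  have i1 : IntegrableOn (fun y => u y * χ y * ψ y) U :=
    hui.mul_bdd (c := C) hψ.continuous.aestronglyMeasurable (Eventually.of_forall hC)
  have i2 : IntegrableOn (fun y => u y * fderiv ℝ χ y b * Ψ y) U :=
    (integrableOn_mul_of_hasCompactSupport hu (continuous_fderiv_apply hχ b)
      (hasCompactSupport_fderiv_apply hc b)).mul_bdd
      hΨs.continuous.aestronglyMeasurable (Eventually.of_forall hΨb)
  have i3 : IntegrableOn (fun y => ⟪G y, b⟫ * χ y * Ψ y) U :=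
    (integrableOn_mul_of_hasCompactSupport (hG.inner_const b) hχ.continuous hc).mul_bdd
      hΨs.continuous.aestronglyMeasurable (Eventually.of_forall hΨb)
  have e1 : ∫ y in U, u y * χ y * ψ y = -∫ y, H y * Ψ y := by
    have e2 : ∫ y, H y * Ψ y = ∫ y in U, (⟪G y, b⟫ * χ y * Ψ y + u y * fderiv ℝ χ y b * Ψ y) := by
      rw [← integral_indicator hU.measurableSet]
      refine integral_congr_ae (Eventually.of_forall fun y => ?_)
      simp only [hH, productDeriv, indicator]
      split_ifs
      · ring
      · simp
    rw [e2, integral_add i3 i2]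
    have e3 : ∫ y in U, u y * (χ y * ψ y + fderiv ℝ χ y b * Ψ y) =
        (∫ y in U, u y * χ y * ψ y) + ∫ y in U, u y * fderiv ℝ χ y b * Ψ y := by
      rw [← integral_add i1 i2]
      refine integral_congr_ae (Eventually.of_forall fun y => ?_)
      ring
    have e4 : ∫ y in U, ⟪G y, b⟫ * (χ y * Ψ y) = ∫ y in U, ⟪G y, b⟫ * χ y * Ψ y :=
      integral_congr_ae (Eventually.of_forall fun y => by ring)
    rw [e3, e4] at hweak
    linarith
  rw [hΨ, integral_mul_segmentIntegral hHi hψ.continuous hψc] at e1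
  have e5 : ∫ y in U, u y * χ y * ψ y = ∫ y, ψ y * (U.indicator (fun y => u y * χ y) y) := by
    rw [← integral_indicator hU.measurableSet]
    refine integral_congr_ae (Eventually.of_forall fun y => ?_)
    simp only [indicator]
    split_ifs
    · ring
    · simp
  rw [e5] at e1
  have i4 : Integrable fun y => ψ y * (U.indicator (fun y => u y * χ y) y) :=
    ((integrable_indicator_iff hU.measurableSet).2 hui).bdd_mul (c := C)
      hψ.continuous.aestronglyMeasurable (Eventually.of_forall hC)
  have i5 : Integrable fun y => ψ y * ∫ r in Ioc 0 L, H (y + r • b) :=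
    hPi.bdd_mul (c := C) hψ.continuous.aestronglyMeasurable (Eventually.of_forall hC)
  have e6 : ∫ y, ψ y • (u y * χ y + ∫ r in Ioc 0 L, H (y + r • b)) =
      (∫ y, ψ y * (U.indicator (fun y => u y * χ y) y)) +
        ∫ y, ψ y * ∫ r in Ioc 0 L, H (y + r • b) := by
    rw [← integral_add i4 i5]
    refine integral_congr_ae (Eventually.of_forall fun y => ?_)
    simp only [indicator, smul_eq_mul]
    split_ifs with hy
    · ring
    · have : ψ y = 0 := image_eq_zero_of_notMem_tsupport fun h' => hy (hWU (hψW h'))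
      simp [this]
  rw [e6, e1]
  ring

/-! ### Boundary values on a half-plane -/

theorem setIntegral_prod_comp_fst {D : ℝ → ℝ} (s t : Set ℝ) :
    ∫ p in s ×ˢ t, D p.1 = volume.real t * ∫ x in s, D x := by
  have := setIntegral_prod_mul (μ := volume) (ν := volume) D (fun _ : ℝ => (1 : ℝ)) s t
  simp only [mul_one] at this
  rw [Measure.volume_eq_prod, this, mul_comm]
  congr 1
  simp

/-- Boundary values at almost every point of the line `τ = 0`: if `ξ (s, τ)` differs from `a s` by
at most the integral of an integrable function `k` over the segment from `(s, 0)` to `(s, τ)`,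
then at almost every `s₀` the mean of `|ξ - a s₀|` over boxes that shrink to `(s₀, 0)` is small. -/
theorem ae_tendsto_box {ξ k : ℝ × ℝ → ℝ} {a : ℝ → ℝ} {I : Set ℝ} (hI : IsOpen I) {δ : ℝ}
    (hδ : 0 < δ) (ha : Integrable a) (hk : Integrable k) (hk0 : ∀ p, 0 ≤ k p)
    (h : ∀ᵐ p : ℝ × ℝ, p.1 ∈ I → 0 < p.2 → p.2 < δ →
      |ξ p - a p.1| ≤ ∫ τ in Ioc 0 p.2, k (p.1, τ)) :
    ∀ᵐ s₀, s₀ ∈ I → ∀ C > 0, Tendsto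
      (fun r : ℝ => (r ^ 2)⁻¹ * ∫ p in Metric.closedBall s₀ r ×ˢ Ioo 0 (C * r), |ξ p - a s₀|)
      (𝓝[>] 0) (𝓝 0) := by
  -- The majorant of |ξ - a| below height 1/(n+1). Countably many heights keep the exceptional set
  -- null: s₀ is taken as a Lebesgue point of a and of every κ n, and κ n s₀ → 0.
  set κ : ℕ → ℝ → ℝ := fun n s => ∫ τ in Ioc (0 : ℝ) (1 / (n + 1)), k (s, τ) with hκ
  have hk' : Integrable k (volume.prod volume) := hk
  have hκi : ∀ n, Integrable (κ n) := by
    intro n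
    have h1 : Integrable k ((volume : Measure ℝ).prod
        (volume.restrict (Ioc (0 : ℝ) (1 / (n + 1))))) := by
      have h2 := hk'.restrict (s := univ ×ˢ Ioc (0 : ℝ) (1 / (n + 1)))
      rwa [← Measure.prod_restrict, Measure.restrict_univ] at h2
    exact h1.integral_prod_left
  have hks : ∀ᵐ s, Integrable fun τ => k (s, τ) := hk'.prod_right_ae
  have hks' : ∀ᵐ p : ℝ × ℝ, Integrable fun τ => k (p.1, τ) :=
    Measure.quasiMeasurePreserving_fst.ae hks
  have hL1 := IsUnifLocDoublingMeasure.ae_tendsto_average_norm_sub volume ha.locallyIntegrable 1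
  have hL2 : ∀ᵐ s₀, ∀ n, Tendsto (fun r => ⨍ s in Metric.closedBall s₀ r, κ n s) (𝓝[>] 0)
      (𝓝 (κ n s₀)) := by
    rw [ae_all_iff]
    intro n
    filter_upwards [IsUnifLocDoublingMeasure.ae_tendsto_average volume (hκi n).locallyIntegrable 1]
      with s₀ hs
    refine hs (fun _ => s₀) (fun r => r) tendsto_id ?_
    filter_upwards [self_mem_nhdsWithin] with r (hr : 0 < r)
    exact Metric.mem_closedBall_self (by linarith)
  filter_upwards [hks, hL1, hL2] with s₀ h1 h2 h3 hs₀ C hC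
  have h2' : Tendsto (fun r => ⨍ s in Metric.closedBall s₀ r, ‖a s - a s₀‖) (𝓝[>] 0) (𝓝 0) := by
    refine h2 (fun _ => s₀) (fun r => r) tendsto_id ?_
    filter_upwards [self_mem_nhdsWithin] with r (hr : 0 < r)
    exact Metric.mem_closedBall_self (by linarith)
  have hκ0 : Tendsto (fun n => κ n s₀) atTop (𝓝 0) := by
    have hlim := tendsto_setIntegral_of_antitone (μ := volume) (f := fun τ => k (s₀, τ))
      (s := fun n : ℕ => Ioc (0 : ℝ) (1 / (n + 1))) (fun n => measurableSet_Ioc)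
      (fun m n hmn => Ioc_subset_Ioc_right (Nat.one_div_le_one_div hmn)) ⟨0, h1.integrableOn⟩
    have hempty : ⋂ n : ℕ, Ioc (0 : ℝ) (1 / (n + 1)) = ∅ := by
      ext x
      simp only [mem_iInter, mem_Ioc, mem_empty_iff_false, iff_false, not_forall]
      by_contra! hx
      obtain ⟨n, hn⟩ := exists_nat_one_div_lt (hx 0).1
      exact absurd (hx n).2 (not_le.2 hn)
    rw [hempty, Measure.restrict_empty, integral_zero_measure] at hlim
    exact hlim
  have hnn : ∀ r : ℝ, 0 ≤ (r ^ 2)⁻¹ *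
      ∫ p in Metric.closedBall s₀ r ×ˢ Ioo 0 (C * r), |ξ p - a s₀| := fun r =>
    mul_nonneg (by positivity) (integral_nonneg fun _ => abs_nonneg _)
  rw [Metric.tendsto_nhds]
  intro ε hε
  have h4 : Tendsto (fun n => 2 * C * κ n s₀) atTop (𝓝 0) := by
    simpa using hκ0.const_mul (2 * C)
  obtain ⟨n, hn⟩ := (h4.eventually (gt_mem_nhds hε)).exists
  have h5 : Tendsto (fun r => 2 * C * ((⨍ s in Metric.closedBall s₀ r, ‖a s - a s₀‖) +
      ⨍ s in Metric.closedBall s₀ r, κ n s)) (𝓝[>] 0) (𝓝 (2 * C * (0 + κ n s₀))) :=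
    (h2'.add (h3 n)).const_mul _
  rw [zero_add] at h5
  obtain ⟨η, hη, hηI⟩ := Metric.isOpen_iff.1 hI s₀ hs₀
  -- For such r the box lies over I, below height δ, and below height 1/(n+1).
  have hm : 0 < min (η / 2) (min (δ / C) (1 / (n + 1) / C)) := by positivity
  filter_upwards [h5.eventually (gt_mem_nhds hn), Ioo_mem_nhdsGT hm] with r hr hr'
  have hr0 : 0 < r := hr'.1
  have hrη : r ≤ η / 2 := hr'.2.le.trans (min_le_left _ _)
  have hrδ : C * r ≤ δ := by
    have := hr'.2.le.trans ((min_le_right _ _).trans (min_le_left _ _))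
    rwa [le_div_iff₀ hC, mul_comm] at this
  have hrn : C * r ≤ 1 / (n + 1) := by
    have := hr'.2.le.trans ((min_le_right _ _).trans (min_le_right _ _))
    rwa [le_div_iff₀ hC, mul_comm] at this
  rw [Real.dist_eq, sub_zero, abs_of_nonneg (hnn r)]
  refine lt_of_le_of_lt ?_ hr
  set B := Metric.closedBall s₀ r with hB
  have i1 : IntegrableOn (fun s => ‖a s - a s₀‖) B :=
    (ha.integrableOn.sub (integrableOn_const measure_closedBall_lt_top.ne)).norm
  have i2 : IntegrableOn (κ n) B := (hκi n).integrableOn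
  have hDi : IntegrableOn (fun p : ℝ × ℝ => ‖a p.1 - a s₀‖ + κ n p.1) (B ×ˢ Ioo 0 (C * r)) := by
    have hfin : IsFiniteMeasure (volume.restrict (Ioo 0 (C * r))) := by
      refine ⟨?_⟩
      rw [Measure.restrict_apply_univ]
      exact measure_Ioo_lt_top
    rw [IntegrableOn, Measure.volume_eq_prod, ← Measure.prod_restrict]
    exact (i1.add i2).comp_fst (ν := volume.restrict (Ioo 0 (C * r)))
  have hle : ∫ p in B ×ˢ Ioo 0 (C * r), |ξ p - a s₀| ≤
      ∫ p in B ×ˢ Ioo 0 (C * r), (‖a p.1 - a s₀‖ + κ n p.1) := by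
    refine integral_mono_of_nonneg (Eventually.of_forall fun _ => abs_nonneg _) hDi ?_
    filter_upwards [ae_restrict_of_ae h, ae_restrict_of_ae hks', ae_restrict_mem
      (measurableSet_closedBall.prod measurableSet_Ioo)] with p hp1 hp2 hp3
    have hpI : p.1 ∈ I := hηI (by
      have : dist p.1 s₀ ≤ r := hp3.1
      rw [Metric.mem_ball]
      linarith)
    have hp4 := hp1 hpI hp3.2.1 (hp3.2.2.trans_le hrδ)
    have hp5 : ∫ τ in Ioc 0 p.2, k (p.1, τ) ≤ κ n p.1 :=
      setIntegral_mono_set hp2.integrableOn (Eventually.of_forall fun τ => hk0 _)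
        (Eventually.of_forall (Ioc_subset_Ioc_right (hp3.2.2.le.trans hrn)))
    calc |ξ p - a s₀| = |(ξ p - a p.1) + (a p.1 - a s₀)| := by ring_nf
      _ ≤ |ξ p - a p.1| + |a p.1 - a s₀| := abs_add_le _ _
      _ ≤ _ := by rw [Real.norm_eq_abs]; linarith
  have hvB : volume.real B = 2 * r := by
    rw [hB, measureReal_def, Real.volume_closedBall, ENNReal.toReal_ofReal (by positivity)]
  have hCr : volume.real (Ioo 0 (C * r)) = C * r := by
    rw [measureReal_def, Real.volume_Ioo, sub_zero, ENNReal.toReal_ofReal (by positivity)]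
  rw [setIntegral_prod_comp_fst (D := fun s => ‖a s - a s₀‖ + κ n s), hCr,
    integral_add i1 i2] at hle
  calc (r ^ 2)⁻¹ * ∫ p in B ×ˢ Ioo 0 (C * r), |ξ p - a s₀|
      ≤ (r ^ 2)⁻¹ * (C * r * ((∫ s in B, ‖a s - a s₀‖) + ∫ s in B, κ n s)) :=
        mul_le_mul_of_nonneg_left hle (by positivity)
    _ = _ := by
      rw [setAverage_eq, setAverage_eq, hvB, smul_eq_mul, smul_eq_mul]
      field_simp

/-- Transfer of boundary values from a half-plane to a region above a graph. -/
theorem hasTraceAt_of_tendsto_box {U : Set Plane} {b : Plane} (hb : ‖b‖ = 1)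
    {γ : ℝ → ℝ} (hγ : ContDiff ℝ 1 γ) {s₀ δ : ℝ} (hδ : 0 < δ)
    (hchart : ∀ s τ, |s - s₀| < δ → |τ| < δ → graphChart hb hγ.continuous (s, τ) ∈ U → 0 < τ)
    {k : ℝ} (hk : 0 < k) (hvol : ∀ᶠ r in 𝓝[>] (0 : ℝ),
      k * r ^ 2 ≤ volume.real (Metric.ball (graphChart hb hγ.continuous (s₀, 0)) r ∩ U))
    {u : Plane → ℝ} (hu : Integrable u) {a : ℝ}
    (h : ∀ C > 0, Tendsto (fun r : ℝ => (r ^ 2)⁻¹ *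
      ∫ p in Metric.closedBall s₀ r ×ˢ Ioo 0 (C * r), |u (graphChart hb hγ.continuous p) - a|)
      (𝓝[>] 0) (𝓝 0)) :
    HasTraceAt U u (graphChart hb hγ.continuous (s₀, 0)) a := by
  set Φ := graphChart hb hγ.continuous with hΦ
  -- Since |γ s - γ s₀| ≤ M|s - s₀| near s₀, the part of U in the ball of radius r lies in a chart
  -- box of half-width r and height (1 + M) r, whose area is comparable to r².
  obtain ⟨M, hM0, hM⟩ := (((hγ.differentiable (by simp)) s₀).hasFDerivAt.isBigO_sub).exists_pos
  obtain ⟨η, hη, hγη⟩ := Metric.eventually_nhds_iff.1 hM.bound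
  have hCpos : 0 < 1 + M := by positivity
  have hlim := (h (1 + M) hCpos).const_mul k⁻¹
  rw [mul_zero] at hlim
  refine HasTraceAt.of_le hlim ?_
  have hm : 0 < min η (min δ (δ / (1 + M))) := by positivity
  filter_upwards [hvol, Ioo_mem_nhdsGT hm] with r hr hr'
  have hr0 : 0 < r := hr'.1
  have hrη : r < η := hr'.2.trans_le (min_le_left _ _)
  have hrδ : r < δ := hr'.2.trans_le ((min_le_right _ _).trans (min_le_left _ _))
  have hrδ' : (1 + M) * r < δ := by
    have := hr'.2.trans_le ((min_le_right _ _).trans (min_le_right _ _))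
    rwa [lt_div_iff₀ hCpos, mul_comm] at this
  set S := Metric.ball (Φ (s₀, 0)) r ∩ U with hS
  set box := Metric.closedBall s₀ r ×ˢ Ioo 0 ((1 + M) * r) with hbox
  have hsub : S ⊆ Φ '' box := by
    rintro y ⟨hy, hyU⟩
    obtain ⟨⟨s, τ⟩, rfl⟩ := Φ.surjective y
    rw [mem_ball_iff_norm] at hy
    have hdiff : Φ (s, τ) - Φ (s₀, 0) =
        (s - s₀) • quarterTurn b + (γ s + τ - γ s₀) • b := by
      simp only [hΦ, graphChart_apply, add_zero, sub_smul]
      abel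
    have hsq : (s - s₀) ^ 2 + (γ s + τ - γ s₀) ^ 2 < r ^ 2 := by
      rw [← norm_sq_frame hb, ← hdiff]
      exact pow_lt_pow_left₀ hy (norm_nonneg _) two_ne_zero
    have h1 : |s - s₀| < r := abs_lt_of_sq_lt_sq (by nlinarith [sq_nonneg (γ s + τ - γ s₀)]) hr0.le
    have h2 : |γ s + τ - γ s₀| < r := abs_lt_of_sq_lt_sq (by nlinarith [sq_nonneg (s - s₀)]) hr0.le
    have h3 : |γ s - γ s₀| ≤ M * |s - s₀| := by
      have := hγη (y := s) (by rw [Real.dist_eq]; linarith)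
      simpa [Real.norm_eq_abs] using this
    have h4 : M * |s - s₀| ≤ M * r := mul_le_mul_of_nonneg_left h1.le hM0.le
    have h5 : |τ| < (1 + M) * r := by
      have := abs_lt.1 h2
      have := abs_le.1 (h3.trans h4)
      rw [abs_lt]
      constructor <;> linarith
    refine ⟨(s, τ), ⟨?_, ?_, (le_abs_self τ).trans_lt h5⟩, rfl⟩
    · rw [Metric.mem_closedBall, Real.dist_eq]
      exact h1.le
    · exact hchart s τ (h1.trans hrδ) (h5.trans hrδ') hyU
  have hboxm : MeasurableSet box := measurableSet_closedBall.prod measurableSet_Ioo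
  have hmp := measurePreserving_graphChart hb hγ.continuous
  have hme := measurableEmbedding_graphChart hb hγ.continuous
  have hint : ∫ y in Φ '' box, |u y - a| = ∫ p in box, |u (Φ p) - a| :=
    hmp.setIntegral_image_emb hme _ _
  have hvfin : volume (Φ '' box) ≠ ⊤ := by
    rw [← hmp.measure_preimage_emb hme, preimage_image_eq _ Φ.injective, hbox,
      Measure.volume_eq_prod, Measure.prod_prod]
    exact ENNReal.mul_ne_top measure_closedBall_lt_top.ne measure_Ioo_lt_top.ne
  have hle : ∫ y in S, |u y - a| ≤ ∫ y in Φ '' box, |u y - a| :=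
    setIntegral_mono_set (hu.integrableOn.sub (integrableOn_const hvfin)).abs
      (Eventually.of_forall fun _ => abs_nonneg _) (Eventually.of_forall hsub)
  rw [hint] at hle
  have h0 : 0 ≤ ∫ p in box, |u (Φ p) - a| := integral_nonneg fun _ => abs_nonneg _
  rw [setAverage_eq, smul_eq_mul]
  calc (volume.real S)⁻¹ * ∫ y in S, |u y - a|
      ≤ (k * r ^ 2)⁻¹ * ∫ p in box, |u (Φ p) - a| :=
        mul_le_mul (inv_anti₀ (by positivity) hr) hle
          (integral_nonneg fun _ => abs_nonneg _) (by positivity)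
    _ = _ := by rw [mul_inv, mul_assoc]

/-! ### Regions above graphs -/

/-- `n` is the field of outer unit normals of a set with smooth sides. -/
def IsNormalField (U : Set Plane) (n : Plane → Plane) : Prop :=
  ∀ x ∈ frontier U, ∃ ρ, IsSideAt U x ρ ∧ n x = (‖gradient ρ x‖)⁻¹ • gradient ρ x

theorem IsNormalField.eq {U : Set Plane} (hU : IsOpen U) {n : Plane → Plane}
    (hn : IsNormalField U n) {x : Plane} (hx : x ∈ frontier U) {ρ : Plane → ℝ}
    (h : IsSideAt U x ρ) : n x = (‖gradient ρ x‖)⁻¹ • gradient ρ x := by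
  obtain ⟨ρ', h', he⟩ := hn x hx
  rw [he, h'.normal_unique hU hx h]

/-- In the chart of the graph of `γ` over the line orthogonal to `b`, and over the interval of
radius `δ` around `s₀`, the set `U` is the region above the graph, with unit normal `n`. -/
structure IsGraphRegion (U : Set Plane) (n : Plane → Plane) {b : Plane} (hb : ‖b‖ = 1) {γ : ℝ → ℝ}
    (hγ : ContDiff ℝ 1 γ) (s₀ δ : ℝ) : Prop where
  pos : 0 < δ
  mem_iff : ∀ s τ, |s - s₀| < δ → |τ| < δ → (graphChart hb hγ.continuous (s, τ) ∈ U ↔ 0 < τ)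
  side : ∀ s, |s - s₀| < δ → ∃ ρ, IsSideAt U (graphChart hb hγ.continuous (s, 0)) ρ
  normal : ∀ s, |s - s₀| < δ →
    √(1 + deriv γ s ^ 2) * ⟪n (graphChart hb hγ.continuous (s, 0)), b⟫ = -1

/-- The open box of radius `δ` around `(s₀, 0)`. -/
def chartBox (s₀ δ : ℝ) : Set (ℝ × ℝ) := Metric.ball s₀ δ ×ˢ Metric.ball 0 δ

theorem isOpen_chartBox (s₀ δ : ℝ) : IsOpen (chartBox s₀ δ) :=
  Metric.isOpen_ball.prod Metric.isOpen_ball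

theorem mem_chartBox {s₀ δ : ℝ} {p : ℝ × ℝ} : p ∈ chartBox s₀ δ ↔ |p.1 - s₀| < δ ∧ |p.2| < δ := by
  simp [chartBox, Real.dist_eq]

theorem measurableSet_image_chartBox {b : Plane} (hb : ‖b‖ = 1) {γ : ℝ → ℝ} (hγ : Continuous γ)
    (s₀ δ : ℝ) : MeasurableSet (graphChart hb hγ '' chartBox s₀ δ) :=
  ((graphChart hb hγ).isOpenMap _ (isOpen_chartBox s₀ δ)).measurableSet

theorem mem_frontier_of_chart {U : Set Plane} (hU : IsOpen U) {b : Plane} {hb : ‖b‖ = 1}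
    {γ : ℝ → ℝ} {hγ : Continuous γ} {s₀ δ : ℝ}
    (hmem : ∀ s τ, |s - s₀| < δ → |τ| < δ → (graphChart hb hγ (s, τ) ∈ U ↔ 0 < τ))
    {s τ : ℝ} (hs : |s - s₀| < δ) (hτ : |τ| < δ) :
    graphChart hb hγ (s, τ) ∈ frontier U ↔ τ = 0 := by
  rw [hU.frontier_eq, Set.mem_sdiff, hmem s τ hs hτ, not_lt]
  have hlim : Tendsto (fun t => graphChart hb hγ (s, t)) (𝓝 τ) (𝓝 (graphChart hb hγ (s, τ))) :=
    ((graphChart hb hγ).continuous.comp (by fun_prop)).tendsto τ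
  constructor
  · rintro ⟨hcl, hle⟩
    refine le_antisymm hle (not_lt.1 fun hneg => ?_)
    -- The part of the box below the graph is open and misses U, so no point of it is in the closure
    -- of U.
    set V := graphChart hb hγ '' (Metric.ball s₀ δ ×ˢ (Metric.ball 0 δ ∩ Iio 0)) with hV
    have hVo : IsOpen V := (graphChart hb hγ).isOpenMap _
      (Metric.isOpen_ball.prod (Metric.isOpen_ball.inter isOpen_Iio))
    have hyV : graphChart hb hγ (s, τ) ∈ V :=
      mem_image_of_mem _ ⟨by simpa [Real.dist_eq] using hs, by simpa using hτ, hneg⟩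
    obtain ⟨y, hy, hyU⟩ := mem_closure_iff.1 hcl V hVo hyV
    obtain ⟨⟨s', τ'⟩, ⟨h1, h2, h3⟩, rfl⟩ := hy
    exact lt_asymm h3 ((hmem s' τ' (by simpa [Real.dist_eq] using h1) (by simpa using h2)).1 hyU)
  · rintro rfl
    refine ⟨mem_closure_of_tendsto (hlim.mono_left nhdsWithin_le_nhds : Tendsto _ (𝓝[>] (0 : ℝ)) _) ?_,
      le_rfl⟩
    filter_upwards [Ioo_mem_nhdsGT ((abs_nonneg _).trans_lt hs)] with t ht
    exact (hmem s t hs (by rw [abs_of_pos ht.1]; exact ht.2)).2 ht.1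

/-- A boundary point of a set with smooth sides has a neighbourhood in which the set is the region
above a graph. -/
theorem IsNormalField.exists_isGraphRegion {U : Set Plane} (hU : IsOpen U) {n : Plane → Plane}
    (hn : IsNormalField U n) {x : Plane} (hx : x ∈ frontier U) {b : Plane} (hb : ‖b‖ = 1)
    (hneg : ⟪n x, b⟫ < 0) :
    ∃ γ : ℝ → ℝ, ∃ hγ : ContDiff ℝ 1 γ, ∃ s₀ δ : ℝ, IsGraphRegion U n hb hγ s₀ δ ∧
      graphChart hb hγ.continuous (s₀, 0) = x := by
  obtain ⟨ρ, h, he⟩ := hn x hx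
  have hp : 0 < ‖gradient ρ x‖ := norm_pos_iff.2 h.gradient_ne_zero
  have hneg' : ⟪gradient ρ x, b⟫ < 0 := by
    rw [he, real_inner_smul_left] at hneg
    by_contra! h0
    exact absurd hneg (not_lt.2 (mul_nonneg (inv_nonneg.2 hp.le) h0))
  obtain ⟨γ, hγ, s₀, δ, hδ, hΦx, hbox⟩ := h.exists_graphChart hU hx hb hneg'
  refine ⟨γ, hγ, s₀, δ, ⟨hδ, fun s τ hs hτ => (hbox s τ hs hτ).1, fun s hs =>
    ⟨ρ, (hbox s 0 hs (by simpa using hδ)).2.1⟩, fun s hs => ?_⟩, hΦx⟩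
  have h0 : |(0 : ℝ)| < δ := by simpa using hδ
  obtain ⟨-, h1, h2, h3⟩ := hbox s 0 hs h0
  have hfr : graphChart hb hγ.continuous (s, 0) ∈ frontier U :=
    (mem_frontier_of_chart hU (fun s τ hs hτ => (hbox s τ hs hτ).1) hs h0).2 rfl
  rw [hn.eq hU hfr h1]
  set p := gradient ρ (graphChart hb hγ.continuous (s, 0)) with hp
  rw [inner_add_right, real_inner_smul_right] at h3
  have h4 : ‖p‖ ^ 2 = ⟪quarterTurn b, p⟫ ^ 2 + ⟪b, p⟫ ^ 2 := by
    conv_lhs => rw [← frame_expansion hb p]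
    rw [norm_sq_frame hb]
  rw [real_inner_comm] at h2
  rw [real_inner_comm, real_inner_comm b p] at h3
  -- Orthogonality of p to the tangent gives its component along the rotated b as -γ' times its
  -- component along b, which is negative.
  have h5 : ‖p‖ = √(1 + deriv γ s ^ 2) * -⟪b, p⟫ := by
    rw [← Real.sqrt_sq (norm_nonneg p), ← Real.sqrt_sq (neg_nonneg.2 h2.le),
      ← Real.sqrt_mul (by positivity), h4]
    congr 1
    have : ⟪quarterTurn b, p⟫ = - (deriv γ s * ⟪b, p⟫) := by linarith
    rw [this]
    ring
  have h6 : 0 < √(1 + deriv γ s ^ 2) := Real.sqrt_pos.2 (by positivity)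
  rw [real_inner_smul_left, h5, real_inner_comm b p]
  have h7 : ⟪b, p⟫ ≠ 0 := h2.ne
  field_simp

namespace IsGraphRegion

variable {U : Set Plane} {n : Plane → Plane} {b : Plane} {hb : ‖b‖ = 1} {γ : ℝ → ℝ}
  {hγ : ContDiff ℝ 1 γ} {s₀ δ : ℝ}

theorem frontier_inter_eq (hU : IsOpen U) (h : IsGraphRegion U n hb hγ s₀ δ) :
    frontier U ∩ graphChart hb hγ.continuous '' chartBox s₀ δ =
      (fun s => graphChart hb hγ.continuous (s, 0)) '' Metric.ball s₀ δ := by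
  ext y
  constructor
  · rintro ⟨hy, ⟨s, τ⟩, hp, rfl⟩
    obtain ⟨h1, h2⟩ := mem_chartBox.1 hp
    have := (mem_frontier_of_chart hU h.mem_iff h1 h2).1 hy
    obtain rfl : τ = 0 := this
    exact ⟨s, by simpa [Real.dist_eq] using h1, rfl⟩
  · rintro ⟨s, hs, rfl⟩
    have h1 : |s - s₀| < δ := by simpa [Real.dist_eq] using hs
    have h2 : |(0 : ℝ)| < δ := by simpa using h.pos
    exact ⟨(mem_frontier_of_chart hU h.mem_iff h1 h2).2 rfl,
      mem_image_of_mem _ (mem_chartBox.2 ⟨h1, h2⟩)⟩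

/-- In the chart the boundary is the line τ = 0, so arc length becomes the speed density on the
parameter interval. -/
theorem restrict_frontier_inter (hU : IsOpen U) (h : IsGraphRegion U n hb hγ s₀ δ) :
    (Measure.hausdorffMeasure 1 : Measure Plane).restrict
      (frontier U ∩ graphChart hb hγ.continuous '' chartBox s₀ δ) =
    ((volume.restrict (Metric.ball s₀ δ)).withDensity
      fun s => ENNReal.ofReal √(1 + deriv γ s ^ 2)).map
        fun s => graphChart hb hγ.continuous (s, 0) := by
  have hσ := hasSpeed_graphChart hb hγ.continuous hγ
  rw [h.frontier_inter_eq hU, ← inter_eq_self_of_subset_left (image_subset_range _ _),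
    ← Measure.restrict_restrict
      (hσ.measurableEmbedding.measurableSet_image' measurableSet_ball),
    hσ.hausdorffMeasure_restrict_range, hσ.measurableEmbedding.restrict_map,
    preimage_image_eq _ hσ.injective, restrict_withDensity measurableSet_ball]

/-- The function on the boundary that corresponds to a function on the interval of the chart. -/
noncomputable def boundaryFun (_ : IsGraphRegion U n hb hγ s₀ δ) (a : ℝ → ℝ) : Plane → ℝ :=
  (graphChart hb hγ.continuous '' chartBox s₀ δ).indicator
    fun y => a ((graphChart hb hγ.continuous).symm y).1

theorem integrable_boundaryFun (hU : IsOpen U) (h : IsGraphRegion U n hb hγ s₀ δ) {a : ℝ → ℝ}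
    (ha : Integrable a) : Integrable (h.boundaryFun a)
      ((Measure.hausdorffMeasure 1 : Measure Plane).restrict (frontier U)) := by
  have hσ := hasSpeed_graphChart hb hγ.continuous hγ
  rw [boundaryFun, integrable_indicator_iff (measurableSet_image_chartBox hb hγ.continuous s₀ δ), IntegrableOn,
    Measure.restrict_restrict (measurableSet_image_chartBox hb hγ.continuous s₀ δ), inter_comm,
    h.restrict_frontier_inter hU, hσ.measurableEmbedding.integrable_map_iff,
    integrable_withDensity_iff_integrable_smul' (hσ.continuous.measurable.ennreal_ofReal)
      (Eventually.of_forall fun _ => ENNReal.ofReal_lt_top)]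
  obtain ⟨C, hC⟩ := (isCompact_closedBall s₀ δ).exists_bound_of_continuousOn
    hσ.continuous.continuousOn
  have ha' : Integrable ((fun y => a ((graphChart hb hγ.continuous).symm y).1) ∘
      fun s => graphChart hb hγ.continuous (s, 0)) (volume.restrict (Metric.ball s₀ δ)) := by
    refine ha.integrableOn.congr (Eventually.of_forall fun s => ?_)
    simp
  refine ha'.bdd_mul (c := C) ?_ ?_
  · exact hσ.continuous.measurable.ennreal_ofReal.ennreal_toReal.aestronglyMeasurable
  · refine ae_restrict_of_forall_mem measurableSet_ball fun s hs => ?_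
    rw [ENNReal.toReal_ofReal (Real.sqrt_nonneg _)]
    exact hC s (Metric.ball_subset_closedBall hs)

/-- The length density √(1 + γ'²) cancels against ⟪n, b⟫ = -1/√(1 + γ'²), leaving the plain integral
in the parameter. -/
theorem integral_boundaryFun (hU : IsOpen U) (h : IsGraphRegion U n hb hγ s₀ δ) {a : ℝ → ℝ}
    (ha0 : ∀ s, s ∉ Metric.ball s₀ δ → a s = 0) :
    ∫ x in frontier U, h.boundaryFun a x * ⟪n x, b⟫ ∂(Measure.hausdorffMeasure 1) = -∫ s, a s := by
  have hσ := hasSpeed_graphChart hb hγ.continuous hγ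
  have h1 : ∀ x, h.boundaryFun a x * ⟪n x, b⟫ =
      (graphChart hb hγ.continuous '' chartBox s₀ δ).indicator
        (fun y => a ((graphChart hb hγ.continuous).symm y).1 * ⟪n y, b⟫) x := by
    intro x
    simp only [boundaryFun, indicator]
    split_ifs <;> simp
  simp only [h1]
  rw [integral_indicator (measurableSet_image_chartBox hb hγ.continuous s₀ δ),
    Measure.restrict_restrict (measurableSet_image_chartBox hb hγ.continuous s₀ δ), inter_comm,
    h.restrict_frontier_inter hU, hσ.measurableEmbedding.integral_map,
    integral_withDensity_eq_integral_toReal_smul (hσ.continuous.measurable.ennreal_ofReal)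
      (Eventually.of_forall fun _ => ENNReal.ofReal_lt_top), ← integral_neg,
    ← setIntegral_eq_integral_of_forall_compl_eq_zero (s := Metric.ball s₀ δ)
      (f := fun s => -a s) (fun s hs => by simp [ha0 s hs])]
  refine setIntegral_congr_fun measurableSet_ball fun s hs => ?_
  have h2 := h.normal s (by simpa [Real.dist_eq] using hs)
  simp only [Homeomorph.symm_apply_apply, smul_eq_mul]
  rw [ENNReal.toReal_ofReal (Real.sqrt_nonneg _)]
  linear_combination a s * h2

theorem ae_frontier_inter (hU : IsOpen U) (h : IsGraphRegion U n hb hγ s₀ δ) {p : Plane → Prop}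
    (hp : ∀ᵐ s, s ∈ Metric.ball s₀ δ → p (graphChart hb hγ.continuous (s, 0))) :
    ∀ᵐ x ∂(Measure.hausdorffMeasure 1 : Measure Plane),
      x ∈ frontier U ∩ graphChart hb hγ.continuous '' chartBox s₀ δ → p x := by
  have hσ := hasSpeed_graphChart hb hγ.continuous hγ
  rw [← ae_restrict_iff' (isClosed_frontier.measurableSet.inter (measurableSet_image_chartBox hb hγ.continuous s₀ δ)),
    h.restrict_frontier_inter hU, hσ.measurableEmbedding.ae_map_iff]
  exact (withDensity_absolutelyContinuous _ _).ae_le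
    ((ae_restrict_iff' measurableSet_ball).2 hp)

end IsGraphRegion

/-! ### The divergence theorem for integrable functions with integrable weak gradient -/

/-- The length measure of the boundary of `U`. -/
noncomputable def boundaryMeasure (U : Set Plane) : Measure Plane :=
  (Measure.hausdorffMeasure 1 : Measure Plane).restrict (frontier U)

/-- The formula of Green in the direction `v`, localized to the set `N`: the products of `u` with
test functions supported in `N` have integrable traces and satisfy the formula. -/
def HasGreenOn (U : Set Plane) (n : Plane → Plane) (u : Plane → ℝ) (G : Plane → Plane) (v : Plane)
    (N : Set Plane) : Prop :=
  ∀ χ : Plane → ℝ, ContDiff ℝ ∞ χ → HasCompactSupport χ → tsupport χ ⊆ N →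
    ∃ a : Plane → ℝ, Integrable a (boundaryMeasure U) ∧
      (∀ᵐ x ∂boundaryMeasure U, HasTraceAt U (fun y => u y * χ y) x (a x)) ∧
      ∫ y in U, (⟪G y, v⟫ * χ y + u y * fderiv ℝ χ y v) = ∫ x, a x * ⟪n x, v⟫ ∂boundaryMeasure U

theorem productDeriv_eq_zero {U : Set Plane} {u : Plane → ℝ} {G : Plane → Plane} {χ : Plane → ℝ}
    {b y : Plane} (hy : y ∉ tsupport χ) : productDeriv U u G χ b y = 0 := by
  have h1 : fderiv ℝ χ y = 0 := by
    by_contra h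
    exact hy (support_fderiv_subset ℝ h)
  simp [productDeriv, indicator, h1, image_eq_zero_of_notMem_tsupport hy]

theorem hasTraceAt_indicator {U : Set Plane} (hU : MeasurableSet U) {u : Plane → ℝ} {x : Plane}
    {a : ℝ} (h : HasTraceAt U (U.indicator u) x a) : HasTraceAt U u x a := by
  refine h.congr_of_eventuallyEq hU ?_
  filter_upwards [self_mem_nhdsWithin] with y hy
  rw [indicator_of_mem hy]

theorem setIntegral_Ioc_comp_add {k : ℝ → ℝ} (τ L : ℝ) :
    ∫ r in Ioc 0 L, k (τ + r) = ∫ r in Ioc τ (τ + L), k r := by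
  rcases le_total 0 L with hL | hL
  · rw [← intervalIntegral.integral_of_le hL, ← intervalIntegral.integral_of_le (by linarith),
      intervalIntegral.integral_comp_add_left, add_zero]
  · rw [Ioc_eq_empty (not_lt.2 hL), Ioc_eq_empty (by simpa using hL)]
    simp

/-- An integral over `(τ, τ + L]` for an integrand that vanishes outside `(0, τ + L]`. -/
theorem neg_setIntegral_Ioc_eq {k : ℝ → ℝ} (hk : Integrable k) {τ L : ℝ} (hτ : 0 ≤ τ) (hL : 0 ≤ L)
    (hk0 : ∀ r, r ∉ Ioc 0 (τ + L) → k r = 0) :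
    -∫ r in Ioc τ (τ + L), k r = (-∫ r, k r) + ∫ r in Ioc 0 τ, k r := by
  have h1 : ∫ r, k r = ∫ r in Ioc 0 (τ + L), k r :=
    (setIntegral_eq_integral_of_forall_compl_eq_zero hk0).symm
  rw [h1, ← Ioc_union_Ioc_eq_Ioc hτ (by linarith : τ ≤ τ + L),
    setIntegral_union (Ioc_disjoint_Ioc_of_le le_rfl) measurableSet_Ioc hk.integrableOn
      hk.integrableOn]
  ring

/-- Let H be the b-derivative of uχ, extended by 0. In the chart uχ at (s, τ) is minus the integral
of H above τ, so it differs from a(s) = -∫ H(s, ·) only by the integral over (0, τ]. Hence a is the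
trace by `ae_tendsto_box`, and Fubini turns ∫ H into -∫ a, which is the boundary integral. -/
theorem IsGraphRegion.hasGreenOn {U : Set Plane} (hU : IsOpen U) {n : Plane → Plane} {b : Plane}
    {hb : ‖b‖ = 1} {γ : ℝ → ℝ} {hγ : ContDiff ℝ 1 γ} {s₀ δ : ℝ}
    (h : IsGraphRegion U n hb hγ s₀ δ) {u : Plane → ℝ} {G : Plane → Plane}
    (hw : HasWeakGradientOn U u G) (hu : IntegrableOn u U) (hG : IntegrableOn G U) :
    HasGreenOn U n u G b (graphChart hb hγ.continuous '' chartBox s₀ δ) := by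
  intro χ hχ hc hχN
  set Φ := graphChart hb hγ.continuous with hΦ
  have hmp : MeasurePreserving Φ := measurePreserving_graphChart hb hγ.continuous
  have hme : MeasurableEmbedding Φ := measurableEmbedding_graphChart hb hγ.continuous
  have hδ := h.pos
  have hmemQ : ∀ s τ, Φ (s, τ) ∈ tsupport χ → |s - s₀| < δ ∧ |τ| < δ := by
    intro s τ hs
    obtain ⟨p, hp, he⟩ := hχN hs
    obtain rfl := Φ.injective he
    exact mem_chartBox.1 hp
  set H := productDeriv U u G χ b with hH
  have hHi : Integrable H := integrable_productDeriv hU hu hG hχ hc b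
  have hHΦ : Integrable fun p => H (Φ p) := hmp.integrable_comp_of_integrable hHi
  -- Off the box χ vanishes, and in the box below the graph the indicator of U does.
  have hHz : ∀ s τ, (¬ |s - s₀| < δ ∨ τ ∉ Ioc 0 δ) → H (Φ (s, τ)) = 0 := by
    intro s τ hst
    by_cases hm : Φ (s, τ) ∈ tsupport χ
    · obtain ⟨h1, h2⟩ := hmemQ s τ hm
      have hτ : τ ∉ Ioc 0 δ := hst.resolve_left (not_not.2 h1)
      have hτ0 : ¬ 0 < τ := fun h0 => hτ ⟨h0, ((le_abs_self τ).trans_lt h2).le⟩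
      have : Φ (s, τ) ∉ U := fun hUm => hτ0 ((h.mem_iff s τ h1 h2).1 hUm)
      simp [hH, productDeriv, this]
    · exact productDeriv_eq_zero hm
  set a : ℝ → ℝ := fun s => -∫ τ, H (Φ (s, τ)) with ha
  have hHΦ' : Integrable (fun p => H (Φ p)) (volume.prod volume) := hHΦ
  have hai : Integrable a := hHΦ'.integral_prod_left.neg
  have ha0 : ∀ s, s ∉ Metric.ball s₀ δ → a s = 0 := by
    intro s hs
    have h1 : ∀ τ, H (Φ (s, τ)) = 0 := fun τ => hHz s τ (Or.inl (by
      simpa [Real.dist_eq] using hs))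
    simp [ha, h1]
  have hui : IntegrableOn (fun y => u y * χ y) U :=
    integrableOn_mul_of_hasCompactSupport hu hχ.continuous hc
  refine ⟨h.boundaryFun a, h.integrable_boundaryFun hU hai, ?_, ?_⟩
  · have hacl := hw.mul_ae_eq hU (hU.inter (Φ.isOpenMap _ (isOpen_chartBox s₀ δ)))
      inter_subset_left hu hG hχ hc (b := b) (L := 2 * δ) (by positivity)
      (by
        rintro _ ⟨hyU, ⟨s, τ⟩, hp, rfl⟩ r hr hm
        obtain ⟨h1, h2⟩ := mem_chartBox.1 hp
        rw [hΦ, graphChart_add_smul] at hm ⊢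
        obtain ⟨h3, h4⟩ := hmemQ _ _ hm
        have := (h.mem_iff s τ h1 h2).1 hyU
        exact (h.mem_iff s (τ + r) h3 h4).2 (by linarith))
      (by
        rintro _ ⟨hyU, ⟨s, τ⟩, hp, rfl⟩ hm
        obtain ⟨h1, h2⟩ := mem_chartBox.1 hp
        rw [hΦ, graphChart_add_smul] at hm
        have h3 := (abs_lt.1 (hmemQ _ _ hm).2).2
        have := (h.mem_iff s τ h1 h2).1 hyU
        linarith)
    have hξ : ∀ᵐ p : ℝ × ℝ, p.1 ∈ Metric.ball s₀ δ → 0 < p.2 → p.2 < δ →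
        |U.indicator (fun y => u y * χ y) (Φ p) - a p.1| ≤
          ∫ τ in Ioc 0 p.2, |H (Φ (p.1, τ))| := by
      filter_upwards [hmp.quasiMeasurePreserving.ae hacl,
        Measure.quasiMeasurePreserving_fst.ae hHΦ'.prod_right_ae] with p hp1 hp2 h1 h2 h3
      obtain ⟨s, τ⟩ := p
      simp only at h1 h2 h3 hp2 ⊢
      have hs : |s - s₀| < δ := by simpa [Real.dist_eq] using h1
      have hτ : |τ| < δ := by rwa [abs_of_pos h2]
      have hmU : Φ (s, τ) ∈ U := (h.mem_iff s τ hs hτ).2 h2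
      rw [indicator_of_mem hmU, hp1 ⟨hmU, mem_image_of_mem _ (mem_chartBox.2 ⟨hs, hτ⟩)⟩]
      have hadd : ∀ r : ℝ, Φ (s, τ) + r • b = Φ (s, τ + r) := fun r =>
        graphChart_add_smul hb hγ.continuous s τ r
      simp only [← hH, hadd]
      rw [setIntegral_Ioc_comp_add (k := fun τ => H (Φ (s, τ))),
        neg_setIntegral_Ioc_eq hp2 h2.le (by positivity) fun r hr => hHz s r (Or.inr fun hr' =>
          hr ⟨hr'.1, by linarith [hr'.2]⟩), ha]
      simp only [add_sub_cancel_left]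
      exact abs_integral_le_integral_abs
    have hbox := ae_tendsto_box Metric.isOpen_ball hδ hai hHΦ.abs (fun p => abs_nonneg _) hξ
    have htr : ∀ᵐ s, s ∈ Metric.ball s₀ δ →
        HasTraceAt U (fun y => u y * χ y) (Φ (s, 0)) (h.boundaryFun a (Φ (s, 0))) := by
      filter_upwards [hbox] with s hs hsI
      have hs1 : |s - s₀| < δ := by simpa [Real.dist_eq] using hsI
      have h0 : |(0 : ℝ)| < δ := by simpa using hδ
      have hbf : h.boundaryFun a (Φ (s, 0)) = a s := by
        rw [IsGraphRegion.boundaryFun, indicator_of_mem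
          (mem_image_of_mem _ (mem_chartBox.2 ⟨hs1, h0⟩)), ← hΦ, Homeomorph.symm_apply_apply]
      rw [hbf]
      obtain ⟨ρ, hρ⟩ := h.side s hs1
      obtain ⟨k, hk, hvol⟩ := hρ.volume_ball_inter_ge
        (hρ.apply_eq_zero hU ((mem_frontier_of_chart hU h.mem_iff hs1 h0).2 rfl))
      -- With radius δ - |s - s₀| the box recentred at s stays inside the original one.
      refine hasTraceAt_indicator hU.measurableSet (hasTraceAt_of_tendsto_box hb hγ
        (δ := δ - |s - s₀|) (sub_pos.2 hs1) ?_ hk hvol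
        ((integrable_indicator_iff hU.measurableSet).2 hui) (hs hsI))
      intro s' τ hs' hτ hm
      have h1 : |s' - s₀| < δ := by
        have := abs_sub_le s' s s₀
        linarith
      have h2 : |τ| < δ := by
        have := abs_nonneg (s - s₀)
        linarith
      exact (h.mem_iff s' τ h1 h2).1 hm
    rw [boundaryMeasure, ae_restrict_iff' isClosed_frontier.measurableSet]
    filter_upwards [h.ae_frontier_inter hU
      (p := fun x => HasTraceAt U (fun y => u y * χ y) x (h.boundaryFun a x)) htr] with x hx hxU
    -- At boundary points outside the chart χ vanishes nearby, matching the value 0 of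
    -- `boundaryFun`.
    by_cases hxQ : x ∈ Φ '' chartBox s₀ δ
    · exact hx ⟨hxU, hxQ⟩
    · rw [IsGraphRegion.boundaryFun, indicator_of_notMem hxQ]
      refine HasTraceAt.of_eventually_zero hU.measurableSet ?_
      have : ∀ᶠ y in 𝓝 x, y ∉ tsupport χ :=
        (isClosed_tsupport χ).isOpen_compl.mem_nhds fun hm => hxQ (hχN hm)
      filter_upwards [nhdsWithin_le_nhds this] with y hy
      rw [image_eq_zero_of_notMem_tsupport hy, mul_zero]
  · rw [boundaryMeasure, h.integral_boundaryFun hU ha0, ← integral_indicator hU.measurableSet]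
    change ∫ y, H y = _
    rw [← hmp.integral_comp hme, Measure.volume_eq_prod, integral_prod _ hHΦ', ha, integral_neg,
      neg_neg]

/-! ### From one direction to all directions -/

theorem IsNormalField.norm_eq_one {U : Set Plane} {n : Plane → Plane} (hn : IsNormalField U n)
    {x : Plane} (hx : x ∈ frontier U) : ‖n x‖ = 1 := by
  obtain ⟨ρ, h, he⟩ := hn x hx
  rw [he, norm_smul, norm_inv, norm_norm, inv_mul_cancel₀ (norm_ne_zero_iff.2 h.gradient_ne_zero)]

/-- By uniqueness of the normal, one defining function ρ describes n at all nearby boundary points.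
Continuity supplies the measurability of n. -/
theorem IsNormalField.continuousOn {U : Set Plane} (hU : IsOpen U) {n : Plane → Plane}
    (hn : IsNormalField U n) : ContinuousOn n (frontier U) := by
  intro x hx
  obtain ⟨ρ, h, he⟩ := hn x hx
  have hc : ContinuousAt (fun y => (‖gradient ρ y‖)⁻¹ • gradient ρ y) x := by
    have := (continuous_gradient h.smooth).continuousAt (x := x)
    exact (this.norm.inv₀ (norm_ne_zero_iff.2 h.gradient_ne_zero)).smul this
  refine hc.continuousWithinAt.congr_of_eventuallyEq ?_ he
  filter_upwards [nhdsWithin_le_nhds h.eventually, self_mem_nhdsWithin] with y hy hyU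
  exact hn.eq hU hyU hy

theorem IsNormalField.integrable_mul_inner {U : Set Plane} (hU : IsOpen U) {n : Plane → Plane}
    (hn : IsNormalField U n) {a : Plane → ℝ} (ha : Integrable a (boundaryMeasure U)) (v : Plane) :
    Integrable (fun x => a x * ⟪n x, v⟫) (boundaryMeasure U) := by
  refine ha.mul_bdd (c := ‖v‖) ?_ ?_
  · exact ((hn.continuousOn hU).inner continuousOn_const).aestronglyMeasurable
      isClosed_frontier.measurableSet
  · refine ae_restrict_of_forall_mem isClosed_frontier.measurableSet fun x hx => ?_
    calc ‖⟪n x, v⟫‖ ≤ ‖n x‖ * ‖v‖ := norm_inner_le_norm _ _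
      _ = ‖v‖ := by rw [hn.norm_eq_one hx, one_mul]

theorem HasGreenOn.smul {U N : Set Plane} {n : Plane → Plane} {u : Plane → ℝ} {G : Plane → Plane}
    {v : Plane} (h : HasGreenOn U n u G v N) (t : ℝ) : HasGreenOn U n u G (t • v) N := by
  intro χ hχ hc hN
  obtain ⟨a, ha, htr, he⟩ := h χ hχ hc hN
  refine ⟨a, ha, htr, ?_⟩
  have h1 : ∀ y, ⟪G y, t • v⟫ * χ y + u y * fderiv ℝ χ y (t • v) =
      t * (⟪G y, v⟫ * χ y + u y * fderiv ℝ χ y v) := by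
    intro y
    rw [real_inner_smul_right, map_smul, smul_eq_mul]
    ring
  have h2 : ∀ x, a x * ⟪n x, t • v⟫ = t * (a x * ⟪n x, v⟫) := by
    intro x
    rw [real_inner_smul_right]
    ring
  simp only [h1, h2, integral_const_mul, he]

theorem HasGreenOn.mono {U N N' : Set Plane} {n : Plane → Plane} {u : Plane → ℝ}
    {G : Plane → Plane} {v : Plane} (h : HasGreenOn U n u G v N) (hN : N' ⊆ N) :
    HasGreenOn U n u G v N' := fun χ hχ hc hχN => h χ hχ hc (hχN.trans hN)

/-- The trace functions obtained for v and for w agree almost everywhere by uniqueness of traces, so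
the two formulas can be subtracted. -/
theorem HasGreenOn.sub {U N : Set Plane} (hU : IsOpen U) {n : Plane → Plane}
    (hn : IsNormalField U n) {u : Plane → ℝ} {G : Plane → Plane} (hu : IntegrableOn u U)
    (hG : IntegrableOn G U) {v w : Plane} (hv : HasGreenOn U n u G v N)
    (hw : HasGreenOn U n u G w N) : HasGreenOn U n u G (v - w) N := by
  intro χ hχ hc hN
  obtain ⟨a, ha, htr, he⟩ := hv χ hχ hc hN
  obtain ⟨a', ha', htr', he'⟩ := hw χ hχ hc hN
  have haa : a' =ᵐ[boundaryMeasure U] a := by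
    filter_upwards [htr, htr', ae_restrict_mem isClosed_frontier.measurableSet] with x h1 h2 h3
    exact h2.unique hU (frontier_subset_closure h3)
      (integrableOn_mul_of_hasCompactSupport hu hχ.continuous hc) h1
  refine ⟨a, ha, htr, ?_⟩
  have h1 : ∀ y, ⟪G y, v - w⟫ * χ y + u y * fderiv ℝ χ y (v - w) =
      (⟪G y, v⟫ * χ y + u y * fderiv ℝ χ y v) - (⟪G y, w⟫ * χ y + u y * fderiv ℝ χ y w) := by
    intro y
    rw [inner_sub_right, map_sub]
    ring
  have h2 : ∀ x, a x * ⟪n x, v - w⟫ = a x * ⟪n x, v⟫ - a x * ⟪n x, w⟫ := by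
    intro x
    rw [inner_sub_right]
    ring
  simp only [h1, h2]
  rw [integral_sub (integrableOn_productDeriv hu hG hχ hc v)
    (integrableOn_productDeriv hu hG hχ hc w), integral_sub (hn.integrable_mul_inner hU ha v)
    (hn.integrable_mul_inner hU ha w), he, he']
  congr 1
  refine integral_congr_ae ?_
  filter_upwards [haa] with x hx
  rw [hx]

/-- An inward v, once normalized, can serve as the vertical direction of a graph chart. -/
theorem IsNormalField.exists_hasGreenOn_of_inner_neg {U : Set Plane} (hU : IsOpen U)
    {n : Plane → Plane} (hn : IsNormalField U n) {u : Plane → ℝ} {G : Plane → Plane}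
    (hw : HasWeakGradientOn U u G) (hu : IntegrableOn u U) (hG : IntegrableOn G U) {x : Plane}
    (hx : x ∈ frontier U) {v : Plane} (hv : ⟪n x, v⟫ < 0) :
    ∃ N, IsOpen N ∧ x ∈ N ∧ HasGreenOn U n u G v N := by
  have hv0 : 0 < ‖v‖ := by
    rw [norm_pos_iff]
    rintro rfl
    simp at hv
  have hb : ‖(‖v‖⁻¹ • v)‖ = 1 := by
    rw [norm_smul, norm_inv, norm_norm, inv_mul_cancel₀ hv0.ne']
  obtain ⟨γ, hγ, s₀, δ, h, hΦ⟩ := hn.exists_isGraphRegion hU hx hb (by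
    rw [real_inner_smul_right]
    exact mul_neg_of_pos_of_neg (inv_pos.2 hv0) hv)
  refine ⟨_, (graphChart hb hγ.continuous).isOpenMap _ (isOpen_chartBox s₀ δ), ?_, ?_⟩
  · rw [← hΦ]
    exact mem_image_of_mem _ (mem_chartBox.2 ⟨by simpa using h.pos, by simpa using h.pos⟩)
  · have := (h.hasGreenOn hU hw hu hG).smul ‖v‖
    rwa [smul_smul, mul_inv_cancel₀ hv0.ne', one_smul] at this

/-- At interior points this is the definition of the weak gradient, with zero trace. At a boundary
point v = (v - t n) - (-t n), and for large t both directions point inward. -/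
theorem IsNormalField.exists_hasGreenOn {U : Set Plane} (hU : IsOpen U) {n : Plane → Plane}
    (hn : IsNormalField U n) {u : Plane → ℝ} {G : Plane → Plane} (hw : HasWeakGradientOn U u G)
    (hu : IntegrableOn u U) (hG : IntegrableOn G U) {x : Plane} (hx : x ∈ closure U) (v : Plane) :
    ∃ N, IsOpen N ∧ x ∈ N ∧ HasGreenOn U n u G v N := by
  by_cases hxU : x ∈ U
  · refine ⟨U, hU, hxU, fun χ hχ hc hN => ⟨0, integrable_zero _ _ _, ?_, ?_⟩⟩
    · refine ae_restrict_of_forall_mem isClosed_frontier.measurableSet fun y hy => ?_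
      refine HasTraceAt.of_eventually_zero hU.measurableSet ?_
      rw [hU.frontier_eq] at hy
      have : ∀ᶠ z in 𝓝 y, z ∉ tsupport χ :=
        (isClosed_tsupport χ).isOpen_compl.mem_nhds fun hm => hy.2 (hN hm)
      filter_upwards [nhdsWithin_le_nhds this] with z hz
      rw [image_eq_zero_of_notMem_tsupport hz, mul_zero]
    · rw [integral_add (integrableOn_mul_of_hasCompactSupport (hG.inner_const v) hχ.continuous hc)
        (integrableOn_mul_of_hasCompactSupport hu (continuous_fderiv_apply hχ v)
          (hasCompactSupport_fderiv_apply hc v)), hw.integral_eq χ hχ hc hN v]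
      simp
  · have hxf : x ∈ frontier U := by
      rw [hU.frontier_eq]
      exact ⟨hx, hxU⟩
    have hnn : ⟪n x, n x⟫ = 1 := by rw [real_inner_self_eq_norm_sq, hn.norm_eq_one hxf, one_pow]
    set t : ℝ := |⟪n x, v⟫| + 1 with ht
    have ht0 : 0 < t := by positivity
    obtain ⟨N₁, h1, h2, h3⟩ := hn.exists_hasGreenOn_of_inner_neg hU hw hu hG hxf
      (v := v - t • n x) (by
        rw [inner_sub_right, real_inner_smul_right, hnn]
        have := le_abs_self ⟪n x, v⟫
        linarith)
    obtain ⟨N₂, h4, h5, h6⟩ := hn.exists_hasGreenOn_of_inner_neg hU hw hu hG hxf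
      (v := -(t • n x)) (by
        rw [inner_neg_right, real_inner_smul_right, hnn]
        linarith)
    refine ⟨N₁ ∩ N₂, h1.inter h4, ⟨h2, h5⟩, ?_⟩
    have := (h3.mono inter_subset_left).sub hU hn hu hG (h6.mono inter_subset_right)
    simpa using this

/-- A finite smooth partition of unity on a compact set. -/
theorem exists_finite_partition {S : Set Plane} (hS : IsCompact S) {N : ∀ x ∈ S, Set Plane}
    (hN : ∀ x hx, IsOpen (N x hx) ∧ x ∈ N x hx) :
    ∃ (ι : Type) (_ : Fintype ι) (χ : ι → Plane → ℝ), (∀ i, ContDiff ℝ ∞ (χ i)) ∧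
      (∀ i, HasCompactSupport (χ i)) ∧ (∀ i, ∃ x hx, tsupport (χ i) ⊆ N x hx) ∧
      ∀ y ∈ S, ∑ i, χ i y = 1 := by
  obtain ⟨t, ht⟩ := hS.elim_nhds_subcover' (fun x hx => N x hx ∩ Metric.ball x 1) fun x hx =>
    inter_mem ((hN x hx).1.mem_nhds (hN x hx).2) (Metric.ball_mem_nhds x one_pos)
  obtain ⟨f, hf⟩ := SmoothPartitionOfUnity.exists_isSubordinate (modelWithCornersSelf ℝ Plane)
    hS.isClosed (fun i : t => N i.1.1 i.1.2 ∩ Metric.ball i.1.1 1)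
    (fun i => (hN i.1.1 i.1.2).1.inter Metric.isOpen_ball) (by
      intro y hy
      obtain ⟨i, hi, hyi⟩ := mem_iUnion₂.1 (ht hy)
      exact mem_iUnion.2 ⟨⟨i, hi⟩, hyi⟩)
  refine ⟨t, inferInstance, fun i => f i, fun i => (f i).contMDiff.contDiff, fun i => ?_,
    fun i => ⟨i.1.1, i.1.2, (hf i).trans inter_subset_left⟩, fun y hy => ?_⟩
  · exact (isCompact_closedBall i.1.1 1).of_isClosed_subset (isClosed_tsupport _)
      (((hf i).trans inter_subset_right).trans Metric.ball_subset_closedBall)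
  · rw [← finsum_eq_sum_of_fintype]
    exact f.sum_eq_one hy

/-- **Divergence theorem** for an integrable function with integrable weak gradient on a bounded
open set with smooth sides. -/
theorem HasWeakGradientOn.green {U : Set Plane} (hU : IsOpen U) (hUb : Bornology.IsBounded U)
    {n : Plane → Plane} (hn : IsNormalField U n) {u : Plane → ℝ} {G : Plane → Plane}
    (hw : HasWeakGradientOn U u G) (hu : IntegrableOn u U) (hG : IntegrableOn G U) (v : Plane) :
    Integrable (boundaryTrace U u) (boundaryMeasure U) ∧
      (∀ᵐ x ∂boundaryMeasure U, HasTraceAt U u x (boundaryTrace U u x)) ∧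
      ∫ y in U, ⟪G y, v⟫ = ∫ x, boundaryTrace U u x * ⟪n x, v⟫ ∂boundaryMeasure U := by
  choose N hNo hxN hN using fun x hx => hn.exists_hasGreenOn hU hw hu hG (x := x) hx v
  obtain ⟨ι, _, χ, hχ, hc, hsub, hone⟩ := exists_finite_partition hUb.isCompact_closure
    (N := N) fun x hx => ⟨hNo x hx, hxN x hx⟩
  have hloc : ∀ i, ∃ a : Plane → ℝ, Integrable a (boundaryMeasure U) ∧
      (∀ᵐ x ∂boundaryMeasure U, HasTraceAt U (fun y => u y * χ i y) x (a x)) ∧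
      ∫ y in U, (⟪G y, v⟫ * χ i y + u y * fderiv ℝ (χ i) y v) =
        ∫ x, a x * ⟪n x, v⟫ ∂boundaryMeasure U := by
    intro i
    obtain ⟨x, hx, hs⟩ := hsub i
    exact hN x hx (χ i) (hχ i) (hc i) hs
  choose a ha htr he using hloc
  have htr' : ∀ᵐ x ∂boundaryMeasure U, HasTraceAt U u x (∑ i, a i x) := by
    filter_upwards [ae_all_iff.2 htr] with x hx
    have h1 := HasTraceAt.sum Finset.univ (fun i _ => integrableOn_mul_of_hasCompactSupport hu
      (hχ i).continuous (hc i)) fun i _ => hx i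
    refine h1.congr_of_eventuallyEq hU.measurableSet ?_
    filter_upwards [self_mem_nhdsWithin] with y hy
    rw [← Finset.mul_sum, hone y (subset_closure hy), mul_one]
  have heq : boundaryTrace U u =ᵐ[boundaryMeasure U] fun x => ∑ i, a i x := by
    filter_upwards [htr', ae_restrict_mem isClosed_frontier.measurableSet] with x h1 h2
    exact h1.boundaryTrace_eq hU (frontier_subset_closure h2) hu
  refine ⟨(integrable_finsetSum _ fun i _ => ha i).congr heq.symm, ?_, ?_⟩
  · filter_upwards [htr', heq] with x h1 h2
    rwa [h2]
  -- The partition sums to 1 on U, so the terms in which the derivative falls on the cutoffs cancel.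
  · have hder : ∀ y ∈ U, ∑ i, fderiv ℝ (χ i) y v = 0 := by
      intro y hy
      have h1 : HasFDerivAt (fun z => ∑ i, χ i z) (∑ i, fderiv ℝ (χ i) y) y :=
        HasFDerivAt.fun_sum fun i _ => ((hχ i).differentiable (by simp) y).hasFDerivAt
      have h2 : (fun z => ∑ i, χ i z) =ᶠ[𝓝 y] fun _ => 1 := by
        filter_upwards [hU.mem_nhds hy] with z hz
        exact hone z (subset_closure hz)
      have h3 := h1.unique ((hasFDerivAt_const (1 : ℝ) y).congr_of_eventuallyEq h2)
      rw [← _root_.sum_apply, h3]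
      simp
    calc ∫ y in U, ⟪G y, v⟫
        = ∫ y in U, ∑ i, (⟪G y, v⟫ * χ i y + u y * fderiv ℝ (χ i) y v) := by
          refine setIntegral_congr_fun hU.measurableSet fun y hy => ?_
          rw [Finset.sum_add_distrib, ← Finset.mul_sum, ← Finset.mul_sum,
            hone y (subset_closure hy), hder y hy]
          ring
      _ = ∑ i, ∫ x, a i x * ⟪n x, v⟫ ∂boundaryMeasure U := by
          rw [integral_finsetSum _ fun i _ => integrableOn_productDeriv hu hG (hχ i) (hc i) v]
          exact Finset.sum_congr rfl fun i _ => he i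
      _ = ∫ x, ∑ i, a i x * ⟪n x, v⟫ ∂boundaryMeasure U :=
          (integral_finsetSum _ fun i _ => hn.integrable_mul_inner hU (ha i) v).symm
      _ = _ := by
          refine integral_congr_ae ?_
          filter_upwards [heq] with x hx
          rw [hx, Finset.sum_mul]

/-! ### Auxiliary facts on products, weights and closures -/

theorem tendsto_volume_ball_inter (U : Set Plane) (x : Plane) :
    Tendsto (fun r : ℝ => volume.restrict U (Metric.ball x r)) (𝓝[>] 0) (𝓝 0) := by
  have h1 : Tendsto (fun r : ℝ => ENNReal.ofReal (r ^ 2) * volume (Metric.ball (0 : Plane) 1))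
      (𝓝[>] 0) (𝓝 0) := by
    have h2 : Tendsto (fun r : ℝ => ENNReal.ofReal (r ^ 2)) (𝓝[>] 0) (𝓝 0) := by
      have : Continuous fun r : ℝ => ENNReal.ofReal (r ^ 2) :=
        ENNReal.continuous_ofReal.comp (by fun_prop)
      simpa using (this.tendsto 0).mono_left nhdsWithin_le_nhds
    have h3 := ENNReal.Tendsto.mul_const (b := volume (Metric.ball (0 : Plane) 1)) h2
      (Or.inr measure_ball_lt_top.ne)
    rwa [zero_mul] at h3
  refine tendsto_of_tendsto_of_tendsto_of_le_of_le' tendsto_const_nhds h1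
    (Eventually.of_forall fun _ => zero_le) ?_
  filter_upwards [self_mem_nhdsWithin] with r (hr : 0 < r)
  refine (Measure.restrict_apply_le _ _).trans (le_of_eq ?_)
  rw [Measure.addHaar_ball volume x hr.le, finrank_euclideanSpace_fin]

/-- The product of a square integrable function and a function that vanishes to first order at a
boundary point has the trace zero there. -/
theorem hasTraceAt_zero_of_memLp_two {U : Set Plane} (hU : IsOpen U) {u F : Plane → ℝ}
    (hu : MemLp u 2 (volume.restrict U)) {x : Plane} {k : ℝ} (hk : 0 < k)
    (hvol : ∀ᶠ r in 𝓝[>] (0 : ℝ), k * r ^ 2 ≤ volume.real (Metric.ball x r ∩ U))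
    (hF : F =O[𝓝[U] x] fun y => y - x) : HasTraceAt U (fun y => u y * F y) x 0 := by
  obtain ⟨C, hC, hFC⟩ := hF.exists_pos
  have hsq : Integrable (fun y => u y ^ 2) (volume.restrict U) := hu.integrable_sq
  have hlim := hsq.tendsto_setIntegral_nhds_zero (tendsto_volume_ball_inter U x)
  rw [HasTraceAt, Metric.tendsto_nhds]
  intro ε hε
  -- Young's inequality bounds C r|u| by Cη/2 + C r²u²/(2η). The first term is ε/4. In the second,
  -- r² cancels against the area k r² of the averaging set, leaving the integral of u² over a
  -- shrinking set; this is where dimension two matters.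
  set η : ℝ := ε / (2 * C) with hη
  have hη0 : 0 < η := by positivity
  have hlim' := hlim.const_mul (C / (2 * η * k))
  rw [mul_zero] at hlim'
  filter_upwards [hvol, eventually_ball_of_nhdsWithin hFC.bound,
    hlim'.eventually (gt_mem_nhds (half_pos hε)), self_mem_nhdsWithin] with r h1 h2 h3 (hr : 0 < r)
  rw [Real.dist_eq, sub_zero, abs_of_nonneg (setAverage_abs_nonneg _ _), setAverage_eq, smul_eq_mul]
  rw [Measure.restrict_restrict measurableSet_ball] at h3
  set S := Metric.ball x r ∩ U with hS
  have hkr : 0 < k * r ^ 2 := by positivity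
  have hSv : 0 < volume.real S := hkr.trans_le h1
  have hsqS : IntegrableOn (fun y => u y ^ 2) S := IntegrableOn.mono_set hsq inter_subset_right
  have hcS : IntegrableOn (fun _ : Plane => C * η / 2) S :=
    integrableOn_const (volume_ball_inter_ne_top U x r)
  have h4 : ∫ y in S, |u y * F y - 0| ≤
      ∫ y in S, (C * η / 2 + C * r ^ 2 / (2 * η) * u y ^ 2) := by
    refine integral_mono_of_nonneg (Eventually.of_forall fun _ => abs_nonneg _)
      (hcS.add (hsqS.const_mul _)) ?_
    refine ae_restrict_of_forall_mem (measurableSet_ball.inter hU.measurableSet) fun y hy => ?_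
    have h5 : |F y| ≤ C * r := by
      have h6 := h2 y hy
      have h7 : ‖y - x‖ < r := mem_ball_iff_norm.1 hy.1
      rw [Real.norm_eq_abs] at h6
      exact h6.trans (mul_le_mul_of_nonneg_left h7.le hC.le)
    have h8 : r * |u y| ≤ η / 2 + r ^ 2 / (2 * η) * u y ^ 2 := by
      have h9 : η / 2 + r ^ 2 / (2 * η) * u y ^ 2 - r * |u y| = (η - r * |u y|) ^ 2 / (2 * η) := by
        rw [← sq_abs (u y)]
        field_simp
        ring
      have h10 : 0 ≤ (η - r * |u y|) ^ 2 / (2 * η) := by positivity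
      linarith
    simp only [sub_zero, abs_mul]
    calc |u y| * |F y| ≤ |u y| * (C * r) := mul_le_mul_of_nonneg_left h5 (abs_nonneg _)
      _ = C * (r * |u y|) := by ring
      _ ≤ C * (η / 2 + r ^ 2 / (2 * η) * u y ^ 2) := mul_le_mul_of_nonneg_left h8 hC.le
      _ = _ := by ring
  rw [integral_add hcS (hsqS.const_mul _), integral_const_mul, setIntegral_const, smul_eq_mul] at h4
  have h0 : 0 ≤ ∫ y in S, u y ^ 2 := integral_nonneg fun _ => sq_nonneg _
  calc (volume.real S)⁻¹ * ∫ y in S, |u y * F y - 0|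
      ≤ (volume.real S)⁻¹ * (volume.real S * (C * η / 2) +
          C * r ^ 2 / (2 * η) * ∫ y in S, u y ^ 2) := mul_le_mul_of_nonneg_left h4 (by positivity)
    _ = C * η / 2 + (volume.real S)⁻¹ * (C * r ^ 2 / (2 * η) * ∫ y in S, u y ^ 2) := by
        field_simp
    _ ≤ C * η / 2 + (k * r ^ 2)⁻¹ * (C * r ^ 2 / (2 * η) * ∫ y in S, u y ^ 2) := by
        gcongr
    _ = ε / 4 + C / (2 * η * k) * ∫ y in S, u y ^ 2 := by
        have h5 : C * η / 2 = ε / 4 := by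
          rw [hη]
          field_simp
          norm_num
        rw [h5]
        field_simp
    _ < ε := by linarith

/-- The product rule for a weakly differentiable and a smooth function. -/
theorem HasWeakGradientOn.mul_contDiffOn {U : Set Plane} (hU : IsOpen U) {u F : Plane → ℝ}
    {G : Plane → Plane} (h : HasWeakGradientOn U u G) (hF : ContDiffOn ℝ ∞ F U) :
    HasWeakGradientOn U (fun y => u y * F y) (fun y => F y • G y + u y • gradient F y) := by
  have hFat : ∀ y ∈ U, ContDiffAt ℝ ∞ F y := fun y hy => hF.contDiffAt (hU.mem_nhds hy)
  have hgc : ContinuousOn (gradient F) U :=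
    (InnerProductSpace.toDual ℝ Plane).symm.continuous.comp_continuousOn
      (hF.continuousOn_fderiv_of_isOpen hU (by simp))
  refine ⟨h.1.mul_continuousOn hF.continuousOn hU.isLocallyClosed,
    (LocallyIntegrableOn.continuousOn_smul hU.isLocallyClosed h.2 hF.continuousOn).add
      (LocallyIntegrableOn.smul_continuousOn hU.isLocallyClosed h.1 hgc), ?_⟩
  intro ψ hψ hc hψU v
  -- Although F is smooth only on U, its product with ψ is a test function, because ψ vanishes near
  -- every point outside its support.
  have hs : ContDiff ℝ ∞ fun y => F y * ψ y := by
    rw [contDiff_iff_contDiffAt]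
    intro y
    by_cases hy : y ∈ tsupport ψ
    · exact (hFat y (hψU hy)).mul hψ.contDiffAt
    · refine (contDiffAt_const (c := (0 : ℝ))).congr_of_eventuallyEq ?_
      filter_upwards [(isClosed_tsupport ψ).isOpen_compl.mem_nhds hy] with z hz
      rw [image_eq_zero_of_notMem_tsupport hz, mul_zero]
  have hcs : HasCompactSupport fun y => F y * ψ y := hc.mul_left
  have hsub : tsupport (fun y => F y * ψ y) ⊆ U := (tsupport_mul_subset_right).trans hψU
  have hder : ∀ y ∈ U, fderiv ℝ (fun y => F y * ψ y) y v =
      F y * fderiv ℝ ψ y v + ψ y * fderiv ℝ F y v := by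
    intro y hy
    rw [fderiv_fun_mul ((hFat y hy).differentiableAt (by simp)) (hψ.differentiable (by simp) y)]
    simp
  have hw := h.3 _ hs hcs hsub v
  have hloc : LocallyIntegrableOn (fun y => u y * fderiv ℝ F y v) U :=
    h.1.mul_continuousOn ((hF.continuousOn_fderiv_of_isOpen hU (by simp)).clm_apply
      continuousOn_const) hU.isLocallyClosed
  have i1 : IntegrableOn (fun y => u y * F y * fderiv ℝ ψ y v) U :=
    integrableOn_mul_fderiv (h.1.mul_continuousOn hF.continuousOn hU.isLocallyClosed) hψ hc hψU v
  have i2 : IntegrableOn (fun y => u y * fderiv ℝ F y v * ψ y) U :=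
    integrableOn_mul_test hloc hψ.continuous hc hψU fun y hy => image_eq_zero_of_notMem_tsupport hy
  have i3 : IntegrableOn (fun y => ⟪G y, v⟫ * (F y * ψ y)) U :=
    integrableOn_inner_mul h.2 hs hcs hsub v
  have e1 : ∫ y in U, u y * fderiv ℝ (fun y => F y * ψ y) y v =
      (∫ y in U, u y * F y * fderiv ℝ ψ y v) + ∫ y in U, u y * fderiv ℝ F y v * ψ y := by
    rw [← integral_add i1 i2]
    refine setIntegral_congr_fun hU.measurableSet fun y hy => ?_
    rw [hder y hy]
    ring
  have e2 : ∫ y in U, ⟪F y • G y + u y • gradient F y, v⟫ * ψ y =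
      (∫ y in U, ⟪G y, v⟫ * (F y * ψ y)) + ∫ y in U, u y * fderiv ℝ F y v * ψ y := by
    rw [← integral_add i3 i2]
    refine integral_congr_ae (Eventually.of_forall fun y => ?_)
    beta_reduce
    rw [inner_add_left, real_inner_smul_left, real_inner_smul_left, inner_gradient_left]
    ring
  rw [e2]
  linarith

/-- The closure of a set with smooth sides is a set of unique differentiability. -/
theorem uniqueDiffOn_closure {U : Set Plane} (hU : IsOpen U) {n : Plane → Plane}
    (hn : IsNormalField U n) : UniqueDiffOn ℝ (closure U) := by
  intro x hx
  by_cases hxU : x ∈ U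
  · exact uniqueDiffWithinAt_of_mem_nhds (mem_of_superset (hU.mem_nhds hxU) subset_closure)
  have hxf : x ∈ frontier U := by
    rw [hU.frontier_eq]
    exact ⟨hx, hxU⟩
  obtain ⟨ρ, h, -⟩ := hn x hxf
  -- The tangent cone contains an open half-plane, and that already spans.
  have hcone : {v : Plane | ⟪gradient ρ x, v⟫ < 0} ⊆ tangentConeAt ℝ (closure U) x := by
    intro v hv
    refine mem_tangentConeAt_of_add_smul_mem (l := 𝓝[>] (0 : ℝ)) (c := id) ?_ ?_
    · exact tendsto_id.mono_left (nhdsWithin_mono _ fun t (ht : 0 < t) => ht.ne')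
    · filter_upwards [h.eventually_smul_mem (h.apply_eq_zero hU hxf) hv] with t ht
      exact subset_closure ht
  have hopen : IsOpen {v : Plane | ⟪gradient ρ x, v⟫ < 0} :=
    isOpen_lt (by fun_prop) continuous_const
  refine ⟨?_, by rwa [closure_closure]⟩
  have htop : Submodule.span ℝ (tangentConeAt ℝ (closure U) x) = ⊤ := by
    refine Submodule.eq_top_of_nonempty_interior' _ ⟨-gradient ρ x, ?_⟩
    refine interior_maximal (hcone.trans Submodule.subset_span) hopen ?_
    simp only [mem_ofPred_eq, inner_neg_right, Left.neg_neg_iff]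
    exact real_inner_self_pos.2 h.gradient_ne_zero
  rw [htop]
  exact dense_univ

theorem eLpNorm_two_withDensity {α E : Type*} [MeasurableSpace α] [NormedAddCommGroup E]
    [NormedSpace ℝ E] {μ : Measure α} {a : α → ℝ} (ha : AEMeasurable a μ) {q : α → E}
    (hq : AEStronglyMeasurable q μ) :
    eLpNorm q 2 (μ.withDensity fun x => ENNReal.ofReal (a x)) =
      eLpNorm (fun x => √(a x) • q x) 2 μ := by
  rw [eLpNorm_eq_lintegral_rpow_enorm_toReal two_ne_zero ENNReal.ofNat_ne_top,
    eLpNorm_eq_lintegral_rpow_enorm_toReal two_ne_zero ENNReal.ofNat_ne_top,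
    lintegral_withDensity_eq_lintegral_mul₀ ha.ennreal_ofReal (hq.enorm.pow_const _)]
  congr 1
  refine lintegral_congr fun x => ?_
  rw [Pi.mul_apply, enorm_smul, ENNReal.mul_rpow_of_nonneg _ _ (by simp)]
  congr 1
  rw [Real.enorm_of_nonneg (Real.sqrt_nonneg _), ENNReal.ofReal_rpow_of_nonneg (Real.sqrt_nonneg _)
    (by simp), ENNReal.toReal_ofNat, Real.rpow_two]
  -- No sign of a is assumed: where a is negative, both `ENNReal.ofReal` and the square root give 0.
  rcases le_total 0 (a x) with h | h
  · rw [Real.sq_sqrt h]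
  · rw [Real.sqrt_eq_zero_of_nonpos h, ENNReal.ofReal_of_nonpos h]
    simp

/-! ### The boundary of `Ω ∖ Ω_K` -/

/-- A limit point of Ω_K outside Ω would lie on both boundaries. So Ω_K is closed in the plane, and
Ω ∖ Ω_K is open. -/
theorem isClosed_of_disjoint_frontier {Ω ΩK : Set Plane} (hΩ : IsOpen Ω) (hsub : ΩK ⊆ Ω)
    (hK : ∃ C : Set Plane, IsClosed C ∧ ΩK = C ∩ Ω) (hd : Disjoint (frontier Ω) (frontier ΩK)) :
    IsClosed ΩK := by
  obtain ⟨C, hC, hCe⟩ := hK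
  refine isClosed_of_closure_subset fun x hx => ?_
  have hxC : x ∈ C := closure_minimal (hCe ▸ inter_subset_left) hC hx
  by_cases hxΩ : x ∈ Ω
  · rw [hCe]
    exact ⟨hxC, hxΩ⟩
  · have h1 : x ∈ frontier Ω := by
      rw [hΩ.frontier_eq]
      exact ⟨closure_mono hsub hx, hxΩ⟩
    exact absurd (⟨hx, fun hi => hxΩ (hsub (interior_subset hi))⟩ : x ∈ frontier ΩK)
      (disjoint_left.1 hd h1)

theorem frontier_sdiff_of_isClosed {Ω ΩK : Set Plane} (hΩ : IsOpen Ω) (hK : IsClosed ΩK)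
    (hsub : ΩK ⊆ Ω) : frontier (Ω \ ΩK) = frontier Ω ∪ frontier ΩK := by
  have hU : IsOpen (Ω \ ΩK) := hΩ.sdiff hK
  rw [hU.frontier_eq, hΩ.frontier_eq]
  ext x
  constructor
  · rintro ⟨hx, hxU⟩
    by_cases hxΩ : x ∈ Ω
    · have hxK : x ∈ ΩK := by
        by_contra h
        exact hxU ⟨hxΩ, h⟩
      refine Or.inr ⟨subset_closure hxK, ?_⟩
      rw [← Set.mem_compl_iff, ← closure_compl]
      exact closure_mono (fun y hy => hy.2) hx
    · exact Or.inl ⟨closure_mono sdiff_subset hx, hxΩ⟩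
  · rintro (⟨hx, hxΩ⟩ | hx)
    · refine ⟨?_, fun h => hxΩ h.1⟩
      rw [mem_closure_iff_frequently] at hx ⊢
      have : ∀ᶠ y in 𝓝 x, y ∉ ΩK := hK.isOpen_compl.mem_nhds fun h => hxΩ (hsub h)
      exact (hx.and_eventually this).mono fun y hy => hy
    · have hxK : x ∈ ΩK := hK.frontier_subset hx
      refine ⟨?_, fun h => h.2 hxK⟩
      have hx' : x ∈ closure ΩKᶜ := by
        rw [closure_compl]
        exact hx.2
      rw [mem_closure_iff_frequently] at hx' ⊢
      exact (hx'.and_eventually (hΩ.mem_nhds (hsub hxK))).mono fun y hy => ⟨hy.2, hy.1⟩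

theorem IsDefiningAt.isSideAt_sdiff {Ω ΩK : Set Plane} (hΩ : IsOpen Ω) (hK : IsClosed ΩK)
    (hsub : ΩK ⊆ Ω) {x : Plane} (hx : x ∈ frontier Ω) {ρ : Plane → ℝ} (h : IsDefiningAt Ω x ρ) :
    IsSideAt (Ω \ ΩK) x ρ := by
  refine ⟨h.smooth, h.gradient_ne_zero, ?_⟩
  rw [hΩ.frontier_eq] at hx
  have : ∀ᶠ y in 𝓝 x, y ∉ ΩK := hK.isOpen_compl.mem_nhds fun h => hx.2 (hsub h)
  filter_upwards [this, h.interior_iff] with y h1 h2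
  rw [hΩ.interior_eq] at h2
  rw [← h2]
  exact ⟨fun h => h.1, fun h => ⟨h, h1⟩⟩

/-- Near ∂Ω_K the set Ω ∖ Ω_K is the complement of the closed set Ω_K, so the sign of ρ flips and
the condition on the closure is the relevant one. -/
theorem IsDefiningAt.isSideAt_sdiff_neg {Ω ΩK : Set Plane} (hΩ : IsOpen Ω) (hK : IsClosed ΩK)
    (hsub : ΩK ⊆ Ω) {x : Plane} (hx : x ∈ frontier ΩK) {ρ : Plane → ℝ} (h : IsDefiningAt ΩK x ρ) :
    IsSideAt (Ω \ ΩK) x (fun y => -ρ y) := by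
  refine ⟨h.smooth.neg, ?_, ?_⟩
  · have : gradient (fun y => -ρ y) x = -gradient ρ x := by simp [gradient]
    rw [this]
    exact neg_ne_zero.2 h.gradient_ne_zero
  · filter_upwards [hΩ.mem_nhds (hsub (hK.frontier_subset hx)), h.closure_iff] with y h1 h2
    rw [hK.closure_eq] at h2
    rw [neg_lt_zero, ← not_le, ← h2]
    exact ⟨fun h => h.2, fun h => ⟨h1, h⟩⟩

theorem exists_isNormalField {U : Set Plane} (h : ∀ x ∈ frontier U, ∃ ρ, IsSideAt U x ρ) :
    ∃ n, IsNormalField U n := by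
  classical
  choose! ρ hρ using h
  exact ⟨fun x => (‖gradient (ρ x) x‖)⁻¹ • gradient (ρ x) x, fun x hx => ⟨ρ x, hρ x hx, rfl⟩⟩

theorem exists_isNormalField_sdiff {Ω ΩK : Set Plane} (hΩ : IsOpen Ω) (hK : IsClosed ΩK)
    (hsub : ΩK ⊆ Ω) (hΩs : HasSmoothBoundary Ω) (hKs : HasSmoothBoundary ΩK) :
    ∃ n, IsNormalField (Ω \ ΩK) n := by
  refine exists_isNormalField fun x hx => ?_
  rw [frontier_sdiff_of_isClosed hΩ hK hsub] at hx
  rcases hx with hx | hx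
  · obtain ⟨ρ, h⟩ := hΩs x hx
    exact ⟨ρ, h.isSideAt_sdiff hΩ hK hsub hx⟩
  · obtain ⟨ρ, h⟩ := hKs x hx
    exact ⟨_, h.isSideAt_sdiff_neg hΩ hK hsub hx⟩

/-- The normal does not depend on the defining function, so the one chosen for Ω is the one of Ω ∖
Ω_K, whose sides near ∂Ω are the same. -/
theorem outerNormal_eq {Ω ΩK : Set Plane} (hΩ : IsOpen Ω) (hK : IsClosed ΩK) (hsub : ΩK ⊆ Ω)
    (hΩs : HasSmoothBoundary Ω) {n : Plane → Plane} (hn : IsNormalField (Ω \ ΩK) n) {x : Plane}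
    (hx : x ∈ frontier Ω) : outerNormal Ω x = n x := by
  have hex : ∃ ν, IsOuterNormalAt Ω x ν := by
    obtain ⟨ρ, h⟩ := hΩs x hx
    exact ⟨_, ρ, h, rfl⟩
  rw [outerNormal, dif_pos hex]
  obtain ⟨ρ, h, he⟩ := hex.choose_spec
  rw [he, hn.eq (hΩ.sdiff hK) (by
    rw [frontier_sdiff_of_isClosed hΩ hK hsub]
    exact Or.inl hx) (h.isSideAt_sdiff hΩ hK hsub hx)]

/-! ### Functions that are smooth up to the boundary -/

/-- The `i`-th partial derivative, within `S`. -/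
noncomputable def partialWithin (f : Plane → ℝ) (S : Set Plane) (i : Fin 2) (y : Plane) : ℝ :=
  fderivWithin ℝ f S y (EuclideanSpace.single i 1)

theorem sum_smul_single (v : Plane) :
    ∑ i, v i • (EuclideanSpace.single i 1 : Plane) = v := by
  ext j
  fin_cases j <;> simp

theorem fderivWithin_eq_sum (f : Plane → ℝ) (S : Set Plane) (x v : Plane) :
    fderivWithin ℝ f S x v =
      ∑ i, partialWithin f S i x * ⟪v, EuclideanSpace.single i 1⟫ := by
  conv_lhs => rw [← sum_smul_single v]
  rw [map_sum]
  refine Finset.sum_congr rfl fun i _ => ?_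
  rw [map_smul, smul_eq_mul, partialWithin, mul_comm, EuclideanSpace.inner_single_right]
  simp

theorem contDiffOn_partialWithin {f : Plane → ℝ} {S : Set Plane} (hf : ContDiffOn ℝ ∞ f S)
    (hS : UniqueDiffOn ℝ S) (i : Fin 2) : ContDiffOn ℝ ∞ (partialWithin f S i) S :=
  (hf.fderivWithin hS (by simp)).clm_apply contDiffOn_const

theorem partialWithin_eq_inner {f : Plane → ℝ} {S : Set Plane} {y : Plane} (hy : S ∈ 𝓝 y)
    (i : Fin 2) : partialWithin f S i y = ⟪gradient f y, EuclideanSpace.single i 1⟫ := by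
  rw [partialWithin, fderivWithin_of_mem_nhds hy, inner_gradient_left]

theorem sum_partialWithin_mul {f : Plane → ℝ} {S : Set Plane} {y : Plane} (hy : S ∈ 𝓝 y)
    (w : Plane) : ∑ i, partialWithin f S i y * ⟪w, EuclideanSpace.single i 1⟫ =
      ⟪gradient f y, w⟫ := by
  rw [← fderivWithin_eq_sum, fderivWithin_of_mem_nhds hy, inner_gradient_left]

theorem sum_fderiv_partialWithin {f : Plane → ℝ} {Ω : Set Plane} (hΩ : IsOpen Ω)
    (hf : ContDiffOn ℝ ∞ f (closure Ω)) {y : Plane} (hy : y ∈ Ω) :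
    ∑ i, fderiv ℝ (partialWithin f (closure Ω) i) y (EuclideanSpace.single i 1) =
      Laplacian.laplacian f y := by
  rw [InnerProductSpace.laplacian_eq_iteratedFDeriv_orthonormalBasis f
    (EuclideanSpace.basisFun (Fin 2) ℝ)]
  refine Finset.sum_congr rfl fun i _ => ?_
  have hcl : closure Ω ∈ 𝓝 y := mem_of_superset (hΩ.mem_nhds hy) subset_closure
  have h1 : partialWithin f (closure Ω) i =ᶠ[𝓝 y]
      fun z => fderiv ℝ f z (EuclideanSpace.single i 1) := by
    filter_upwards [hΩ.mem_nhds hy] with z hz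
    rw [partialWithin, fderivWithin_of_mem_nhds
      (mem_of_superset (hΩ.mem_nhds hz) subset_closure)]
  have h2 : DifferentiableAt ℝ (fderiv ℝ f) y :=
    ((hf.contDiffAt hcl).fderiv_right (m := ∞) (by simp)).differentiableAt (by simp)
  rw [h1.fderiv_eq, fderiv_clm_apply h2 (differentiableAt_const _), iteratedFDeriv_two_apply]
  simp

theorem norm_gradient {F : Plane → ℝ} {y : Plane} : ‖gradient F y‖ = ‖fderiv ℝ F y‖ := by
  rw [gradient, LinearIsometryEquiv.norm_map]

/-! ### Traces of the products with the partial derivatives -/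

/-- If F i x ≠ 0, dividing the product by F i yields a trace of u. If F i x = 0, the product has
trace 0, so the formula holds even when u has no trace. -/
theorem boundaryTrace_mul {U : Set Plane} (hU : IsOpen U) {x : Plane} (hx : x ∈ closure U)
    {u : Plane → ℝ} (hu : IntegrableOn u U) (hu2 : MemLp u 2 (volume.restrict U)) {k : ℝ}
    (hk : 0 < k)
    (hvol : ∀ᶠ r in 𝓝[>] (0 : ℝ), k * r ^ 2 ≤ volume.real (Metric.ball x r ∩ U))
    {ι : Type*} {F : ι → Plane → ℝ} (hF : ∀ i, Tendsto (F i) (𝓝[U] x) (𝓝 (F i x)))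
    (hFO : ∀ i, F i x = 0 → F i =O[𝓝[U] x] fun y => y - x)
    (hint : ∀ i, IntegrableOn (fun y => u y * F i y) U)
    (htr : ∀ i, ∃ a, HasTraceAt U (fun y => u y * F i y) x a) :
    ((∃ i, F i x ≠ 0) → ∃ a, HasTraceAt U u x a) ∧
      ∀ i, boundaryTrace U (fun y => u y * F i y) x = boundaryTrace U u x * F i x := by
  have hex : (∃ i, F i x ≠ 0) → ∃ a, HasTraceAt U u x a := by
    rintro ⟨i, hi⟩
    obtain ⟨a, ha⟩ := htr i
    refine ⟨a * (F i x)⁻¹, ?_⟩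
    refine (ha.mul_continuousWithinAt hU (hint i) ((hF i).inv₀ hi)).congr_of_eventuallyEq
      hU.measurableSet ?_
    filter_upwards [(hF i).eventually_ne hi] with y hy
    rw [mul_assoc, mul_inv_cancel₀ hy, mul_one]
  refine ⟨hex, fun i => ?_⟩
  by_cases hi : F i x = 0
  · rw [hi, mul_zero]
    exact (hasTraceAt_zero_of_memLp_two hU hu2 hk hvol (hFO i hi)).boundaryTrace_eq hU hx (hint i)
  · obtain ⟨a, ha⟩ := hex ⟨i, hi⟩
    rw [ha.boundaryTrace_eq hU hx hu]
    exact (ha.mul_continuousWithinAt hU hu (hF i)).boundaryTrace_eq hU hx (hint i)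

/-- **Green's formula** on `U = Ω ∖ Ω_K` for a function `f` that is smooth up to the boundary of
`Ω` and a square integrable function `u` with trace zero on `∂Ω_K`, provided that `∇f` compensates
for the lack of integrability of the weak gradient `G` of `u`. -/
theorem green_formula {Ω ΩK : Set Plane} {f u : Plane → ℝ} {G : Plane → Plane}
    (hΩ : IsOpen Ω) (hΩb : Bornology.IsBounded Ω) (hΩs : HasSmoothBoundary Ω) (hsub : ΩK ⊆ Ω)
    (hK : IsClosed ΩK) (hKs : HasSmoothBoundary ΩK) (hd : Disjoint (frontier Ω) (frontier ΩK))
    (hf : ContDiffOn ℝ ∞ f (closure Ω)) (hu2 : MemLp u 2 (volume.restrict (Ω \ ΩK)))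
    (hw : HasWeakGradientOn (Ω \ ΩK) u G)
    (hfG : IntegrableOn (fun y => ‖gradient f y‖ * ‖G y‖) (Ω \ ΩK))
    (h0 : ∀ᵐ x ∂(Measure.hausdorffMeasure 1 : Measure Plane).restrict (frontier ΩK),
      HasTraceAt (Ω \ ΩK) u x 0) :
    (∀ᵐ x ∂neumannMeasure Ω ΩK, normalDerivative Ω f x ≠ 0 → ∃ a, HasTraceAt (Ω \ ΩK) u x a) ∧
    Integrable (fun x => -normalDerivative Ω f x * boundaryTrace (Ω \ ΩK) u x)
      (neumannMeasure Ω ΩK) ∧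
    ∫ x, -normalDerivative Ω f x * boundaryTrace (Ω \ ΩK) u x ∂neumannMeasure Ω ΩK =
      -∫ y in Ω \ ΩK, (⟪gradient f y, G y⟫ + Laplacian.laplacian f y * u y) := by
  set U := Ω \ ΩK with hUdef
  have hU : IsOpen U := hΩ.sdiff hK
  have hUb : Bornology.IsBounded U := hΩb.subset sdiff_subset
  have hfr : frontier U = frontier Ω ∪ frontier ΩK := frontier_sdiff_of_isClosed hΩ hK hsub
  obtain ⟨n, hn⟩ := exists_isNormalField_sdiff hΩ hK hsub hΩs hKs
  -- The case of empty Ω_K, used only to see that the closure of Ω has unique derivatives, so that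
  -- the partial derivatives of f are smooth up to the boundary.
  obtain ⟨n', hn'⟩ := exists_isNormalField_sdiff hΩ isClosed_empty (empty_subset Ω) hΩs
    (by intro x hx; simp at hx)
  rw [sdiff_empty] at hn'
  have hS : UniqueDiffOn ℝ (closure Ω) := uniqueDiffOn_closure hΩ hn'
  have hScomp : IsCompact (closure Ω) := hΩb.isCompact_closure
  have hcl : ∀ y ∈ U, closure Ω ∈ 𝓝 y := fun y hy =>
    mem_of_superset (hΩ.mem_nhds hy.1) subset_closure
  have hUS : U ⊆ closure Ω := sdiff_subset.trans subset_closure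
  set e : Fin 2 → Plane := fun i => EuclideanSpace.single i 1 with he
  set F : Fin 2 → Plane → ℝ := partialWithin f (closure Ω) with hF
  have hFs : ∀ i, ContDiffOn ℝ ∞ (F i) (closure Ω) := fun i => contDiffOn_partialWithin hf hS i
  have hfin : IsFiniteMeasure (volume.restrict U) := by
    refine ⟨?_⟩
    rw [Measure.restrict_apply_univ]
    exact hUb.measure_lt_top
  have hu : IntegrableOn u U := hu2.integrable one_le_two
  have hX : ∀ i, IntegrableOn (fun y => u y * F i y) U := by
    intro i
    obtain ⟨C, hC⟩ := hScomp.exists_bound_of_continuousOn (hFs i).continuousOn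
    exact hu.mul_bdd (c := C) (((hFs i).continuousOn.mono hUS).aestronglyMeasurable
      hU.measurableSet) (ae_restrict_of_forall_mem hU.measurableSet fun y hy => hC y (hUS hy))
  have hXw : ∀ i, HasWeakGradientOn U (fun y => u y * F i y)
      (fun y => F i y • G y + u y • gradient (F i) y) := fun i =>
    hw.mul_contDiffOn hU ((hFs i).mono hUS)
  -- The term with G is dominated by |∇f||G|, integrable by hypothesis; the other has bounded second
  -- derivatives of f.
  have hXG : ∀ i, IntegrableOn (fun y => F i y • G y + u y • gradient (F i) y) U := by
    intro i
    have hgc : ContinuousOn (gradient (F i)) U :=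
      (InnerProductSpace.toDual ℝ Plane).symm.continuous.comp_continuousOn
        (((hFs i).mono hUS).continuousOn_fderiv_of_isOpen hU (by simp))
    refine Integrable.add ?_ ?_
    · refine hfG.mono' ((((hFs i).continuousOn.mono hUS).aestronglyMeasurable
        hU.measurableSet).smul (LocallyIntegrableOn.aestronglyMeasurable hw.2)) ?_
      refine ae_restrict_of_forall_mem hU.measurableSet fun y hy => ?_
      rw [norm_smul]
      refine mul_le_mul_of_nonneg_right ?_ (norm_nonneg _)
      rw [hF, partialWithin_eq_inner (hcl y hy)]
      refine (norm_inner_le_norm _ _).trans (le_of_eq ?_)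
      simp
    · obtain ⟨C, hC⟩ := hScomp.exists_bound_of_continuousOn
        ((hFs i).continuousOn_fderivWithin hS (by simp))
      refine (hu.norm.mul_const C).mono' (hu.aestronglyMeasurable.smul
        (hgc.aestronglyMeasurable hU.measurableSet)) ?_
      refine ae_restrict_of_forall_mem hU.measurableSet fun y hy => ?_
      rw [norm_smul]
      refine mul_le_mul_of_nonneg_left ?_ (norm_nonneg _)
      rw [norm_gradient, ← fderivWithin_of_mem_nhds (hcl y hy)]
      exact hC y (hUS hy)
  choose hgi hgt hge using fun i => (hXw i).green hU hUb hn (hX i) (hXG i) (e i)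
  set B : Fin 2 → Plane → ℝ := fun i => boundaryTrace U fun y => u y * F i y with hB
  have hFt : ∀ x ∈ closure Ω, ∀ i, Tendsto (F i) (𝓝[U] x) (𝓝 (F i x)) := fun x hx i =>
    ((hFs i).continuousOn x hx).mono_left (nhdsWithin_mono x hUS)
  have hFO : ∀ x ∈ closure Ω, ∀ i, F i x = 0 → F i =O[𝓝[U] x] fun y => y - x := by
    intro x hx i hi
    have h1 := ((((hFs i).differentiableOn (by simp)) x hx).hasFDerivWithinAt.mono
      hUS).isBigO_sub
    simpa [hi] using h1
  have hsplit : boundaryMeasure U = neumannMeasure Ω ΩK +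
      (Measure.hausdorffMeasure 1 : Measure Plane).restrict (frontier ΩK) := by
    rw [boundaryMeasure, hfr, neumannMeasure, hd.sdiff_eq_left,
      Measure.restrict_union hd isClosed_frontier.measurableSet]
  have hae := fun {p : Plane → Prop} (h : ∀ᵐ x ∂boundaryMeasure U, p x) => by
    rw [hsplit, ae_add_measure_iff] at h
    exact h
  have hBK : ∀ i, ∀ᵐ x ∂(Measure.hausdorffMeasure 1 : Measure Plane).restrict (frontier ΩK),
      B i x * ⟪n x, e i⟫ = 0 := by
    intro i
    filter_upwards [h0, ae_restrict_mem isClosed_frontier.measurableSet] with x hx hxK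
    have hxU : x ∈ closure U := frontier_subset_closure (hfr ▸ Or.inr hxK)
    have h1 := (hx.mul_continuousWithinAt hU hu (hFt x (closure_mono sdiff_subset hxU)
      i)).boundaryTrace_eq hU hxU (hX i)
    simp only [hB]
    rw [h1, zero_mul, zero_mul]
  have hpt : ∀ᵐ x ∂neumannMeasure Ω ΩK,
      (normalDerivative Ω f x ≠ 0 → ∃ a, HasTraceAt U u x a) ∧
      -normalDerivative Ω f x * boundaryTrace U u x = -∑ i, B i x * ⟪n x, e i⟫ := by
    have hmem : ∀ᵐ x ∂neumannMeasure Ω ΩK, x ∈ frontier Ω :=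
      (ae_restrict_mem (isClosed_frontier.measurableSet.diff
        isClosed_frontier.measurableSet)).mono fun x hx => hx.1
    filter_upwards [hmem, (hae (ae_all_iff.2 hgt)).1] with x hx htr
    have hxfr : x ∈ frontier U := hfr ▸ Or.inl hx
    have hxU : x ∈ closure U := frontier_subset_closure hxfr
    obtain ⟨ρ, hρ, -⟩ := hn x hxfr
    obtain ⟨k, hk, hvol⟩ := hρ.volume_ball_inter_ge (hρ.apply_eq_zero hU hxfr)
    have hxΩ : x ∈ closure Ω := frontier_subset_closure hx
    obtain ⟨h1, h2⟩ := boundaryTrace_mul hU hxU hu hu2 hk hvol (hFt x hxΩ) (hFO x hxΩ) hX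
      fun i => ⟨_, htr i⟩
    have hD : normalDerivative Ω f x = ∑ i, F i x * ⟪n x, e i⟫ := by
      rw [normalDerivative, outerNormal_eq hΩ hK hsub hΩs hn hx, fderivWithin_eq_sum]
    refine ⟨fun hne => h1 ?_, ?_⟩
    -- A nonzero normal derivative requires a nonzero partial derivative, and then u has a trace.
    · by_contra! hz
      refine hne ?_
      rw [hD]
      exact Finset.sum_eq_zero fun i _ => by rw [hz i, zero_mul]
    · rw [hD, neg_mul, Finset.sum_mul]
      congr 1
      refine Finset.sum_congr rfl fun i _ => ?_
      simp only [hB]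
      rw [h2 i]
      ring
  have hBi : ∀ i, Integrable (fun x => B i x * ⟪n x, e i⟫) (boundaryMeasure U) := fun i =>
    hn.integrable_mul_inner hU (hgi i) (e i)
  have hBN : ∀ i, Integrable (fun x => B i x * ⟪n x, e i⟫) (neumannMeasure Ω ΩK) := fun i =>
    (hsplit ▸ hBi i : Integrable _ (_ + _)).left_of_add_measure
  have hBe : ∀ i, ∫ x, B i x * ⟪n x, e i⟫ ∂neumannMeasure Ω ΩK =
      ∫ y in U, ⟪F i y • G y + u y • gradient (F i) y, e i⟫ := by
    intro i
    have h1 := hBi i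
    rw [hsplit] at h1
    rw [hge i, hsplit, integral_add_measure h1.left_of_add_measure h1.right_of_add_measure,
      integral_eq_zero_of_ae (hBK i), add_zero]
  have hpt2 := hpt.mono fun x hx => hx.2
  refine ⟨hpt.mono fun x hx => hx.1, ?_, ?_⟩
  · exact (integrable_finsetSum _ fun i _ => hBN i).neg.congr (hpt2.mono fun x hx => hx.symm)
  · rw [integral_congr_ae hpt2, integral_neg, integral_finsetSum _ fun i _ => hBN i]
    congr 1
    simp only [hBe]
    rw [← integral_finsetSum _ fun i _ => (hXG i).inner_const (e i)]
    refine setIntegral_congr_fun hU.measurableSet fun y hy => ?_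
    beta_reduce
    -- Summing the i-th components of the product gradients gives ⟪∇f, G⟫ and u times the Laplacian.
    rw [← sum_partialWithin_mul (hcl y hy), ← sum_fderiv_partialWithin hΩ hf hy.1, Finset.sum_mul,
      ← Finset.sum_add_distrib]
    refine Finset.sum_congr rfl fun i _ => ?_
    rw [inner_add_left, real_inner_smul_left, real_inner_smul_left, inner_gradient_left]
    ring

/-! ### Duality between L² with a weight and L² without it -/

section WeightedPairing

variable {α E : Type*} [MeasurableSpace α] [NormedAddCommGroup E] [InnerProductSpace ℝ E]
  {μ : Measure α} {a : α → ℝ}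

theorem inv_smul_ae_eq_sqrt_inv_smul (hpos : ∀ᵐ x ∂μ, 0 < a x) (v : α → E) :
    (fun x => (√(a x))⁻¹ • (√(a x))⁻¹ • v x) =ᵐ[μ] fun x => (a x)⁻¹ • v x := by
  filter_upwards [hpos] with x hx
  rw [smul_smul, ← mul_inv, Real.mul_self_sqrt hx.le]

theorem eLpNorm_two_inv_smul_withDensity (ha : AEMeasurable a μ) (hpos : ∀ᵐ x ∂μ, 0 < a x)
    {v : α → E} (hv : AEStronglyMeasurable (fun x => (√(a x))⁻¹ • v x) μ) :
    eLpNorm (fun x => (a x)⁻¹ • v x) 2 (μ.withDensity fun x => ENNReal.ofReal (a x)) =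
      eLpNorm (fun x => (√(a x))⁻¹ • v x) 2 μ := by
  have hq : AEStronglyMeasurable (fun x => (a x)⁻¹ • v x) μ :=
    (ha.sqrt.inv.aestronglyMeasurable.smul hv).congr (inv_smul_ae_eq_sqrt_inv_smul hpos v)
  rw [eLpNorm_two_withDensity ha hq]
  refine eLpNorm_congr_ae ?_
  filter_upwards [hpos] with x hx
  rw [smul_smul]
  congr 1
  have := (Real.sqrt_pos.2 hx).ne'
  nth_rw 2 [← Real.mul_self_sqrt hx.le]
  field_simp

theorem MemLp.inv_smul_withDensity (ha : AEMeasurable a μ) (hpos : ∀ᵐ x ∂μ, 0 < a x)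
    {v : α → E} (hv : MemLp (fun x => (√(a x))⁻¹ • v x) 2 μ) :
    MemLp (fun x => (a x)⁻¹ • v x) 2 (μ.withDensity fun x => ENNReal.ofReal (a x)) := by
  refine ⟨((ha.sqrt.inv.aestronglyMeasurable.smul hv.1).congr
    (inv_smul_ae_eq_sqrt_inv_smul hpos v)).mono_ac (withDensity_absolutelyContinuous _ _), ?_⟩
  rw [eLpNorm_two_inv_smul_withDensity ha hpos hv.1]
  exact hv.2

/-- A weight that is positive almost everywhere has no new null sets. -/
theorem ae_of_ae_withDensity_ofReal (ha : AEMeasurable a μ) (hpos : ∀ᵐ x ∂μ, 0 < a x)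
    {p : α → Prop} (h : ∀ᵐ x ∂μ.withDensity fun x => ENNReal.ofReal (a x), p x) :
    ∀ᵐ x ∂μ, p x := by
  rw [ae_withDensity_iff' ha.ennreal_ofReal] at h
  filter_upwards [h, hpos] with x hx h0
  exact hx (by simpa using h0)

/-- Cauchy-Schwarz in the weighted space for v/a and w; the density a cancels the factor 1/a. -/
theorem integrable_norm_mul_norm_of_withDensity (ha : AEMeasurable a μ)
    (hpos : ∀ᵐ x ∂μ, 0 < a x) {v w : α → E} (hv : MemLp (fun x => (√(a x))⁻¹ • v x) 2 μ)
    (hw : MemLp w 2 (μ.withDensity fun x => ENNReal.ofReal (a x))) :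
    Integrable (fun x => ‖v x‖ * ‖w x‖) μ := by
  have h := (MemLp.inv_smul_withDensity ha hpos hv).norm.integrable_mul hw.norm
  rw [integrable_withDensity_iff_integrable_smul₀' ha.ennreal_ofReal
    (Eventually.of_forall fun _ => ENNReal.ofReal_lt_top)] at h
  refine h.congr ?_
  filter_upwards [hpos] with x hx
  rw [ENNReal.toReal_ofReal hx.le, Pi.mul_apply, norm_smul, Real.norm_of_nonneg (by positivity),
    smul_eq_mul]
  field_simp

theorem integral_inner_withDensity (ha : AEMeasurable a μ) (hpos : ∀ᵐ x ∂μ, 0 < a x)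
    (v w : α → E) :
    ∫ x, ⟪(a x)⁻¹ • v x, w x⟫ ∂μ.withDensity (fun x => ENNReal.ofReal (a x)) =
      ∫ x, ⟪v x, w x⟫ ∂μ := by
  rw [integral_withDensity_eq_integral_toReal_smul₀ ha.ennreal_ofReal
    (Eventually.of_forall fun _ => ENNReal.ofReal_lt_top)]
  refine integral_congr_ae ?_
  filter_upwards [hpos] with x hx
  rw [ENNReal.toReal_ofReal hx.le, real_inner_smul_left, smul_eq_mul, mul_inv_cancel_left₀ hx.ne']

end WeightedPairing

/-- The functional `(u, p) ↦ ⟪g, u⟫ - ⟪l, u⟫ - ⟪q, p⟫` on a Hilbert product. -/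
theorem exists_clm_prod {H K : Type*} [NormedAddCommGroup H] [InnerProductSpace ℝ H]
    [NormedAddCommGroup K] [InnerProductSpace ℝ K] (V : Submodule ℝ (WithLp 2 (H × K)))
    (g l : H) (q : K) :
    ∃ F : V →L[ℝ] ℝ, (∀ φ : V, F φ = ⟪g, (φ : WithLp 2 (H × K)).fst⟫ -
        ⟪l, (φ : WithLp 2 (H × K)).fst⟫ - ⟪q, (φ : WithLp 2 (H × K)).snd⟫) ∧
      ‖F‖ ≤ ‖g‖ + ‖l‖ + ‖q‖ := by
  let T : WithLp 2 (H × K) →L[ℝ] ℝ := (innerSL ℝ g) ∘L WithLp.fstL 2 ℝ H K -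
    (innerSL ℝ l) ∘L WithLp.fstL 2 ℝ H K - (innerSL ℝ q) ∘L WithLp.sndL 2 ℝ H K
  have hT : ∀ φ : V, (T ∘L V.subtypeL) φ = ⟪g, (φ : WithLp 2 (H × K)).fst⟫ -
      ⟪l, (φ : WithLp 2 (H × K)).fst⟫ - ⟪q, (φ : WithLp 2 (H × K)).snd⟫ := fun φ => rfl
  refine ⟨T ∘L V.subtypeL, hT, ContinuousLinearMap.opNorm_le_bound _ (by positivity) fun φ => ?_⟩
  have h1 := WithLp.norm_fst_le H (φ : WithLp 2 (H × K))
  have h2 := WithLp.norm_snd_le H (φ : WithLp 2 (H × K))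
  rw [hT]
  calc _ ≤ ‖g‖ * ‖(φ : WithLp 2 (H × K)).fst‖ + ‖l‖ * ‖(φ : WithLp 2 (H × K)).fst‖ +
        ‖q‖ * ‖(φ : WithLp 2 (H × K)).snd‖ :=
        (norm_sub_le _ _).trans (add_le_add ((norm_sub_le _ _).trans
          (add_le_add (norm_inner_le_norm _ _) (norm_inner_le_norm _ _)))
          (norm_inner_le_norm _ _))
    _ ≤ ‖g‖ * ‖φ‖ + ‖l‖ * ‖φ‖ + ‖q‖ * ‖φ‖ := by
        gcongr <;> assumption
    _ = _ := by ring

theorem L2_inner_toLp_eq {α E : Type*} [MeasurableSpace α] [NormedAddCommGroup E]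
    [InnerProductSpace ℝ E] {μ : Measure α} {g : α → E} (hg : MemLp g 2 μ) (u : Lp E 2 μ) :
    ⟪hg.toLp g, u⟫ = ∫ x, ⟪g x, u x⟫ ∂μ := by
  rw [L2.inner_def]
  refine integral_congr_ae ?_
  filter_upwards [hg.coeFn_toLp] with x hx
  rw [hx]

/-! ### The functional on `V` -/

theorem mainTheorem2
    (Ω ΩK : Set Plane) (c f g : Plane → ℝ) (Dc : Plane → Plane) (κ : ℝ)
    (hΩ_open : IsOpen Ω) (hΩ_conn : IsConnected Ω) (hΩ_bdd : Bornology.IsBounded Ω)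
    (hΩ_smooth : HasSmoothBoundary Ω)
    (hK_sub : ΩK ⊂ Ω) (hK_closed : ∃ C : Set Plane, IsClosed C ∧ ΩK = C ∩ Ω)
    (hK_pos : 0 < volume ΩK) (hK_smooth : HasSmoothBoundary ΩK)
    (h_disj : Disjoint (frontier Ω) (frontier ΩK))
    (hf : ContDiffOn ℝ ∞ f (closure Ω))
    (hc_range : ∀ x ∈ Ω, c x ∈ Set.Icc (0 : ℝ) 1)
    (hc_one : ∀ x ∈ ΩK, c x = 1)
    (hc_lt : ∀ᵐ x ∂volume.restrict (Ω \ ΩK), c x < 1)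
    (hc_weak : HasWeakGradientOn (Ω \ ΩK) c Dc)
    (hκ : 0 < κ)
    (hc_growth : ∀ᵐ x ∂volume.restrict (Ω \ ΩK), ∀ i : Fin 2,
      |Dc x i| ≤ κ * Real.sqrt (c x * (1 - c x)))
    (hg : MemLp g 2 (volume.restrict (Ω \ ΩK)))
    (hΔf : MemLp (Laplacian.laplacian f) 2 (volume.restrict (Ω \ ΩK)))
    (hgradf : MemLp (fun x => (Real.sqrt (1 - c x))⁻¹ • gradient f x) 2
      (volume.restrict (Ω \ ΩK))) :
    (∀ φ : weightedSobolevZero (Ω \ ΩK) (frontier ΩK) c,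
      IntegrableOn (fun x => g x * (sobolevFun φ) x) (Ω \ ΩK) volume ∧
      (∀ᵐ x ∂neumannMeasure Ω ΩK, normalDerivative Ω f x ≠ 0 →
        ∃ a, HasTraceAt (Ω \ ΩK) (sobolevFun φ) x a) ∧
      Integrable (fun x => -normalDerivative Ω f x * boundaryTrace (Ω \ ΩK) (sobolevFun φ) x)
        (neumannMeasure Ω ΩK)) ∧
    ∃ F : weightedSobolevZero (Ω \ ΩK) (frontier ΩK) c →L[ℝ] ℝ,
      (∀ φ, F φ = rhsFunctional Ω ΩK c f g φ) ∧
      ‖F‖ ≤ (eLpNorm g 2 (volume.restrict (Ω \ ΩK))).toReal +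
        (eLpNorm (Laplacian.laplacian f) 2 (volume.restrict (Ω \ ΩK))).toReal +
        (eLpNorm (fun x => (Real.sqrt (1 - c x))⁻¹ • gradient f x) 2
          (volume.restrict (Ω \ ΩK))).toReal := by
  have hK := isClosed_of_disjoint_frontier hΩ_open hK_sub.subset hK_closed h_disj
  have hU : IsOpen (Ω \ ΩK) := hΩ_open.sdiff hK
  have ha : AEMeasurable (fun x => 1 - c x) (volume.restrict (Ω \ ΩK)) :=
    hc_weak.1.aestronglyMeasurable.aemeasurable.const_sub 1
  have hpos : ∀ᵐ x ∂volume.restrict (Ω \ ΩK), 0 < 1 - c x := hc_lt.mono fun x hx => sub_pos.2 hx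
  have key : ∀ φ : weightedSobolevZero (Ω \ ΩK) (frontier ΩK) c,
      (∀ᵐ x ∂neumannMeasure Ω ΩK, normalDerivative Ω f x ≠ 0 →
        ∃ a, HasTraceAt (Ω \ ΩK) (sobolevFun φ) x a) ∧
      Integrable (fun x => -normalDerivative Ω f x * boundaryTrace (Ω \ ΩK) (sobolevFun φ) x)
        (neumannMeasure Ω ΩK) ∧
      ∫ x, -normalDerivative Ω f x * boundaryTrace (Ω \ ΩK) (sobolevFun φ) x
          ∂neumannMeasure Ω ΩK =
        -(∫ x in Ω \ ΩK, ⟪gradient f x, (φ : WeightedPair (Ω \ ΩK) c).snd x⟫) -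
          ∫ x in Ω \ ΩK, Laplacian.laplacian f x * sobolevFun φ x := by
    intro φ
    obtain ⟨⟨G, hw, hpG⟩, h0⟩ := φ.2
    -- The second component of φ equals G only up to null sets of the weight; positivity of 1 - c
    -- upgrades this to Lebesgue measure.
    have hGe := ae_of_ae_withDensity_ofReal ha hpos hpG
    have hu2 : MemLp (sobolevFun φ) 2 (volume.restrict (Ω \ ΩK)) := Lp.memLp _
    have hfG : IntegrableOn (fun y => ‖gradient f y‖ * ‖G y‖) (Ω \ ΩK) volume :=
      integrable_norm_mul_norm_of_withDensity ha hpos hgradf ((Lp.memLp _).ae_eq hpG)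
    obtain ⟨h1, h2, h3⟩ := green_formula hΩ_open hΩ_bdd hΩ_smooth hK_sub.subset hK hK_smooth h_disj
      hf hu2 hw hfG h0
    refine ⟨h1, h2, h3.trans ?_⟩
    -- Measurability of ∇f is recovered from that of ∇f/√(1-c).
    have hgm : AEStronglyMeasurable (gradient f) (volume.restrict (Ω \ ΩK)) := by
      refine (ha.sqrt.aestronglyMeasurable.smul hgradf.1).congr ?_
      filter_upwards [hpos] with x hx
      exact smul_inv_smul₀ (Real.sqrt_pos.2 hx).ne' _
    have hi : IntegrableOn (fun y => ⟪gradient f y, G y⟫) (Ω \ ΩK) volume :=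
      Integrable.mono' hfG (hgm.inner hw.2.aestronglyMeasurable)
        (Eventually.of_forall fun y => norm_inner_le_norm _ _)
    have hm : IntegrableOn (fun y => Laplacian.laplacian f y * sobolevFun φ y) (Ω \ ΩK) volume :=
      hΔf.integrable_mul hu2
    rw [integral_add hi hm, neg_add, ← sub_eq_add_neg]
    congr 2
    refine integral_congr_ae ?_
    filter_upwards [hGe] with x hx
    rw [hx]
  have hgi : ∀ φ : weightedSobolevZero (Ω \ ΩK) (frontier ΩK) c,
      IntegrableOn (fun x => g x * (sobolevFun φ) x) (Ω \ ΩK) volume := fun φ =>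
    hg.integrable_mul (Lp.memLp (φ : WeightedPair (Ω \ ΩK) c).fst)
  refine ⟨fun φ => ⟨hgi φ, (key φ).1, (key φ).2.1⟩, ?_⟩
  have hq := MemLp.inv_smul_withDensity ha hpos hgradf
  -- The functional is represented by g, Δf and, in the weighted space, ∇f/(1-c), whose weighted
  -- norm is the L² norm of ∇f/√(1-c).
  obtain ⟨F, hF, hFn⟩ := exists_clm_prod (weightedSobolevZero (Ω \ ΩK) (frontier ΩK) c)
    (hg.toLp g) (hΔf.toLp _) (hq.toLp _)
  refine ⟨F, fun φ => ?_, ?_⟩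
  · rw [hF, L2_inner_toLp_eq, L2_inner_toLp_eq, L2_inner_toLp_eq,
      integral_inner_withDensity ha hpos, rhsFunctional, (key φ).2.2]
    simp only [RCLike.inner_apply', sobolevFun, conj_trivial]
    ring
  · rwa [Lp.norm_toLp, Lp.norm_toLp, Lp.norm_toLp,
      eLpNorm_two_inv_smul_withDensity ha hpos hgradf.1] at hFn
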